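/- For a prime $p$ and a divisor $q$ of $p-1$, let $G=\mathbb Z_q\ltimes\mathbb Z_p$ be the $q$-hedral group: the group of all maps $(a,b):x\mapsto ax+b$ on $\mathbb Z_p$ with $b\in\mathbb Z_p$ and $a$ in the subgroup of order $q$ of $\mathbb Z_p^*$, so that $(a_1,b_1)(a_2,b_2)=(a_1a_2,\,b_1+a_1b_2)$. An element $(a,b)$ is encoded by the binary representations of the residues $a$ and $b$. A quantum circuit consists of a finite number of qubits, initially $|0\cdots0\rangle$, and a finite list of gates, each of which is a unitary operation on at most two qubits or an oracle query $|x\rangle|y\rangle\mapsto|x\rangle|y\oplus F(x)\rangle$, followed by a measurement of its output qubits in the computational basis; its size is the number of its qubits plus the number of its gates. A function $f$ on $G$ hides a subgroup $K$ if it is constant on each left coset of $K$ and takes distinct values on distinct left cosets. Theorem. The hidden conjugates of non-normal subgroups $H\le\mathbb Z_q\ltimes\mathbb Z_p$ whose image in $\mathbb Z_p^*$ has index $\mathrm{polylog}(p)$ are fully reconstructible. Precisely, for all $A,d\in\mathbb N$ there are $B,e\in\mathbb N$ such that the following holds for every prime $p$, every $q\mid p-1$, every non-normal subgroup $H$ of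 $G=\mathbb Z_q\ltimes\mathbb Z_p$ whose image $\{a:(a,b)\in H\}$ has index at most $A(\log p)^d$ in $\mathbb Z_p^*$, and all $m,k\in\mathbb N$. There is a quantum circuit of size at most $B(\log|G|+m+k)^e$ such that for every $b\in G$ there is exactly one $c\in\mathbb Z_p$ with $(1,c)H(1,c)^{-1}=bHb^{-1}$, and whenever the oracle $F$ computes, on the encodings of the elements of $G$, a function $f:G\to\{0,1\}^m$ that hides $bHb^{-1}$, the circuit outputs this $c$ (in binary) with probability at least $1-2^{-k}$. In particular, if $b$ is the translation $(1,\beta)$, the circuit identifies $\beta$. -/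

import Mathlib

/-!  Semidirect products `ℤ_q ⋉ ℤ_p`, quantum circuits with an oracle, and hidden conjugates. -/

noncomputable section

/-- The action of `ℤ_pˣ` on `ℤ_p` by multiplication, as automorphisms of the additive group `ℤ_p`
(written multiplicatively). -/
def dilation (p : ℕ) : (ZMod p)ˣ →* MulAut (Multiplicative (ZMod p)) where
  toFun a :=
    { toFun := fun x => Multiplicative.ofAdd ((a : ZMod p) * x.toAdd)
      invFun := fun x => Multiplicative.ofAdd (((a⁻¹ : (ZMod p)ˣ) : ZMod p) * x.toAdd)
      left_inv := fun x => by simp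
      right_inv := fun x => by simp
      map_mul' := fun x y => by simp [mul_add] }
  map_one' := by ext x; simp
  map_mul' a b := by ext x; simp [mul_assoc]

/-- The `q`-hedral group `ℤ_q ⋉ ℤ_p` (for `p` prime and `q ∣ p - 1`): all maps `x ↦ a x + b` on
`ℤ_p`, where `b ∈ ℤ_p` and `a` runs through the subgroup of order `q` of the cyclic group `ℤ_pˣ`,
that is, through the solutions of `a ^ q = 1`.  The component `g.right` is `a`, and `g.left`
is `b`. -/
abbrev QHedral (p q : ℕ) : Type :=
  Multiplicative (ZMod p) ⋊[(dilation p).comp (rootsOfUnity q (ZMod p)).subtype]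
    rootsOfUnity q (ZMod p)

namespace QHedral

variable {p q : ℕ}

/-- The element `(a, b)` of `ℤ_q ⋉ ℤ_p`, the map `x ↦ a x + b`. -/
def mk (a : rootsOfUnity q (ZMod p)) (b : ZMod p) : QHedral p q := ⟨Multiplicative.ofAdd b, a⟩

/-- The translation `(1, b)`. -/
def translation (b : ZMod p) : QHedral p q := mk 1 b

/-- The homomorphism `(a, b) ↦ a` to `ℤ_pˣ`. -/
def linearPart (p q : ℕ) : QHedral p q →* (ZMod p)ˣ :=
  (rootsOfUnity q (ZMod p)).subtype.comp SemidirectProduct.rightHom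

/-- The multiplication law `(a₁, b₁) (a₂, b₂) = (a₁ a₂, b₁ + a₁ b₂)`. -/
theorem mk_mul_mk (a₁ a₂ : rootsOfUnity q (ZMod p)) (b₁ b₂ : ZMod p) :
    mk a₁ b₁ * mk a₂ b₂ = mk (a₁ * a₂) (b₁ + ((a₁ : (ZMod p)ˣ) : ZMod p) * b₂) := rfl

end QHedral

/-- Length of the binary representation of residues modulo `p`. -/
abbrev bitLen (p : ℕ) : ℕ := Nat.size p

/-- Binary representation of the residue `x`, taken in `{0, …, p - 1}`. -/
def residueBits {p : ℕ} (x : ZMod p) : Fin (bitLen p) → Bool := fun i => x.val.testBit i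

/-- The bit string that represents the group element `(a, b)`: the residues `a` and `b` in
binary, next to each other. -/
def QHedral.bits {p q : ℕ} (g : QHedral p q) : Fin (bitLen p) ⊕ Fin (bitLen p) → Bool :=
  Sum.elim (residueBits ((g.right : (ZMod p)ˣ) : ZMod p)) (residueBits g.left.toAdd)

/-! ### Quantum circuits -/

/-- A gate on `w` qubits: an arbitrary unitary operation on at most two qubits, or a query to the
oracle `F : {0,1}^ι → {0,1}^κ`, with argument and answer on chosen distinct qubits. -/
inductive QGate (ι κ : Type) (w : ℕ) : Type
  | unitary (k : ℕ) (hk : k ≤ 2) (e : Fin k ↪ Fin w)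
      (U : Matrix.unitaryGroup (Fin k → Bool) ℂ) : QGate ι κ w
  | query (e : ι ⊕ κ ↪ Fin w) : QGate ι κ w

/-- The amplitudes of a (pure) state of `w` qubits in the computational basis. -/
abbrev QState (w : ℕ) : Type := (Fin w → Bool) → ℂ

/-- The action of a gate on states.  A unitary `U` acts on the qubits `e 0, …, e (k - 1)` and as
the identity on the others.  A query is the map `|x⟩ |y⟩ ↦ |x⟩ |y ⊕ F x⟩` (its own inverse)
on the selected qubits. -/
def QGate.apply {ι κ : Type} {w : ℕ} (F : (ι → Bool) → (κ → Bool)) :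
    QGate ι κ w → QState w → QState w
  | .unitary _ _ e U, ψ => fun s =>
      ∑ z, (U : Matrix _ _ ℂ) (fun i => s (e i)) z * ψ (Function.extend e z s)
  | .query e, ψ => fun s =>
      ψ (Function.extend (fun j : κ => e (.inr j))
        (fun j => xor (s (e (.inr j))) (F (fun i => s (e (.inl i))) j)) s)

/-- A quantum circuit with oracle queries `{0,1}^ι → {0,1}^κ` and outputs in `{0,1}^ο`: a number of
qubits, a list of gates, which are applied from left to right, and the qubits that are
measured at the end. -/
structure QCircuit (ι κ ο : Type) : Type where
  width : ℕ
  gates : List (QGate ι κ width)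
  out : ο ↪ Fin width

namespace QCircuit

variable {ι κ ο : Type}

/-- The size of a circuit: the number of its qubits plus the number of its gates, where each
query counts as one gate. -/
def size (C : QCircuit ι κ ο) : ℕ := C.width + C.gates.length

/-- The state that the circuit produces from `|0…0⟩` with the oracle `F`. -/
def finalState (C : QCircuit ι κ ο) (F : (ι → Bool) → (κ → Bool)) : QState C.width :=
  C.gates.foldl (fun ψ g => g.apply F ψ) (Pi.single (fun _ => false) 1)

open scoped Classical in
/-- The probability that measuring the output qubits at the end gives `y`. -/
def prob (C : QCircuit ι κ ο) (F : (ι → Bool) → (κ → Bool)) (y : ο → Bool) : ℝ :=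
  ∑ s : Fin C.width → Bool, if (fun i => s (C.out i)) = y then ‖C.finalState F s‖ ^ 2 else 0

end QCircuit

/-! ### Hidden subgroups -/

/-- `f` hides the subgroup `K`: it is constant on each left coset of `K`, and has distinct values on
distinct left cosets. -/
def Hides {G S : Type} [Group G] (f : G → S) (K : Subgroup G) : Prop :=
  ∀ g g' : G, f g = f g' ↔ (QuotientGroup.mk g : G ⧸ K) = QuotientGroup.mk g'

/-- The conjugate `b H b⁻¹`. -/
def conjSubgroup {G : Type} [Group G] (b : G) (H : Subgroup G) : Subgroup G :=
  H.map (MulAut.conj b).toMonoidHom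

end

/-! A non-normal `H` contains no translation except the identity. Indeed one translation generates
all of them because `p` is prime, and a subgroup containing all translations is normal because the
quotient is abelian. So commutators in `H` are trivial, and `H` consists of the maps that fix one
point `s` and have linear part in a nontrivial group `M`, of order `r` say
(`QHedral.exists_fixed_point`). In `b H b⁻¹` the point `s` is replaced by `t = b(s)`. Hence `c = t -
s`, and for `a, a'` in `M` a hiding function satisfies `f(a, x) = f(a', x')` iff `x + a t = x' + a'
t` (`QHedral.Hides.apply_pairBits_eq_iff`).

One round (`exists_trial_gates`) superposes all pairs `(a, x)`, flags those with `a ^ r = 1`,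
queries the oracle, applies the Fourier transform modulo `Q = 2 ^ n` to both registers and measures.
With the flag raised and answer `f(1, z)`, the surviving pairs form the line `x + a t = z + t`, `a ∈
M`. At the frequencies `(U, V)` obtained by rounding up `Q · vt / p` and `Q · v / p`, with `vt` and
`v` reduced modulo `p`, all phases are close to `v (z + t) / p`, so the amplitudes add up
(`norm_sum_turn_ge`). Rounding back yields `vt` and `v`, and their quotient is `t`. Summing over `v
≠ 0` and `z`, a round succeeds with probability at least `1 / (65536 I²)`, where `I` is the index of
`M` (`success_probability_ge`); this is inverse polylogarithmic.

A candidate `u` is checked by two queries: for a fixed `a ≠ 1` in `M`, `f(1, -u) = f(a, -a u)` iff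
`u = t` (`verified_iff`). Running `65536 I² (k + 1)` rounds coherently and combining the verified
candidates gives failure probability at most `2 ^ (-k)` (`exists_repeated_circuit`,
`exists_reconstruction_circuit`). The data `r`, `a`, `s` of `H` are hard-wired into the circuit.

The classical parts are Boolean straight-line programs (`Comp`), which become reversible circuits
that restore their auxiliary wires (`Comp.exists_xor`). Modular arithmetic is written as such
programs. -/

noncomputable section

/-! ### Circuits on an arbitrary type of wires -/

/-- The type of oracles. -/
abbrev Oracle (ι κ : Type) : Type := (ι → Bool) → (κ → Bool)

/-- The amplitudes of a state of the wires `W`. -/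
abbrev Ket (W : Type) : Type := (W → Bool) → ℂ

/-- The basis state `|0…0⟩`. -/
def zeroKet (W : Type) [DecidableEq W] [Fintype W] : Ket W := Pi.single (fun _ => false) 1

/-- A gate on the wires `W`: a controlled one-qubit operation or an oracle query. -/
inductive WireGate (ι κ W : Type) : Type
  | ctrl (w a : W) (h : a ≠ w) (M : Bool → Matrix.unitaryGroup Bool ℂ) : WireGate ι κ W
  | query (e : ι ⊕ κ ↪ W) : WireGate ι κ W

/-- Apply to the wire `w` the operation `N s`, which may depend on the other wires. -/
def act {W : Type} [DecidableEq W] (w : W) (N : (W → Bool) → Matrix Bool Bool ℂ) (ψ : Ket W) :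
    Ket W :=
  fun s => ∑ z, N s (s w) z * ψ (Function.update s w z)

/-- The classical action of an oracle query. -/
def queryMap {ι κ W : Type} (e : ι ⊕ κ ↪ W) (F : Oracle ι κ) (s : W → Bool) : W → Bool :=
  Function.extend (fun j : κ => e (.inr j))
    (fun j => xor (s (e (.inr j))) (F (fun i => s (e (.inl i))) j)) s

theorem queryMap_arg {ι κ W : Type} (e : ι ⊕ κ ↪ W) (F : Oracle ι κ) (s : W → Bool) (i : ι) :
    queryMap e F s (e (.inl i)) = s (e (.inl i)) := by
  unfold queryMap
  rw [Function.extend_apply']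
  rintro ⟨j, hj⟩
  simpa using e.injective hj

theorem queryMap_ans {ι κ W : Type} (e : ι ⊕ κ ↪ W) (F : Oracle ι κ) (s : W → Bool) (j : κ) :
    queryMap e F s (e (.inr j)) = xor (s (e (.inr j))) (F (fun i => s (e (.inl i))) j) :=
  Function.Injective.extend_apply (f := fun j : κ => e (.inr j))
    (fun i j h => by simpa using h) _ _ j

theorem queryMap_of_ne {ι κ W : Type} (e : ι ⊕ κ ↪ W) (F : Oracle ι κ) (s : W → Bool) {w : W}
    (hw : ∀ j, w ≠ e (.inr j)) : queryMap e F s w = s w :=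
  Function.extend_apply' _ _ _ fun ⟨j, hj⟩ => hw j hj.symm

theorem queryMap_involutive {ι κ W : Type} (e : ι ⊕ κ ↪ W) (F : Oracle ι κ) :
    Function.Involutive (queryMap e F) := by
  intro s
  funext v
  by_cases hv : ∃ j, e (.inr j) = v
  · obtain ⟨j, rfl⟩ := hv
    rw [queryMap_ans, queryMap_ans]
    simp [queryMap_arg]
  · have hv' : ∀ j, v ≠ e (.inr j) := fun j h => hv ⟨j, h.symm⟩
    rw [queryMap_of_ne _ _ _ hv', queryMap_of_ne _ _ _ hv']

/-- An oracle query as a permutation of the basis states. -/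
def queryPerm {ι κ W : Type} (e : ι ⊕ κ ↪ W) (F : Oracle ι κ) : Equiv.Perm (W → Bool) :=
  (queryMap_involutive e F).toPerm

namespace WireGate

variable {ι κ W : Type} [DecidableEq W]

/-- The action of a gate on states. -/
def apply (F : Oracle ι κ) : WireGate ι κ W → Ket W → Ket W
  | .ctrl w a _ M, ψ => act w (fun s => (M (s a) : Matrix Bool Bool ℂ)) ψ
  | .query e, ψ => fun s => ψ (queryMap e F s)

/-- The action of a list of gates, from left to right. -/
def run (F : Oracle ι κ) (l : List (WireGate ι κ W)) (ψ : Ket W) : Ket W :=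
  l.foldl (fun ψ g => g.apply F ψ) ψ

@[simp] theorem run_nil (F : Oracle ι κ) (ψ : Ket W) :
    run F ([] : List (WireGate ι κ W)) ψ = ψ := rfl

@[simp] theorem run_cons (F : Oracle ι κ) (g : WireGate ι κ W) (l : List (WireGate ι κ W))
    (ψ : Ket W) : run F (g :: l) ψ = run F l (g.apply F ψ) := rfl

theorem run_append (F : Oracle ι κ) (l l' : List (WireGate ι κ W)) (ψ : Ket W) :
    run F (l ++ l') ψ = run F l' (run F l ψ) := by
  simp [run]

end WireGate

/-! ### From abstract wires to numbered qubits and two-qubit unitaries -/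

section Transport

/-- The block-diagonal two-qubit unitary with blocks `M false` and `M true`; qubit `0` is the
target and qubit `1` the control. -/
def controlledUnitary (M : Bool → Matrix.unitaryGroup Bool ℂ) :
    Matrix.unitaryGroup (Fin 2 → Bool) ℂ :=
  ⟨(Matrix.blockDiagonal fun b => (M b : Matrix Bool Bool ℂ)).submatrix
      (finTwoArrowEquiv Bool) (finTwoArrowEquiv Bool), by
    rw [Matrix.mem_unitaryGroup_iff, Matrix.star_eq_conjTranspose, Matrix.conjTranspose_submatrix,
      Matrix.submatrix_mul_equiv, Matrix.blockDiagonal_conjTranspose, ← Matrix.blockDiagonal_mul]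
    have h : (fun b => (M b : Matrix Bool Bool ℂ) * (M b : Matrix Bool Bool ℂ).conjTranspose)
        = 1 := by
      funext b
      exact Matrix.mem_unitaryGroup_iff.mp (M b).2
    rw [h, Matrix.blockDiagonal_one, Matrix.submatrix_one_equiv]⟩

/-- Two distinct elements as an embedding of `Fin 2`. -/
def pairEmbedding {α : Type} (x y : α) (h : x ≠ y) : Fin 2 ↪ α where
  toFun := ![x, y]
  inj' := by
    intro i j hij
    fin_cases i <;> fin_cases j <;> simp_all [h.symm]

theorem pairEmbedding_zero {α : Type} (x y : α) (h : x ≠ y) : pairEmbedding x y h 0 = x := rfl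

theorem pairEmbedding_one {α : Type} (x y : α) (h : x ≠ y) : pairEmbedding x y h 1 = y := rfl

variable {ι κ W : Type} [DecidableEq W] {n : ℕ}

/-- The same gate on numbered qubits. -/
def WireGate.toQGate (ε : W ≃ Fin n) : WireGate ι κ W → QGate ι κ n
  | .ctrl w a h M => .unitary 2 le_rfl
      (pairEmbedding (ε w) (ε a) fun hwa => h (ε.injective hwa.symm)) (controlledUnitary M)
  | .query e => .query (e.trans ε.toEmbedding)

theorem WireGate.apply_toQGate (ε : W ≃ Fin n) (F : Oracle ι κ) (g : WireGate ι κ W) (ψ : Ket W) :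
    (g.toQGate ε).apply F (fun s => ψ (s ∘ ε)) = fun s => g.apply F ψ (s ∘ ε) := by
  cases g with
  | ctrl w a h M =>
    funext s
    have hwa : ε w ≠ ε a := fun hwa => h (ε.injective hwa.symm)
    have hext : ∀ z : Fin 2 → Bool, z 1 = s (ε a) →
        (Function.extend (pairEmbedding _ _ hwa) z s) ∘ ε = Function.update (s ∘ ε) w (z 0) := by
      intro z hz
      have hinj := (pairEmbedding _ _ hwa).injective
      funext v
      by_cases hv : v = w
      · subst hv
        rw [Function.update_self]
        exact hinj.extend_apply z s 0
      · by_cases hva : v = a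
        · subst hva
          rw [Function.update_of_ne hv]
          exact (hinj.extend_apply z s 1).trans hz
        · rw [Function.update_of_ne hv, Function.comp_apply, Function.extend_apply']
          · rfl
          · rintro ⟨i, hi⟩
            fin_cases i
            · exact hv (ε.injective hi.symm)
            · exact hva (ε.injective hi.symm)
    have hmat : ∀ x y : Fin 2 → Bool, (controlledUnitary M : Matrix _ _ ℂ) x y =
        if x 1 = y 1 then (M (x 1) : Matrix Bool Bool ℂ) (x 0) (y 0) else 0 := fun x y => rfl
    simp only [toQGate, QGate.apply, apply, act, hmat, pairEmbedding_zero, pairEmbedding_one]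
    rw [← (finTwoArrowEquiv Bool).symm.sum_comp, Fintype.sum_prod_type]
    refine Finset.sum_congr rfl fun z _ => ?_
    -- By block-diagonality only the terms that keep the control bit contribute.
    rw [Finset.sum_eq_single (s (ε a))]
    · rw [hext _ rfl]
      simp [finTwoArrowEquiv]
    · intro b _ hb
      simp [finTwoArrowEquiv, hb.symm]
    · simp
  | query e =>
    funext s
    simp only [toQGate, QGate.apply, apply, queryMap]
    congr 1
    funext v
    simp only [Function.comp_apply]
    have hinj : Function.Injective fun j : κ => e (.inr j) := fun i j h => by simpa using h
    have hinj' : Function.Injective fun j : κ => (e.trans ε.toEmbedding) (.inr j) :=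
      fun i j h => by simpa using h
    by_cases hv : ∃ j, e (.inr j) = v
    · obtain ⟨j, rfl⟩ := hv
      rw [hinj.extend_apply]
      exact hinj'.extend_apply _ _ j
    · rw [Function.extend_apply' _ _ _ hv, Function.extend_apply']
      · rfl
      · rintro ⟨j, hj⟩
        exact hv ⟨j, ε.injective (by simpa using hj)⟩

theorem WireGate.run_toQGate (ε : W ≃ Fin n) (F : Oracle ι κ) (l : List (WireGate ι κ W))
    (ψ : Ket W) :
    (l.map (WireGate.toQGate ε)).foldl (fun ψ g => g.apply F ψ) (fun s => ψ (s ∘ ε)) =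
      fun s => WireGate.run F l ψ (s ∘ ε) := by
  induction l generalizing ψ with
  | nil => rfl
  | cons g l ih =>
    simp only [List.map_cons, List.foldl_cons, WireGate.apply_toQGate, ih, WireGate.run_cons]

open scoped Classical in
/-- A list of gates on finitely many wires gives a circuit with the same output distribution. -/
theorem exists_circuit_of_wireGates [Fintype W] {ο : Type} (l : List (WireGate ι κ W))
    (out : ο ↪ W) :
    ∃ C : QCircuit ι κ ο, C.size = Fintype.card W + l.length ∧
      ∀ F y, C.prob F y = ∑ s : W → Bool, if (fun i => s (out i)) = y
        then ‖WireGate.run F l (zeroKet W) s‖ ^ 2 else 0 := by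
  let ε := Fintype.equivFin W
  refine ⟨⟨Fintype.card W, l.map (WireGate.toQGate ε), out.trans ε.toEmbedding⟩, ?_, ?_⟩
  · simp [QCircuit.size]
  · intro F y
    have hz : (Pi.single (fun _ => false) 1 : QState (Fintype.card W)) =
        fun s => zeroKet W (s ∘ ε) := by
      funext s
      simp only [zeroKet, Pi.single_apply]
      congr 1
      refine propext ⟨fun h => by subst h; rfl, fun h => ?_⟩
      funext i
      simpa using congrFun h (ε.symm i)
    simp only [QCircuit.prob, QCircuit.finalState]
    rw [hz]
    simp only [WireGate.run_toQGate]
    rw [← (Equiv.arrowCongr ε (Equiv.refl Bool)).sum_comp]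
    refine Finset.sum_congr rfl fun s _ => ?_
    have : (Equiv.arrowCongr ε (Equiv.refl Bool)) s ∘ ε = s := by
      funext v; simp [Equiv.arrowCongr]
    rw [this]
    simp [Equiv.arrowCongr]

end Transport

/-! ### Norm -/

section Norm

variable {ι κ W : Type} [DecidableEq W]

/-- Negate one wire. -/
def flipWire (w : W) : Equiv.Perm (W → Bool) :=
  Function.Involutive.toPerm (fun s => Function.update s w (!s w)) fun s => by simp

/-- Unitarity on the two amplitudes that differ in the target bit, ordered so that it applies
whichever value that bit has. -/
theorem act_flip_norm (M : Matrix.unitaryGroup Bool ℂ) (x : Bool → ℂ) (b : Bool) :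
    ‖∑ z, (M : Matrix Bool Bool ℂ) b z * x z‖ ^ 2 + ‖∑ z, (M : Matrix Bool Bool ℂ) (!b) z * x z‖ ^ 2
      = ‖x b‖ ^ 2 + ‖x (!b)‖ ^ 2 := by
  have key : ∑ c, ‖∑ z, (M : Matrix Bool Bool ℂ) c z * x z‖ ^ 2 = ∑ c, ‖x c‖ ^ 2 := by
    have h : star ((M : Matrix Bool Bool ℂ).mulVec x) ⬝ᵥ ((M : Matrix Bool Bool ℂ).mulVec x)
        = star x ⬝ᵥ x := by
      rw [Matrix.star_mulVec, ← Matrix.dotProduct_mulVec, Matrix.mulVec_mulVec,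
        ← Matrix.star_eq_conjTranspose, Matrix.mem_unitaryGroup_iff'.mp M.2, Matrix.one_mulVec]
    have e : ∀ y : Bool → ℂ, star y ⬝ᵥ y = ((∑ c, ‖y c‖ ^ 2 : ℝ) : ℂ) := by
      intro y
      simp only [dotProduct, Pi.star_apply, RCLike.star_def]
      push_cast
      exact Finset.sum_congr rfl fun c _ => Complex.conj_mul' (y c)
    rw [e, e] at h
    exact_mod_cast h
  simp only [Fintype.sum_bool] at key ⊢
  cases b
  · simp only [Bool.not_false]; linarith
  · simp only [Bool.not_true]; linarith

theorem sum_norm_act [Fintype W] (w a : W) (h : a ≠ w) (M : Bool → Matrix.unitaryGroup Bool ℂ)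
    (ψ : Ket W) :
    ∑ s, ‖act w (fun s => (M (s a) : Matrix Bool Bool ℂ)) ψ s‖ ^ 2 = ∑ s, ‖ψ s‖ ^ 2 := by
  -- Counting each pair of a state and its flip twice avoids choosing representatives.
  have h2 : ∀ f : (W → Bool) → ℝ, 2 * ∑ s, f s = ∑ s, (f s + f (flipWire w s)) := by
    intro f
    rw [Finset.sum_add_distrib, Equiv.sum_comp (flipWire w) f, two_mul]
  have : 2 * ∑ s, ‖act w (fun s => (M (s a) : Matrix Bool Bool ℂ)) ψ s‖ ^ 2
      = 2 * ∑ s, ‖ψ s‖ ^ 2 := by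
    rw [h2, h2]
    refine Finset.sum_congr rfl fun s _ => ?_
    have := act_flip_norm (M (s a)) (fun z => ψ (Function.update s w z)) (s w)
    simp only [Function.update_eq_self] at this
    simpa [act, flipWire, Function.Involutive.toPerm, Function.update_of_ne h] using this
  linarith

theorem WireGate.sum_norm_run [Fintype W] (F : Oracle ι κ) (l : List (WireGate ι κ W)) (ψ : Ket W) :
    ∑ s, ‖run F l ψ s‖ ^ 2 = ∑ s, ‖ψ s‖ ^ 2 := by
  induction l generalizing ψ with
  | nil => rfl
  | cons g l ih =>
    rw [run_cons, ih]
    cases g with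
    | ctrl w a h M => exact sum_norm_act w a h M ψ
    | query e => exact Equiv.sum_comp (queryPerm e F) fun s => ‖ψ s‖ ^ 2

end Norm

/-! ### Classical computation -/

section Classical

variable {ι κ W : Type} [DecidableEq W]

/-- Both the permutation `σ` of the basis states and its inverse are performed by at most `c` gates,
which do not depend on the oracle. -/
def Realizable (c : ℕ) (σ : Oracle ι κ → Equiv.Perm (W → Bool)) : Prop :=
  ∃ l l' : List (WireGate ι κ W), l.length ≤ c ∧ l'.length ≤ c ∧ ∀ F ψ,
    WireGate.run F l ψ = ψ ∘ (σ F).symm ∧ WireGate.run F l' ψ = ψ ∘ σ F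

namespace Realizable

theorem one : Realizable (ι := ι) (κ := κ) (W := W) 0 (fun _ => 1) :=
  ⟨[], [], le_rfl, le_rfl, fun _ _ => ⟨rfl, rfl⟩⟩

theorem mul {c d : ℕ} {σ τ : Oracle ι κ → Equiv.Perm (W → Bool)} (hσ : Realizable c σ)
    (hτ : Realizable d τ) : Realizable (c + d) (fun F => τ F * σ F) := by
  obtain ⟨l₁, l₁', h₁, h₁', e₁⟩ := hσ
  obtain ⟨l₂, l₂', h₂, h₂', e₂⟩ := hτ
  refine ⟨l₁ ++ l₂, l₂' ++ l₁', by simp; omega, by simp; omega, fun F ψ => ⟨?_, ?_⟩⟩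
  · rw [WireGate.run_append, (e₁ F ψ).1, (e₂ F _).1]; rfl
  · rw [WireGate.run_append, (e₂ F ψ).2, (e₁ F _).2]; rfl

theorem inv {c : ℕ} {σ : Oracle ι κ → Equiv.Perm (W → Bool)} (hσ : Realizable c σ) :
    Realizable c (fun F => (σ F)⁻¹) := by
  obtain ⟨l, l', h, h', e⟩ := hσ
  exact ⟨l', l, h', h, fun F ψ => ⟨(e F ψ).2, (e F ψ).1⟩⟩

theorem mono {c d : ℕ} {σ : Oracle ι κ → Equiv.Perm (W → Bool)} (hσ : Realizable c σ)
    (hcd : c ≤ d) : Realizable d σ := by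
  obtain ⟨l, l', h, h', e⟩ := hσ
  exact ⟨l, l', h.trans hcd, h'.trans hcd, e⟩

theorem query (e : ι ⊕ κ ↪ W) : Realizable 1 (queryPerm e) :=
  ⟨[.query e], [.query e], le_rfl, le_rfl, fun _ _ => ⟨rfl, rfl⟩⟩

end Realizable

/-- A square root of the negation gate. -/
def sqrtNot : Matrix.unitaryGroup Bool ℂ :=
  ⟨Matrix.of fun i j => if i = j then (1 + Complex.I) / 2 else (1 - Complex.I) / 2, by
    rw [Matrix.mem_unitaryGroup_iff]
    ext i j
    cases i <;> cases j <;>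
      simp [Matrix.mul_apply, map_ofNat, Complex.ext_iff, Complex.div_ofNat_re,
        Complex.div_ofNat_im] <;>
      norm_num⟩

theorem sqrtNot_sq_apply (i j : Bool) :
    ((sqrtNot ^ 2 : Matrix.unitaryGroup Bool ℂ) : Matrix Bool Bool ℂ) i j =
      if i = j then 0 else 1 := by
  rw [pow_two]
  cases i <;> cases j <;>
    simp [sqrtNot, Matrix.mul_apply, Complex.ext_iff, Complex.div_ofNat_re, Complex.div_ofNat_im] <;>
    norm_num

theorem sqrtNot_pow_four : sqrtNot ^ 4 = 1 := by
  ext i j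
  rw [show 4 = 2 + 2 from rfl, pow_add, Matrix.UnitaryGroup.mul_val, Matrix.mul_apply]
  simp only [sqrtNot_sq_apply, Fintype.sum_bool]
  cases i <;> cases j <;> simp

theorem act_act (w : W) (N N' : (W → Bool) → Matrix Bool Bool ℂ)
    (hN : ∀ s z, N (Function.update s w z) = N s) (ψ : Ket W) :
    act w N' (act w N ψ) = act w (fun s => N' s * N s) ψ := by
  funext s
  simp only [act, hN, Function.update_self, Function.update_idem, Matrix.mul_apply,
    Fintype.sum_bool]
  ring

theorem act_not (w : W) (h : (W → Bool) → Bool) (ψ : Ket W) :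
    act w (fun s => ((sqrtNot ^ (if h s then 2 else 0) : Matrix.unitaryGroup Bool ℂ) :
      Matrix Bool Bool ℂ)) ψ = fun s => ψ (Function.update s w (xor (s w) (h s))) := by
  funext s
  cases hs : h s
  · cases hw : s w <;> simp [act, hs, hw]
  · cases hw : s w <;> simp [act, hs, hw, sqrtNot_sq_apply]

/-- It is used with `π` a CNOT, which makes the control wire hold `s a ⊕ s b` for the duration of
one gate. -/
theorem act_conj (w : W) (π : (W → Bool) → W → Bool) (hw : ∀ s, π s w = s w)
    (hu : ∀ s z, π (Function.update (π s) w z) = Function.update s w z)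
    (N : (W → Bool) → Matrix Bool Bool ℂ) (ψ : Ket W) :
    (fun s => act w N (fun s => ψ (π s)) (π s)) = act w (fun s => N (π s)) ψ := by
  funext s
  simp only [act, hw, hu]

/-- The basis change `s w ↦ s w ⊕ h (s a) (s b)`. -/
def bitPerm (w a b : W) (ha : a ≠ w) (hb : b ≠ w) (h : Bool → Bool → Bool) :
    Equiv.Perm (W → Bool) :=
  Function.Involutive.toPerm (fun s => Function.update s w (xor (s w) (h (s a) (s b)))) fun s => by
    simp [Function.update_of_ne ha, Function.update_of_ne hb]

theorem bitPerm_apply (w a b : W) (ha : a ≠ w) (hb : b ≠ w) (h : Bool → Bool → Bool)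
    (s : W → Bool) :
    bitPerm w a b ha hb h s = Function.update s w (xor (s w) (h (s a) (s b))) := rfl

/-- Modulo 4 one has `2xy = x + y - (x ⊕ y)`. Hence twice the polynomial of `h` splits into
functions of `x`, of `y` and of `x ⊕ y`. The sum of the four values of `h` has the parity of the
coefficient of `xy`, and `3` stands for `-1`. -/
theorem exists_phase_exponents (h : Bool → Bool → Bool) : ∃ e₁ e₂ e₃ : Bool → ℕ, ∀ x y,
    (e₃ (xor x y) + (e₂ y + e₁ x)) % 4 = if h x y then 2 else 0 := by
  refine ⟨fun x => 2 * (h x false).toNat +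
      ((h true true).toNat + (h true false).toNat + (h false true).toNat + (h false false).toNat) * x.toNat,
    fun y => if y then 2 * ((h false true).toNat + (h false false).toNat) +
      ((h true true).toNat + (h true false).toNat + (h false true).toNat + (h false false).toNat) else 0,
    fun z => if z then 3 * ((h true true).toNat + (h true false).toNat + (h false true).toNat +
      (h false false).toNat) else 0, ?_⟩
  intro x y
  cases x <;> cases y <;> dsimp only <;> cases h true true <;> cases h true false <;> cases h false true <;>
    cases h false false <;> rfl

theorem sqrtNot_pow_mod (k : ℕ) : sqrtNot ^ k = sqrtNot ^ (k % 4) := by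
  conv_lhs => rw [← Nat.div_add_mod k 4, pow_add, pow_mul, sqrtNot_pow_four, one_pow, one_mul]

/-- A three-wire operation from two-wire gates: powers of the square root of NOT, controlled by `a`,
by `b` and by `a ⊕ b`, multiply to the identity or to NOT. Two CNOTs put `a ⊕ b` on the wire `b` and
remove it again. -/
theorem realizable_bitPerm (w a b : W) (ha : a ≠ w) (hb : b ≠ w) (h : Bool → Bool → Bool) :
    Realizable (ι := ι) (κ := κ) 5 (fun _ => bitPerm w a b ha hb h) := by
  have inv : ∀ ψ : Ket W, ψ ∘ (bitPerm w a b ha hb h).symm =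
    ψ ∘ bitPerm w a b ha hb h := fun ψ => rfl
  suffices ∃ l : List (WireGate ι κ W), l.length ≤ 5 ∧ ∀ F ψ,
      WireGate.run F l ψ = ψ ∘ bitPerm w a b ha hb h by
    obtain ⟨l, hl, e⟩ := this
    exact ⟨l, l, hl, hl, fun F ψ => ⟨(e F ψ).trans (inv ψ).symm, e F ψ⟩⟩
  by_cases hab : a = b
  · subst hab
    refine ⟨[.ctrl w a ha fun x => sqrtNot ^ (if h x x then 2 else 0)], by simp, fun F ψ => ?_⟩
    exact act_not w (fun s => h (s a) (s a)) ψ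
  · obtain ⟨e₁, e₂, e₃, he⟩ := exists_phase_exponents h
    have cnot : ∀ F (ψ : Ket W), WireGate.apply F
        (.ctrl b a hab fun x => sqrtNot ^ (if x then 2 else 0) : WireGate ι κ W) ψ =
        fun s => ψ (Function.update s b (xor (s b) (s a))) := fun F ψ => act_not b (fun s => s a) ψ
    refine ⟨[.ctrl w a ha fun x => sqrtNot ^ e₁ x, .ctrl w b hb fun x => sqrtNot ^ e₂ x,
      .ctrl b a hab fun x => sqrtNot ^ (if x then 2 else 0), .ctrl w b hb fun x => sqrtNot ^ e₃ x,
      .ctrl b a hab fun x => sqrtNot ^ (if x then 2 else 0)], by simp, fun F ψ => ?_⟩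
    simp only [WireGate.run_cons, WireGate.run_nil, cnot]
    simp only [WireGate.apply]
    rw [act_act _ _ _ (by intro s z; simp [Function.update_of_ne ha]),
      act_conj w (fun s => Function.update s b (xor (s b) (s a)))
        (fun s => Function.update_of_ne hb.symm _ _) (fun s z => ?_),
      act_act _ _ _ (by intro s z; simp [Function.update_of_ne ha, Function.update_of_ne hb])]
    · refine Eq.trans ?_ (act_not w (fun s => h (s a) (s b)) ψ)
      congr 1
      funext s
      rw [← he, ← sqrtNot_pow_mod]
      simp [← pow_add, Bool.xor_comm (s b)]
    · rw [Function.update_of_ne hb, Function.update_of_ne ha, Function.update_self,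
        Function.update_of_ne hab, Function.update_comm hb, Function.update_idem]
      simp [Function.update_of_ne hb]

theorem realizable_copies {J : Type} [Fintype J] (src dst : J → W)
    (hdst : Function.Injective dst) (hne : ∀ i j, src i ≠ dst j) :
    ∃ π : Equiv.Perm (W → Bool),
      Realizable (ι := ι) (κ := κ) (5 * Fintype.card J) (fun _ => π) ∧
      ∀ s, (∀ j, π s (dst j) = xor (s (dst j)) (s (src j))) ∧
        ∀ w, (∀ j, w ≠ dst j) → π s w = s w := by
  classical
  suffices ∀ T : Finset J, ∃ π : Equiv.Perm (W → Bool),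
      Realizable (ι := ι) (κ := κ) (5 * T.card) (fun _ => π) ∧
      ∀ s, (∀ j ∈ T, π s (dst j) = xor (s (dst j)) (s (src j))) ∧
        ∀ w, (∀ j ∈ T, w ≠ dst j) → π s w = s w by
    obtain ⟨π, h, h'⟩ := this Finset.univ
    exact ⟨π, h, fun s => ⟨fun j => (h' s).1 j (Finset.mem_univ j),
      fun w hw => (h' s).2 w fun j _ => hw j⟩⟩
  intro T
  induction T using Finset.induction_on with
  | empty => exact ⟨1, Realizable.one, fun s => by simp⟩
  | insert j T hj ih =>
    obtain ⟨π, h, h'⟩ := ih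
    refine ⟨bitPerm (dst j) (src j) (src j) (hne j j) (hne j j) (fun x _ => x) * π, ?_,
      fun s => ?_⟩
    · refine (h.mul (realizable_bitPerm _ _ _ (hne j j) (hne j j) (fun x _ => x))).mono ?_
      rw [Finset.card_insert_of_notMem hj]
      omega
    have hsrc : π s (src j) = s (src j) := (h' s).2 _ fun i _ => hne j i
    have hdj : π s (dst j) = s (dst j) := (h' s).2 _ fun i hi e => hj (hdst e ▸ hi)
    simp only [Equiv.Perm.mul_apply, bitPerm_apply, hsrc, hdj]
    refine ⟨fun i hi => ?_, fun w hw => ?_⟩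
    · rcases eq_or_ne i j with rfl | hij
      · simp
      · rw [Function.update_of_ne (fun e => hij (hdst e))]
        exact (h' s).1 i (Finset.mem_of_mem_insert_of_ne hi hij)
    · rw [Function.update_of_ne (hw j (Finset.mem_insert_self _ _))]
      exact (h' s).2 w fun i hi => hw i (Finset.mem_insert_of_mem hi)

end Classical

/-! ### Straight-line programs and their reversible realization -/

/-- `Comp n S`: straight-line programs with `n` auxiliary bits compute all functions in
`S`, where a program may use the input bits, Boolean operations on two bits, and oracle queries. -/
inductive Comp {ι κ I : Type} [Fintype ι] [Fintype κ] :
    ℕ → Set (Oracle ι κ × (I → Bool) → Bool) → Prop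
  | init : Comp 0 (Set.range fun i x => x.2 i)
  | weaken {n n' : ℕ} {S : Set (Oracle ι κ × (I → Bool) → Bool)} (h : n ≤ n') (hS : Comp n S) :
      Comp n' S
  | bin {n : ℕ} {S : Set (Oracle ι κ × (I → Bool) → Bool)}
      {f g : Oracle ι κ × (I → Bool) → Bool} (h : Bool → Bool → Bool) (hS : Comp n S)
      (hf : f ∈ S) (hg : g ∈ S) : Comp (n + 1) (insert (fun x => h (f x) (g x)) S)
  | query {n : ℕ} {S : Set (Oracle ι κ × (I → Bool) → Bool)}
      (f : ι → Oracle ι κ × (I → Bool) → Bool) (hS : Comp n S) (hf : ∀ i, f i ∈ S) :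
      Comp (n + (Fintype.card ι + Fintype.card κ + 1))
        (S ∪ Set.range fun j x => x.1 (fun i => f i x) j)

/-- Straight-line programs become circuits on given wires for input and auxiliary bits. -/
theorem Comp.realize {ι κ I W : Type} [Fintype ι] [Fintype κ] [DecidableEq W] {K : ℕ}
    (anc : Fin K ↪ W) (inp : I → W) (hdisj : ∀ i k, inp i ≠ anc k)
    {n : ℕ} {S : Set (Oracle ι κ × (I → Bool) → Bool)} (hS : Comp n S) (hn : n ≤ K) :
    ∃ σ : Oracle ι κ → Equiv.Perm (W → Bool), Realizable (5 * n) σ ∧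
      (∀ F s, (∀ k, s (anc k) = false) → (∀ w, (∀ k, w ≠ anc k) → σ F s w = s w) ∧
        ∀ k : Fin K, n ≤ k → σ F s (anc k) = false) ∧
      (∀ F s s', (∀ k, s (anc k) = false) → (∀ k, s' (anc k) = false) → s ∘ inp = s' ∘ inp →
        ∀ k, σ F s (anc k) = σ F s' (anc k)) ∧
      ∀ f ∈ S, ∃ w, (∀ k : Fin K, n ≤ k → w ≠ anc k) ∧
        ∀ F s, (∀ k, s (anc k) = false) → σ F s w = f (F, s ∘ inp) := by
  -- The invariants: wires outside the auxiliary ones are untouched, later auxiliary wires are still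
  -- clean, the auxiliary contents depend on the input wires only, and each computed function sits
  -- on some wire. The third one is what makes uncomputation possible.
  induction hS with
  | init =>
    refine ⟨fun _ => 1, Realizable.one, fun F s hs => ⟨fun _ _ => rfl, fun k _ => hs k⟩,
      fun F s s' hs hs' _ k => (hs k).trans (hs' k).symm, ?_⟩
    rintro _ ⟨i, rfl⟩
    exact ⟨inp i, fun k _ => hdisj i k, fun F s _ => rfl⟩
  | @weaken n n' S h hS ih =>
    obtain ⟨σ, hσ, h1, h3, h2⟩ := ih (by omega)
    refine ⟨σ, hσ.mono (by omega), fun F s hs => ⟨(h1 F s hs).1, fun k hk => (h1 F s hs).2 k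
      (by omega)⟩, h3, fun f hf => ?_⟩
    obtain ⟨w, hw, hw'⟩ := h2 f hf
    exact ⟨w, fun k hk => hw k (by omega), hw'⟩
  | @bin n S f g h hS hf hg ih =>
    obtain ⟨σ, hσ, h1, h3, h2⟩ := ih (by omega)
    obtain ⟨wf, hwf, hf'⟩ := h2 f hf
    obtain ⟨wg, hwg, hg'⟩ := h2 g hg
    have hwf' := hwf ⟨n, hn⟩ le_rfl
    have hwg' := hwg ⟨n, hn⟩ le_rfl
    have hval : ∀ F s, (∀ k, s (anc k) = false) →
        (bitPerm (anc ⟨n, hn⟩) wf wg hwf' hwg' h * σ F) s =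
        Function.update (σ F s) (anc ⟨n, hn⟩) (h (f (F, s ∘ inp)) (g (F, s ∘ inp))) := by
      intro F s hs
      rw [Equiv.Perm.mul_apply, bitPerm_apply, (h1 F s hs).2 _ le_rfl, hf' F s hs, hg' F s hs,
        Bool.false_xor]
    refine ⟨fun F => bitPerm (anc ⟨n, hn⟩) wf wg hwf' hwg' h * σ F,
      (hσ.mul (realizable_bitPerm _ _ _ hwf' hwg' h)).mono (by omega), fun F s hs => ?_,
      fun F s s' hs hs' hss k => ?_, ?_⟩
    · simp only [hval F s hs]
      refine ⟨fun w hw => ?_, fun k hk => ?_⟩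
      · rw [Function.update_of_ne (hw _), (h1 F s hs).1 w hw]
      · rw [Function.update_of_ne, (h1 F s hs).2 k (by omega)]
        intro e
        have := anc.injective e
        simp [this] at hk
    · simp only [hval F s hs, hval F s' hs', hss]
      rcases eq_or_ne k ⟨n, hn⟩ with rfl | hk
      · simp
      · rw [Function.update_of_ne (anc.injective.ne hk), Function.update_of_ne (anc.injective.ne hk)]
        exact h3 F s s' hs hs' hss k
    · rintro f' (rfl | hf'')
      · refine ⟨anc ⟨n, hn⟩, fun k hk e => ?_, fun F s hs => ?_⟩
        · have := anc.injective e
          simp [← this] at hk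
        · simp only [hval F s hs, Function.update_self]
      · obtain ⟨w, hw, hw'⟩ := h2 f' hf''
        refine ⟨w, fun k hk => hw k (by omega), fun F s hs => ?_⟩
        simp only [hval F s hs]
        rw [Function.update_of_ne (hw _ le_rfl), hw' F s hs]
  | @query n S f hS hf ih =>
    obtain ⟨σ, hσ, h1, h3, h2⟩ := ih (by omega)
    choose wf hwf hf' using fun i => h2 (f i) (hf i)
    let pos : ι ⊕ κ → Fin K := fun x => ⟨n + Fintype.equivFin (ι ⊕ κ) x, by
      have := (Fintype.equivFin (ι ⊕ κ) x).2
      have := Fintype.card_sum (α := ι) (β := κ)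
      omega⟩
    have hpos : Function.Injective pos := by
      intro x y hxy
      have : n + (Fintype.equivFin (ι ⊕ κ) x : ℕ) = n + Fintype.equivFin (ι ⊕ κ) y :=
        congrArg Fin.val hxy
      exact (Fintype.equivFin (ι ⊕ κ)).injective (Fin.ext (by omega))
    have hposn : ∀ x, n ≤ pos x := fun x => Nat.le_add_right _ _
    have hposlt : ∀ x, (pos x : ℕ) < n + (Fintype.card ι + Fintype.card κ + 1) := fun x => by
      have := (Fintype.equivFin (ι ⊕ κ) x).2
      have := Fintype.card_sum (α := ι) (β := κ)
      show n + _ < _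
      omega
    let e : ι ⊕ κ ↪ W := ⟨fun x => anc (pos x), anc.injective.comp hpos⟩
    -- The argument bits may sit on coinciding wires, whereas a query needs distinct ones, so they
    -- are first copied to fresh wires.
    obtain ⟨π, hπ, hπ'⟩ := realizable_copies (ι := ι) (κ := κ) (W := W) wf
      (fun i => e (.inl i)) (fun i j h => by simpa using e.injective h)
      (fun i j => hwf i (pos (.inl j)) (hposn _))
    have hother : ∀ F s, (∀ k, s (anc k) = false) → ∀ w, (∀ x, w ≠ e x) →
        queryPerm e F (π (σ F s)) w = σ F s w := by
      intro F s hs w hw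
      exact (queryMap_of_ne e F _ fun j => hw _).trans ((hπ' _).2 w fun i => hw _)
    have hin : ∀ F s, (∀ k, s (anc k) = false) → ∀ i, π (σ F s) (e (.inl i)) = f i (F, s ∘ inp) := by
      intro F s hs i
      rw [(hπ' _).1 i, hf' i F s hs]
      have : σ F s (e (.inl i)) = false := (h1 F s hs).2 _ (hposn _)
      rw [this, Bool.false_xor]
    have hans : ∀ F s, (∀ k, s (anc k) = false) → ∀ j,
        queryPerm e F (π (σ F s)) (e (.inr j)) = F (fun i => f i (F, s ∘ inp)) j := by
      intro F s hs j
      refine (queryMap_ans e F _ j).trans ?_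
      simp only [hin F s hs]
      have : π (σ F s) (e (.inr j)) = false := by
        rw [(hπ' _).2 _ (fun i h => by simpa using e.injective h)]
        exact (h1 F s hs).2 _ (hposn _)
      rw [this, Bool.false_xor]
    -- The additional auxiliary bit charged for a query pays for the query gate.
    refine ⟨fun F => queryPerm e F * (π * σ F),
      ((hσ.mul hπ).mul (Realizable.query e)).mono (by omega), fun F s hs => ⟨?_, ?_⟩,
      fun F s s' hs hs' hss k => ?_, ?_⟩
    · intro w hw
      exact (hother F s hs w fun x => hw _).trans ((h1 F s hs).1 w hw)
    · intro k hk
      refine (hother F s hs _ fun x h => ?_).trans ((h1 F s hs).2 k (by omega))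
      have := hposlt x
      rw [← anc.injective h] at this
      omega
    · by_cases hk : ∃ x, anc k = e x
      · obtain ⟨x | x, hx⟩ := hk
        · rw [hx]
          refine (queryMap_arg e F _ x).trans (Eq.trans ?_ (queryMap_arg e F _ x).symm)
          exact (hin F s hs x).trans (by rw [hss]; exact (hin F s' hs' x).symm)
        · rw [hx]
          exact (hans F s hs x).trans (by rw [hss]; exact (hans F s' hs' x).symm)
      · push Not at hk
        exact (hother F s hs _ hk).trans ((h3 F s s' hs hs' hss k).trans (hother F s' hs' _ hk).symm)
    · rintro f' (hf'' | ⟨j, rfl⟩)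
      · obtain ⟨w, hw, hw'⟩ := h2 f' hf''
        exact ⟨w, fun k hk => hw k (by omega), fun F s hs =>
          (hother F s hs w fun x => hw _ (hposn x)).trans (hw' F s hs)⟩
      · refine ⟨e (.inr j), fun k hk h => ?_, fun F s hs => hans F s hs j⟩
        have := hposlt (.inr j)
        rw [anc.injective h] at this
        omega

/-- Add a computed bit to a wire, leaving the auxiliary wires clean. -/
theorem Comp.exists_xor {ι κ I W : Type} [Fintype ι] [Fintype κ] [DecidableEq W] {K : ℕ}
    (anc : Fin K ↪ W) (inp : I → W) (hdisj : ∀ i k, inp i ≠ anc k) (flag : W)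
    (hflag : ∀ i, inp i ≠ flag) (hflag' : ∀ k, anc k ≠ flag)
    {n : ℕ} {S : Set (Oracle ι κ × (I → Bool) → Bool)} (hS : Comp n S) (hn : n ≤ K)
    {f : Oracle ι κ × (I → Bool) → Bool} (hf : f ∈ S) :
    ∃ τ : Oracle ι κ → Equiv.Perm (W → Bool), Realizable (10 * n + 5) τ ∧
      ∀ F s, (∀ k, s (anc k) = false) →
        τ F s = Function.update s flag (xor (s flag) (f (F, s ∘ inp))) := by
  obtain ⟨σ, hσ, h1, h3, h2⟩ := hS.realize anc inp hdisj hn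
  obtain ⟨w, hw, hf⟩ := h2 f hf
  -- The flag is preserved by `σ` and is not an input, so it cannot carry a function of the input
  -- alone.
  have hwf : w ≠ flag := by
    rintro rfl
    have h : ∀ s : W → Bool, (∀ k, s (anc k) = false) → s w = f (fun _ _ => false, s ∘ inp) :=
      fun s hs => ((h1 _ s hs).1 w fun k => (hflag' k).symm).symm.trans (hf _ s hs)
    have h0 := h (fun _ => false) fun _ => rfl
    have h1 := h (Function.update (fun _ => false) w true) fun k => Function.update_of_ne
      (hflag' k) _ _
    have e : Function.update (fun _ => false) w true ∘ inp = (fun _ => false) ∘ inp := by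
      funext i
      exact Function.update_of_ne (hflag i) _ _
    rw [e, ← h0, Function.update_self] at h1
    exact Bool.noConfusion h1
  -- Compute, copy, uncompute. The state after copying is the image under `σ F` of the initial state
  -- with the flag changed, since the auxiliary contents ignore the flag.
  refine ⟨fun F => (σ F)⁻¹ * (bitPerm flag w w hwf hwf (fun x _ => x) * σ F),
    ((hσ.mul (realizable_bitPerm _ _ _ hwf hwf _)).mul hσ.inv).mono (by omega), fun F s hs => ?_⟩
  rw [Equiv.Perm.mul_apply, Equiv.Perm.inv_eq_iff_eq, Equiv.Perm.mul_apply, bitPerm_apply,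
    hf F s hs, (h1 F s hs).1 flag fun k => (hflag' k).symm]
  have hz : ∀ b k, Function.update s flag b (anc k) = false := fun b k => by
    rw [Function.update_of_ne (hflag' k), hs k]
  funext v
  by_cases hv : ∃ k, v = anc k
  · obtain ⟨k, rfl⟩ := hv
    rw [Function.update_of_ne (hflag' k)]
    refine h3 F s _ hs (hz _) ?_ k
    funext i
    exact (Function.update_of_ne (hflag i) _ _).symm
  · push Not at hv
    rw [(h1 F _ (hz _)).1 v hv]
    by_cases hvf : v = flag
    · subst hvf; simp
    · rw [Function.update_of_ne hvf, Function.update_of_ne hvf, (h1 F s hs).1 v hv]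

/-! ### Boolean functions and modular arithmetic by straight-line programs -/

section Arithmetic

/-- Functions of the oracle and the input bits. -/
abbrev Inputs (ι κ I : Type) : Type := Oracle ι κ × (I → Bool)

variable {ι κ I : Type}

/-- All binary digits of the number-valued function `N` are in `S`. -/
def HasNum (S : Set (Inputs ι κ I → Bool)) (N : Inputs ι κ I → ℕ) : Prop :=
  ∀ i, (fun x => (N x).testBit i) ∈ S

namespace HasNum

theorem const {S : Set (Inputs ι κ I → Bool)} (hc : ∀ b, (fun _ => b) ∈ S) (k : ℕ) :
    HasNum S fun _ => k := fun i => hc (k.testBit i)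

theorem mono {S S' : Set (Inputs ι κ I → Bool)} {N : Inputs ι κ I → ℕ} (h : HasNum S N)
    (hS : S ⊆ S') : HasNum S' N := fun i => hS (h i)

theorem div_two {S : Set (Inputs ι κ I → Bool)} {N : Inputs ι κ I → ℕ} (h : HasNum S N) :
    HasNum S fun x => N x / 2 := fun i => by
  simpa [Nat.testBit_div_two] using h (i + 1)

theorem of_lt {S : Set (Inputs ι κ I → Bool)} {a : Inputs ι κ I → ℕ} {L : ℕ}
    (hc : ∀ b, (fun _ => b) ∈ S) (hL : ∀ x, a x < 2 ^ L)
    (h : ∀ i < L, (fun x => (a x).testBit i) ∈ S) : HasNum S a := by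
  intro i
  by_cases hi : i < L
  · exact h i hi
  · convert hc false using 2 with x
    exact Nat.testBit_lt_two_pow ((hL x).trans_le (Nat.pow_le_pow_right two_pos (by omega)))

end HasNum

variable [Fintype ι] [Fintype κ]

/-- From the functions in `S`, those in `S'` are computed with `c` further auxiliary bits. -/
def Reach (c : ℕ) (S S' : Set (Inputs ι κ I → Bool)) : Prop :=
  S ⊆ S' ∧ ∀ n, Comp n S → Comp (n + c) S'

namespace Reach

theorem refl (S : Set (Inputs ι κ I → Bool)) : Reach 0 S S := ⟨le_rfl, fun _ h => h⟩

theorem trans {c d : ℕ} {S S' S'' : Set (Inputs ι κ I → Bool)} (h : Reach c S S')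
    (h' : Reach d S' S'') : Reach (c + d) S S'' :=
  ⟨h.1.trans h'.1, fun n hn => by rw [← add_assoc]; exact h'.2 _ (h.2 n hn)⟩

theorem mono {c d : ℕ} {S S' : Set (Inputs ι κ I → Bool)} (h : Reach c S S') (hcd : c ≤ d) :
    Reach d S S' :=
  ⟨h.1, fun n hn => (h.2 n hn).weaken (by omega)⟩

theorem bin {S : Set (Inputs ι κ I → Bool)} {f g : Inputs ι κ I → Bool}
    (h : Bool → Bool → Bool) (hf : f ∈ S) (hg : g ∈ S) :
    ∃ S', Reach 1 S S' ∧ (fun x => h (f x) (g x)) ∈ S' :=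
  ⟨_, ⟨Set.subset_insert _ _, fun _ hn => hn.bin h hf hg⟩, Set.mem_insert _ _⟩

theorem query {S : Set (Inputs ι κ I → Bool)} (f : ι → Inputs ι κ I → Bool) (hf : ∀ i, f i ∈ S) :
    ∃ S', Reach (Fintype.card ι + Fintype.card κ + 1) S S' ∧
      ∀ j, (fun x : Inputs ι κ I => x.1 (fun i => f i x) j) ∈ S' :=
  ⟨_, ⟨Set.subset_union_left, fun _ hn => hn.query f hf⟩, fun j => .inr ⟨j, rfl⟩⟩

theorem family {S : Set (Inputs ι κ I → Bool)} {c : ℕ} {J : Type} (T : Finset J)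
    (f : J → Inputs ι κ I → Bool)
    (h : ∀ j ∈ T, ∀ S', S ⊆ S' → ∃ S'', Reach c S' S'' ∧ f j ∈ S'') :
    ∃ S', Reach (c * T.card) S S' ∧ ∀ j ∈ T, f j ∈ S' := by
  classical
  induction T using Finset.induction_on with
  | empty => exact ⟨S, refl S, by simp⟩
  | insert j T hj ih =>
    obtain ⟨S₁, h₁, hT⟩ := ih fun j hj => h j (Finset.mem_insert_of_mem hj)
    obtain ⟨S₂, h₂, hj'⟩ := h j (Finset.mem_insert_self _ _) S₁ h₁.1
    refine ⟨S₂, (h₁.trans h₂).mono ?_, fun i hi => ?_⟩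
    · rw [Finset.card_insert_of_notMem hj, mul_add, mul_one]
    · rcases Finset.mem_insert.mp hi with rfl | hi
      · exact hj'
      · exact h₂.1 (hT i hi)

theorem mux {S : Set (Inputs ι κ I → Bool)} {c f g : Inputs ι κ I → Bool} (hc : c ∈ S)
    (hf : f ∈ S) (hg : g ∈ S) :
    ∃ S', Reach 3 S S' ∧ (fun x => if c x then f x else g x) ∈ S' := by
  obtain ⟨S₁, h₁, m₁⟩ := bin (fun a b => a && b) hc hf
  obtain ⟨S₂, h₂, m₂⟩ := bin (fun a b => !a && b) (h₁.1 hc) (h₁.1 hg)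
  obtain ⟨S₃, h₃, m₃⟩ := bin (fun a b => a || b) (h₂.1 m₁) m₂
  refine ⟨S₃, (h₁.trans h₂).trans h₃, ?_⟩
  convert m₃ using 2 with x
  cases c x <;> simp

theorem forall_eq {S : Set (Inputs ι κ I → Bool)} {J : Type} (T : Finset J)
    (f g : J → Inputs ι κ I → Bool) (hc : ∀ b, (fun _ => b) ∈ S) (hf : ∀ j ∈ T, f j ∈ S)
    (hg : ∀ j ∈ T, g j ∈ S) :
    ∃ S', Reach (2 * T.card) S S' ∧ (fun x => decide (∀ j ∈ T, f j x = g j x)) ∈ S' := by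
  classical
  induction T using Finset.induction_on with
  | empty => exact ⟨S, refl S, by simpa using hc true⟩
  | insert j T hj ih =>
    obtain ⟨S₁, h₁, m₁⟩ := ih (fun j hj => hf j (Finset.mem_insert_of_mem hj))
      (fun j hj => hg j (Finset.mem_insert_of_mem hj))
    obtain ⟨S₂, h₂, m₂⟩ := bin (fun a b => a == b) (h₁.1 (hf j (Finset.mem_insert_self _ _)))
      (h₁.1 (hg j (Finset.mem_insert_self _ _)))
    obtain ⟨S₃, h₃, m₃⟩ := bin (fun a b => a && b) m₂ (h₂.1 m₁)
    refine ⟨S₃, ((h₁.trans h₂).trans h₃).mono ?_, ?_⟩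
    · rw [Finset.card_insert_of_notMem hj]; omega
    · convert m₃ using 2 with x
      rw [Bool.eq_iff_iff]
      simp

end Reach

/-- The carry into the digit `i` in the addition of `a` and `b`. -/
def carryBit (i a b : ℕ) : Bool := decide (2 ^ i ≤ a % 2 ^ i + b % 2 ^ i)

theorem carryBit_succ (i a b : ℕ) : carryBit (i + 1) a b =
    if xor (a.testBit i) (b.testBit i) then carryBit i a b else a.testBit i := by
  have ha := Nat.mod_pow_succ (b := 2) (k := i) (x := a)
  have hb := Nat.mod_pow_succ (b := 2) (k := i) (x := b)
  rw [← Nat.toNat_testBit] at ha hb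
  have h1 := Nat.mod_lt a (Nat.two_pow_pos i)
  have h2 := Nat.mod_lt b (Nat.two_pow_pos i)
  unfold carryBit
  rw [ha, hb, pow_succ]
  cases a.testBit i <;> cases b.testBit i <;> simp <;> omega

theorem testBit_add_eq (i a b : ℕ) : (a + b).testBit i =
    xor (xor (a.testBit i) (b.testBit i)) (carryBit i a b) := by
  simp only [Nat.testBit_eq_decide_div_mod_eq, carryBit]
  rw [Nat.add_div (Nat.two_pow_pos i)]
  have h1 := Nat.mod_two_eq_zero_or_one (a / 2 ^ i)
  have h2 := Nat.mod_two_eq_zero_or_one (b / 2 ^ i)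
  generalize a / 2 ^ i = A at *
  generalize b / 2 ^ i = B at *
  by_cases h : 2 ^ i ≤ a % 2 ^ i + b % 2 ^ i <;> rcases h1 with h1 | h1 <;>
    rcases h2 with h2 | h2 <;> simp [h, h1, h2, Nat.add_mod]

namespace HasNum

variable {S : Set (Inputs ι κ I → Bool)} {a b : Inputs ι κ I → ℕ} {L : ℕ}

/-- Ripple-carry addition: each digit costs two XORs and one multiplexer for the next carry. -/
theorem add (hc : ∀ b, (fun _ => b) ∈ S) (ha : HasNum S a) (hb : HasNum S b)
    (hLa : ∀ x, a x < 2 ^ L) (hLb : ∀ x, b x < 2 ^ L) :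
    ∃ S', Reach (5 * L) S S' ∧ HasNum S' fun x => a x + b x := by
  have key : ∀ l, ∃ S', Reach (5 * l) S S' ∧ (fun x => carryBit l (a x) (b x)) ∈ S' ∧
      ∀ i < l, (fun x => (a x + b x).testBit i) ∈ S' := by
    intro l
    induction l with
    | zero => exact ⟨S, Reach.refl S, by simpa [carryBit, Nat.mod_one] using hc false, by simp⟩
    | succ l ih =>
      obtain ⟨S₁, h₁, m₁, b₁⟩ := ih
      obtain ⟨S₂, h₂, m₂⟩ := Reach.bin (fun a b => xor a b) (h₁.1 (ha l)) (h₁.1 (hb l))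
      obtain ⟨S₃, h₃, m₃⟩ := Reach.bin (fun a b => xor a b) m₂ (h₂.1 m₁)
      obtain ⟨S₄, h₄, m₄⟩ := Reach.mux (h₃.1 m₂) (h₃.1 (h₂.1 m₁)) (h₃.1 (h₂.1 (h₁.1 (ha l))))
      refine ⟨S₄, (((h₁.trans h₂).trans h₃).trans h₄).mono (by omega), ?_, fun i hi => ?_⟩
      · simpa only [carryBit_succ] using m₄
      · rcases Nat.lt_succ_iff_lt_or_eq.mp hi with hi | rfl
        · exact h₄.1 (h₃.1 (h₂.1 (b₁ i hi)))
        · simpa only [testBit_add_eq] using h₄.1 m₃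
  obtain ⟨S', h, m, hb'⟩ := key L
  refine ⟨S', h, of_lt (L := L + 1) (fun b => h.1 (hc b)) (fun x => ?_) fun i hi => ?_⟩
  · have := hLa x; have := hLb x; rw [pow_succ]; omega
  · rcases Nat.lt_succ_iff_lt_or_eq.mp hi with hi | rfl
    · exact hb' i hi
    · convert m using 2 with x
      rw [testBit_add_eq, Nat.testBit_lt_two_pow (hLa x), Nat.testBit_lt_two_pow (hLb x)]
      simp

theorem ite {c : Inputs ι κ I → Bool} (hc : ∀ b, (fun _ => b) ∈ S) (hcS : c ∈ S)
    (ha : HasNum S a) (hb : HasNum S b) (hL : ∀ x, (if c x then a x else b x) < 2 ^ L) :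
    ∃ S', Reach (3 * L) S S' ∧ HasNum S' fun x => if c x then a x else b x := by
  obtain ⟨S', h, m⟩ := Reach.family (S := S) (c := 3) (Finset.range L)
    (fun i x => if c x then (a x).testBit i else (b x).testBit i)
    (fun i _ S' hS' => Reach.mux (hS' hcS) (hS' (ha i)) (hS' (hb i)))
  refine ⟨S', by simpa using h, of_lt (fun b => h.1 (hc b)) hL fun i hi => ?_⟩
  convert m i (Finset.mem_range.mpr hi) using 2 with x
  split_ifs <;> rfl

/-- Comparison with a constant `p`, together with the difference. -/
theorem compare (hc : ∀ b, (fun _ => b) ∈ S) (ha : HasNum S a) (hL : ∀ x, a x < 2 ^ L) {p : ℕ}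
    (hp : 0 < p) (hpL : p ≤ 2 ^ L) :
    ∃ S', Reach (5 * L) S S' ∧ (fun x => decide (p ≤ a x)) ∈ S' ∧
      ∃ d, HasNum S' d ∧ ∀ x, p ≤ a x → ∀ i < L, (d x).testBit i = (a x - p).testBit i := by
  -- After adding `2 ^ L - p`, digit `L` tells whether `p ≤ a`, and in that case the lower digits
  -- are those of `a - p`.
  obtain ⟨S', h, m⟩ := add (L := L) hc ha (HasNum.const hc (2 ^ L - p)) hL (fun _ => by
    have := Nat.two_pow_pos L; omega)
  refine ⟨S', h, ?_, _, m, fun x hx i hi => ?_⟩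
  · convert m L using 2 with x
    have := hL x
    rw [Nat.testBit_eq_decide_div_mod_eq]
    by_cases hpa : p ≤ a x
    · have : (a x + (2 ^ L - p)) / 2 ^ L = 1 := by
        rw [Nat.div_eq_iff (Nat.two_pow_pos L)]; omega
      simp [hpa, this]
    · have : (a x + (2 ^ L - p)) / 2 ^ L = 0 := by
        rw [Nat.div_eq_iff (Nat.two_pow_pos L)]; omega
      simp [hpa, this]
  · have e : a x + (2 ^ L - p) = 2 ^ L + (a x - p) := by omega
    rw [e, Nat.testBit_two_pow_add_gt hi]

/-- Since `a + b < 2 p`, a single conditional subtraction reduces the sum. -/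
theorem addMod (hc : ∀ b, (fun _ => b) ∈ S) (ha : HasNum S a) (hb : HasNum S b)
    (hLa : ∀ x, a x < 2 ^ L) (hLb : ∀ x, b x < 2 ^ L) {p : ℕ} (hp : 0 < p) (hpL : p ≤ 2 ^ L)
    (hab : ∀ x, a x + b x < 2 * p) :
    ∃ S', Reach (13 * L + 5) S S' ∧ HasNum S' fun x => (a x + b x) % p := by
  obtain ⟨S₁, h₁, m₁⟩ := add hc ha hb hLa hLb
  obtain ⟨S₂, h₂, m₂, d, hd, hd'⟩ := compare (L := L + 1) (fun b => h₁.1 (hc b)) m₁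
    (fun x => by have := hab x; rw [pow_succ]; omega) hp (by rw [pow_succ]; omega)
  have hc₂ : ∀ b, (fun _ => b) ∈ S₂ := fun b => h₂.1 (h₁.1 (hc b))
  obtain ⟨S₃, h₃, m₃⟩ := Reach.family (S := S₂) (c := 3) (Finset.range L)
    (fun i x => if decide (p ≤ a x + b x) then (d x).testBit i else (a x + b x).testBit i)
    (fun i _ S' hS' => Reach.mux (hS' m₂) (hS' (hd i)) (hS' (h₂.1 (m₁ i))))
  refine ⟨S₃, ((h₁.trans h₂).trans h₃).mono (by rw [Finset.card_range]; omega),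
    of_lt (L := L) (fun b => h₃.1 (hc₂ b)) (fun x => (Nat.mod_lt _ hp).trans_le hpL)
    fun i hi => ?_⟩
  convert m₃ i (Finset.mem_range.mpr hi) using 2 with x
  by_cases hx : p ≤ a x + b x
  · rw [Nat.mod_eq_sub_mod hx, Nat.mod_eq_of_lt (by have := hab x; omega)]
    simp [hx, hd' x hx i (by omega)]
  · simp [hx, Nat.mod_eq_of_lt (not_le.mp hx)]

/-- Horner's scheme from the leading digit of `a`: double the partial product modulo `p`, then add
`b` if the digit is set. -/
theorem mulMod (hc : ∀ b, (fun _ => b) ∈ S) (ha : HasNum S a) (hb : HasNum S b) {p : ℕ}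
    (hLa : ∀ x, a x < 2 ^ L) (hbp : ∀ x, b x < p) (hp : 0 < p) (hpL : p ≤ 2 ^ L) :
    ∃ S', Reach ((29 * L + 10) * L) S S' ∧ HasNum S' fun x => (a x * b x) % p := by
  have key : ∀ l ≤ L, ∃ S', Reach ((29 * L + 10) * l) S S' ∧
      HasNum S' fun x => (a x / 2 ^ (L - l) * b x) % p := by
    intro l
    induction l with
    | zero =>
      intro _
      refine ⟨S, Reach.refl S, ?_⟩
      convert HasNum.const hc 0 using 2 with x
      simp [Nat.div_eq_of_lt (hLa x)]
    | succ l ih =>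
      intro hl
      obtain ⟨S₁, h₁, m₁⟩ := ih (by omega)
      have hlt : ∀ N : Inputs ι κ I → ℕ, ∀ x, N x % p < p := fun N x => Nat.mod_lt _ hp
      have hc₁ : ∀ b, (fun _ => b) ∈ S₁ := fun b => h₁.1 (hc b)
      obtain ⟨S₂, h₂, m₂⟩ := addMod (L := L) hc₁ m₁ m₁ (fun x => (Nat.mod_lt _ hp).trans_le hpL)
        (fun x => (Nat.mod_lt _ hp).trans_le hpL) hp hpL (fun x => by
          have := hlt (fun x => a x / 2 ^ (L - l) * b x) x; omega)
      have hc₂ : ∀ b, (fun _ => b) ∈ S₂ := fun b => h₂.1 (hc₁ b)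
      obtain ⟨S₃, h₃, m₃⟩ := HasNum.ite (L := L) hc₂
        (h₂.1 (h₁.1 (ha (L - (l + 1))))) ((hb.mono h₁.1).mono h₂.1) (HasNum.const hc₂ 0)
        (fun x => by
          have := hbp x
          split_ifs
          · omega
          · exact Nat.two_pow_pos L)
      have hc₃ : ∀ b, (fun _ => b) ∈ S₃ := fun b => h₃.1 (hc₂ b)
      have hm : ∀ x, (if (a x).testBit (L - (l + 1)) then b x else 0) < p := fun x => by
        split_ifs
        · exact hbp x
        · exact hp
      obtain ⟨S₄, h₄, m₄⟩ := addMod (L := L) hc₃ (m₂.mono h₃.1) m₃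
        (fun x => (Nat.mod_lt _ hp).trans_le hpL) (fun x => (hm x).trans_le hpL) hp hpL (fun x => by
          have := hlt (fun x => (a x / 2 ^ (L - l) * b x) % p + (a x / 2 ^ (L - l) * b x) % p) x
          have := hm x
          omega)
      refine ⟨S₄, (((h₁.trans h₂).trans h₃).trans h₄).mono ?_, ?_⟩
      · rw [mul_add, mul_one]; omega
      · convert m₄ using 2 with x
        have e : L - l = (L - (l + 1)) + 1 := by omega
        have e2 : a x / 2 ^ (L - (l + 1)) = 2 * (a x / 2 ^ (L - l)) +
            ((a x).testBit (L - (l + 1))).toNat := by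
          rw [e, pow_succ, ← Nat.div_div_eq_div_mul, Nat.toNat_testBit]
          exact (Nat.div_add_mod _ 2).symm
        rw [e2]
        simp only [Nat.mod_add_mod, Nat.add_mod_mod]
        congr 1
        split_ifs with h <;> simp [h] <;> ring
  simpa using key L le_rfl

/-- Square-and-multiply along the digits of the constant exponent, at most two multiplications per
digit. -/
theorem powMod (hc : ∀ b, (fun _ => b) ∈ S) (ha : HasNum S a) {p : ℕ}
    (hap : ∀ x, a x < p) (hp : 0 < p) (hpL : p ≤ 2 ^ L) (l e : ℕ) (he : e < 2 ^ l) :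
    ∃ S', Reach (2 * ((29 * L + 10) * L) * l) S S' ∧ HasNum S' fun x => (a x ^ e) % p := by
  induction l generalizing e with
  | zero =>
    obtain rfl : e = 0 := by simpa using he
    exact ⟨S, Reach.refl S, by simpa using HasNum.const hc (1 % p)⟩
  | succ l ih =>
    obtain ⟨S₁, h₁, m₁⟩ := ih (e / 2) (by rw [pow_succ] at he; omega)
    have hlt : ∀ N : Inputs ι κ I → ℕ, ∀ x, N x % p < p := fun N x => Nat.mod_lt _ hp
    have hc₁ : ∀ b, (fun _ => b) ∈ S₁ := fun b => h₁.1 (hc b)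
    obtain ⟨S₂, h₂, m₂⟩ := mulMod (L := L) hc₁ m₁ m₁ (fun x => (Nat.mod_lt _ hp).trans_le hpL)
      (hlt _) hp hpL
    rcases Nat.mod_two_eq_zero_or_one e with h0 | h0
    · refine ⟨S₂, (h₁.trans h₂).mono ?_, ?_⟩
      · generalize (29 * L + 10) * L = M
        rw [mul_add]; omega
      · convert m₂ using 2 with x
        rw [← Nat.mul_mod, ← pow_add]
        congr 2
        omega
    · obtain ⟨S₃, h₃, m₃⟩ := mulMod (L := L) (fun b => h₂.1 (hc₁ b)) m₂ ((ha.mono h₁.1).mono h₂.1)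
        (fun x => (Nat.mod_lt _ hp).trans_le hpL) hap hp hpL
      refine ⟨S₃, ((h₁.trans h₂).trans h₃).mono ?_, ?_⟩
      · generalize (29 * L + 10) * L = M
        rw [mul_add]; omega
      · convert m₃ using 2 with x
        rw [← Nat.mul_mod, Nat.mod_mul_mod, ← pow_add, ← pow_succ]
        congr 2
        omega

/-- Rounding: `⌊p a / 2 ^ n⌋`. -/
theorem mulShift (hc : ∀ b, (fun _ => b) ∈ S) (ha : HasNum S a) {p : ℕ} (hp : 0 < p)
    (hpL : p < 2 ^ L) {n : ℕ} (hn : ∀ x, a x < 2 ^ n) :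
    ∃ S', Reach (8 * L * n) S S' ∧ HasNum S' fun x => p * a x / 2 ^ n := by
  have key : ∀ l, ∃ S', Reach (8 * L * l) S S' ∧ HasNum S' fun x => p * (a x % 2 ^ l) / 2 ^ l := by
    intro l
    induction l with
    | zero => exact ⟨S, Reach.refl S, by simpa [Nat.mod_one] using HasNum.const hc 0⟩
    | succ l ih =>
      obtain ⟨S₁, h₁, m₁⟩ := ih
      have hc₁ : ∀ b, (fun _ => b) ∈ S₁ := fun b => h₁.1 (hc b)
      have hlt : ∀ x, p * (a x % 2 ^ l) / 2 ^ l < p := fun x => by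
        rw [Nat.div_lt_iff_lt_mul (Nat.two_pow_pos l)]
        exact Nat.mul_lt_mul_of_pos_left (Nat.mod_lt _ (Nat.two_pow_pos l)) hp
      obtain ⟨S₂, h₂, m₂⟩ := HasNum.ite (L := L) hc₁ (h₁.1 (ha l)) (HasNum.const hc₁ p)
        (HasNum.const hc₁ 0) (fun x => by split_ifs <;> omega)
      obtain ⟨S₃, h₃, m₃⟩ := HasNum.add (L := L) (fun b => h₂.1 (hc₁ b)) (m₁.mono h₂.1) m₂
        (fun x => (hlt x).trans hpL) (fun x => by split_ifs <;> omega)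
      refine ⟨S₃, ((h₁.trans h₂).trans h₃).mono (by rw [mul_add]; omega), ?_⟩
      -- Nested floors: the next value is half of the previous value plus `p` times digit `l`,
      -- rounded down. Thus all intermediate numbers stay short.
      convert m₃.div_two using 2 with x
      rw [pow_succ, ← Nat.div_div_eq_div_mul, Nat.mod_mul, ← Nat.toNat_testBit]
      congr 1
      split_ifs with h
      · simp only [h, Bool.toNat_true, mul_one, mul_add]
        rw [Nat.add_mul_div_right _ _ (Nat.two_pow_pos l)]
      · simp [h]
  obtain ⟨S', h, m⟩ := key n
  refine ⟨S', h, ?_⟩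
  convert m using 2 with x
  rw [Nat.mod_eq_of_lt (hn x)]

end HasNum

end Arithmetic

/-! ### Fourier transform -/

/-- `exp (2 π i θ)`. -/
def turn (θ : ℝ) : ℂ := Complex.exp ((2 * Real.pi * θ : ℝ) * Complex.I)

theorem turn_add (θ θ' : ℝ) : turn (θ + θ') = turn θ * turn θ' := by
  rw [turn, turn, turn, ← Complex.exp_add]
  congr 1
  push_cast
  ring

theorem turn_zero : turn 0 = 1 := by simp [turn]

theorem turn_intCast (k : ℤ) : turn k = 1 := by
  rw [turn, Complex.exp_eq_one_iff]
  exact ⟨k, by push_cast; ring⟩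

theorem turn_half : turn (1 / 2) = -1 := by
  rw [turn, show 2 * Real.pi * (1 / 2 : ℝ) = Real.pi by ring, Complex.exp_pi_mul_I]

theorem norm_turn (θ : ℝ) : ‖turn θ‖ = 1 := Complex.norm_exp_ofReal_mul_I _

theorem turn_re (θ : ℝ) : (turn θ).re = Real.cos (2 * Real.pi * θ) := Complex.exp_ofReal_mul_I_re _

theorem turn_sum {J : Type} (T : Finset J) (θ : J → ℝ) :
    turn (∑ j ∈ T, θ j) = ∏ j ∈ T, turn (θ j) := by
  classical
  induction T using Finset.induction_on with
  | empty => simp [turn_zero]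
  | insert j T hj ih => rw [Finset.sum_insert hj, Finset.prod_insert hj, turn_add, ih]

/-- The Hadamard gate. -/
def hadamardGate : Matrix.unitaryGroup Bool ℂ :=
  ⟨Matrix.of fun i j => (Real.sqrt 2 : ℂ)⁻¹ * (if i && j then -1 else 1), by
    have h : (Real.sqrt 2 : ℂ)⁻¹ * (Real.sqrt 2 : ℂ)⁻¹ = 1 / 2 := by
      rw [← mul_inv, ← Complex.ofReal_mul, Real.mul_self_sqrt zero_le_two]
      simp
    rw [Matrix.mem_unitaryGroup_iff]
    ext i j
    cases i <;> cases j <;> (simp [Matrix.mul_apply, h]; try norm_num)⟩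

/-- A phase shift. -/
def phaseGate (θ : ℝ) : Matrix.unitaryGroup Bool ℂ :=
  ⟨Matrix.diagonal fun i => if i then turn θ else 1, by
    have h : turn θ * (starRingEnd ℂ) (turn θ) = 1 := by
      rw [Complex.mul_conj', norm_turn]; simp
    rw [Matrix.mem_unitaryGroup_iff]
    ext i j
    cases i <;> cases j <;> simp [Matrix.mul_apply, Matrix.diagonal_apply, h]⟩

section Fourier

variable {ι κ W : Type} [DecidableEq W]

/-- A controlled gate, omitted if target and control coincide. -/
def gateIfNe (w a : W) (M : Bool → Matrix.unitaryGroup Bool ℂ) : List (WireGate ι κ W) :=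
  if h : a ≠ w then [.ctrl w a h M] else []

theorem gateIfNe_of_ne {w a : W} (h : a ≠ w) (M : Bool → Matrix.unitaryGroup Bool ℂ) :
    gateIfNe (ι := ι) (κ := κ) w a M = [.ctrl w a h M] := dif_pos h

theorem length_gateIfNe_le (w a : W) (M : Bool → Matrix.unitaryGroup Bool ℂ) :
    (gateIfNe (ι := ι) (κ := κ) w a M).length ≤ 1 := by
  unfold gateIfNe; split_ifs <;> simp

/-- The part of the Fourier transform that treats the wire `w`: a Hadamard gate and controlled
phase shifts (the wire `d` is idle). -/
def fourierStep (d w : W) (C : List (W × ℝ)) : List (WireGate ι κ W) :=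
  gateIfNe w d (fun _ => hadamardGate) ++
    C.flatMap fun c => gateIfNe w c.1 fun x => if x then phaseGate c.2 else 1

theorem run_fourierStep (F : Oracle ι κ) {d w : W} (hd : d ≠ w) (C : List (W × ℝ))
    (hC : ∀ c ∈ C, c.1 ≠ w) (ψ : Ket W) (s : W → Bool) :
    WireGate.run F (fourierStep d w C) ψ s =
      (∑ z, (Real.sqrt 2 : ℂ)⁻¹ * (if s w && z then -1 else 1) * ψ (Function.update s w z)) *
        (C.map fun c => if s w && s c.1 then turn c.2 else 1).prod := by
  have phases : ∀ φ : Ket W, WireGate.run F (C.flatMap fun c =>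
      gateIfNe w c.1 fun x => if x then phaseGate c.2 else 1) φ s =
      φ s * (C.map fun c => if s w && s c.1 then turn c.2 else 1).prod := by
    induction C with
    | nil => simp
    | cons c C ih =>
      intro φ
      rw [List.flatMap_cons, WireGate.run_append, ih fun c hc => hC c (List.mem_cons_of_mem _ hc),
        gateIfNe_of_ne (hC c List.mem_cons_self), List.map_cons, List.prod_cons, ← mul_assoc]
      congr 1
      simp only [WireGate.run_cons, WireGate.run_nil, WireGate.apply, act]
      have hs := Function.update_eq_self w s
      cases hc : s c.1 <;> cases hw : s w <;> rw [hw] at hs <;>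
        simp [phaseGate, hs, mul_comm]
  rw [fourierStep, WireGate.run_append, phases, gateIfNe_of_ne hd]
  rfl

-- The invariant is a product state: wires of treated digits `P` carry the factors `G`, and all
-- others still hold `s₀`. By `hord`, a digit that controls phases of another one is treated later,
-- so its wire still has its value in `s₀` when it is needed.
open scoped Classical in
theorem run_fourier [Fintype W] {J : Type} (F : Oracle ι κ) (reg : J ↪ W) (d : W)
    (hd : ∀ j, d ≠ reg j) (C : J → List (J × ℝ)) (s₀ : W → Bool) (G : J → Bool → ℂ)
    (hG : ∀ j b, G j b = (Real.sqrt 2 : ℂ)⁻¹ * (if b && s₀ (reg j) then -1 else 1) *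
      ((C j).map fun c => if b && s₀ (reg c.1) then turn c.2 else 1).prod)
    (hC : ∀ j, ∀ c ∈ C j, c.1 ≠ j) (js : List J) (hjs : js.Nodup)
    (hord : js.Pairwise fun j j' => ∀ c ∈ C j', c.1 ≠ j) (P : Finset J)
    (hP : ∀ j ∈ js, j ∉ P ∧ ∀ c ∈ C j, c.1 ∉ P) (P' : Finset J)
    (hP' : ∀ j, j ∈ P' ↔ j ∈ P ∨ j ∈ js) (ψ : Ket W)
    (hψ : ∀ s, ψ s = if ∀ v, (∀ j ∈ P, v ≠ reg j) → s v = s₀ v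
      then ∏ j ∈ P, G j (s (reg j)) else 0) (s : W → Bool) :
    WireGate.run F (js.flatMap fun j =>
        fourierStep d (reg j) ((C j).map fun c => (reg c.1, c.2))) ψ s =
      if ∀ v, (∀ j ∈ P', v ≠ reg j) → s v = s₀ v then ∏ j ∈ P', G j (s (reg j)) else 0 := by
  induction js generalizing P ψ with
  | nil =>
    obtain rfl : P' = P := by ext; simp [hP']
    exact hψ s
  | cons j js ih =>
    obtain ⟨hj, hCj⟩ := hP j List.mem_cons_self
    rw [List.pairwise_cons] at hord
    rw [List.nodup_cons] at hjs
    rw [List.flatMap_cons, WireGate.run_append]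
    refine ih hjs.2 hord.2 (insert j P) (fun i hi => ⟨?_, fun c hc => ?_⟩)
      (fun i => by rw [hP', List.mem_cons, Finset.mem_insert]; tauto) _ fun s => ?_
    · rw [Finset.mem_insert, not_or]
      exact ⟨fun h => hjs.1 (h ▸ hi), (hP i (List.mem_cons_of_mem _ hi)).1⟩
    · rw [Finset.mem_insert, not_or]
      exact ⟨hord.1 i hi c hc, (hP i (List.mem_cons_of_mem _ hi)).2 c hc⟩
    · rw [run_fourierStep F (hd j) _ (by
        intro c hc
        obtain ⟨c, hc', rfl⟩ := List.mem_map.mp hc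
        exact fun h => hC j c hc' (reg.injective h))]
      have hcond : ∀ z, (∀ v, (∀ i ∈ P, v ≠ reg i) → Function.update s (reg j) z v = s₀ v) ↔
          (∀ v, (∀ i ∈ insert j P, v ≠ reg i) → s v = s₀ v) ∧ z = s₀ (reg j) := by
        intro z
        refine ⟨fun h => ⟨fun v hv => ?_, ?_⟩, fun ⟨h, hz⟩ v hv => ?_⟩
        · have := h v fun i hi => hv i (Finset.mem_insert_of_mem hi)
          rwa [Function.update_of_ne (hv j (Finset.mem_insert_self _ _))] at this
        · simpa using h (reg j) fun i hi h => hj (by rwa [reg.injective h])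
        · by_cases hvj : v = reg j
          · subst hvj; simpa using hz
          · rw [Function.update_of_ne hvj]
            refine h v fun i hi => ?_
            rcases Finset.mem_insert.mp hi with rfl | hi
            · exact hvj
            · exact hv i hi
      have hval : ∀ z, ψ (Function.update s (reg j) z) =
          if (∀ v, (∀ i ∈ insert j P, v ≠ reg i) → s v = s₀ v) ∧ z = s₀ (reg j)
          then ∏ i ∈ P, G i (s (reg i)) else 0 := by
        intro z
        rw [hψ]
        refine if_congr (hcond z) (Finset.prod_congr rfl fun i hi => ?_) rfl
        rw [Function.update_of_ne fun h => hj (by rwa [← reg.injective h])]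
      have hval₀ : ∀ z, ¬((∀ v, (∀ i ∈ insert j P, v ≠ reg i) → s v = s₀ v) ∧ z = s₀ (reg j)) →
          ψ (Function.update s (reg j) z) = 0 := fun z hz => by rw [hval, if_neg hz]
      by_cases hs : ∀ v, (∀ i ∈ insert j P, v ≠ reg i) → s v = s₀ v
      · rw [Finset.sum_eq_single (s₀ (reg j)) (fun b _ hb => by
            rw [hval₀ b fun h => hb h.2, mul_zero]) (by simp),
          (hval _).trans (if_pos ⟨hs, rfl⟩), if_pos hs,
          Finset.prod_insert hj, hG j]
        have hc : ∀ c ∈ C j, s (reg c.1) = s₀ (reg c.1) := fun c hc => hs _ fun i hi h => by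
          have := reg.injective h
          rcases Finset.mem_insert.mp hi with rfl | hi
          · exact hC _ c hc this
          · exact hCj c hc (by rwa [this])
        rw [List.map_map]
        have : (C j).map ((fun c : W × ℝ => if s (reg j) && s c.1 then turn c.2 else 1) ∘
            fun c => (reg c.1, c.2)) =
            (C j).map fun c => if s (reg j) && s₀ (reg c.1) then turn c.2 else 1 :=
          List.map_congr_left fun c hc' => by simp [hc c hc']
        rw [this]
        ring
      · rw [if_neg hs, Finset.sum_eq_zero fun z _ => by rw [hval₀ z fun h => hs h.1, mul_zero],
          zero_mul]

theorem length_fourierStep_le (d w : W) (C : List (W × ℝ)) :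
    (fourierStep (ι := ι) (κ := κ) d w C).length ≤ 1 + C.length := by
  rw [fourierStep, List.length_append]
  refine add_le_add (length_gateIfNe_le _ _ _) ?_
  induction C with
  | nil => simp
  | cons c C ih =>
    rw [List.flatMap_cons, List.length_append, List.length_cons]
    have := length_gateIfNe_le (ι := ι) (κ := κ) w c.1 fun x => if x then phaseGate c.2 else 1
    omega

/-- Linearity, which reduces the Fourier transform of a superposition to that of basis states. -/
theorem WireGate.run_sum (F : Oracle ι κ) (l : List (WireGate ι κ W)) {X : Type} (T : Finset X)
    (c : X → ℂ) (φ : X → Ket W) :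
    run F l (fun s => ∑ x ∈ T, c x * φ x s) = fun s => ∑ x ∈ T, c x * run F l (φ x) s := by
  induction l generalizing φ with
  | nil => rfl
  | cons g l ih =>
    simp only [run_cons]
    rw [← ih]
    congr 1
    cases g with
    | ctrl w a h M =>
      funext s
      simp only [apply, act, Fintype.sum_bool, Finset.mul_sum, ← Finset.sum_add_distrib]
      exact Finset.sum_congr rfl fun x _ => by ring
    | query e => rfl

end Fourier

theorem Nat.ofBits_eq_sum {n : ℕ} (f : Fin n → Bool) :
    Nat.ofBits f = ∑ i : Fin n, (f i).toNat * 2 ^ (i : ℕ) := by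
  induction n with
  | zero => simp [Nat.ofBits]
  | succ n ih =>
    rw [Nat.ofBits_succ, ih, Fin.sum_univ_succ, Finset.mul_sum, add_comm]
    congr 1
    · simp
    · refine Finset.sum_congr rfl fun i _ => ?_
      simp only [Function.comp_apply, Fin.val_succ, pow_succ]
      ring

/-- The phases of the Fourier transform modulo `2 ^ n`; the output has its digits reversed. -/
theorem prod_fourier_phases {n : ℕ} (b z : Fin n → Bool) :
    ∏ i : Fin n, ((Real.sqrt 2 : ℂ)⁻¹ * (if b i && z i then -1 else 1) *
      ∏ l ∈ Finset.univ.filter (· < i),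
        (if b i && z l then turn (2 ^ (l : ℕ) / 2 ^ ((i : ℕ) + 1)) else 1)) =
      (Real.sqrt 2 : ℂ)⁻¹ ^ n *
        turn ((Nat.ofBits z : ℝ) * (Nat.ofBits fun k => b k.rev) / 2 ^ n) := by
  have e : (Nat.ofBits z : ℝ) * (Nat.ofBits fun k => b k.rev) / 2 ^ n =
      ∑ i : Fin n, ∑ l : Fin n, ((b i && z l).toNat : ℝ) * (2 ^ (l : ℕ) / 2 ^ ((i : ℕ) + 1)) := by
    have hb : (Nat.ofBits fun k => b k.rev) = ∑ i : Fin n, (b i).toNat * 2 ^ (n - (i + 1) : ℕ) := by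
      rw [Nat.ofBits_eq_sum, ← Equiv.sum_comp Fin.revPerm]
      simp
    rw [Nat.ofBits_eq_sum, hb]
    push_cast
    rw [mul_comm, Finset.sum_mul_sum, Finset.sum_div]
    refine Finset.sum_congr rfl fun i _ => ?_
    rw [Finset.sum_div]
    refine Finset.sum_congr rfl fun l _ => ?_
    have h2 : (2 : ℝ) ^ n = 2 ^ (n - (i + 1) : ℕ) * 2 ^ ((i : ℕ) + 1) := by
      rw [← pow_add]; congr 1; omega
    rw [h2]
    cases b i <;> cases z l <;> simp
    field_simp
  rw [e, turn_sum, Finset.prod_congr rfl fun i _ => mul_assoc _ _ _, Finset.prod_mul_distrib,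
    Finset.prod_const, Finset.card_univ, Fintype.card_fin]
  congr 1
  refine Finset.prod_congr rfl fun i _ => ?_
  rw [turn_sum, Finset.prod_filter]
  have h1 : (if (b i && z i) = true then (-1 : ℂ) else 1) =
      ∏ l : Fin n, if l = i then (if (b i && z l) = true then (-1 : ℂ) else 1) else 1 := by
    rw [Finset.prod_ite_eq' Finset.univ i]; simp
  rw [h1, ← Finset.prod_mul_distrib]
  refine Finset.prod_congr rfl fun l _ => ?_
  cases hb : (b i && z l)
  · simp [turn_zero]
  · simp only [if_true, Bool.toNat_true, Nat.cast_one, one_mul]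
    -- Digits `l < i` give the controlled phases, `l = i` gives the sign of the Hadamard gate, and
    -- `l > i` gives whole turns.
    rcases lt_trichotomy l i with h | rfl | h
    · simp [h, h.ne]
    · rw [if_pos rfl, if_neg (lt_irrefl _), mul_one, pow_succ, ← turn_half]
      congr 1
      field_simp
    · rw [if_neg h.ne', if_neg h.not_gt, mul_one]
      have : (2 : ℝ) ^ (l : ℕ) / 2 ^ ((i : ℕ) + 1) = ((2 ^ ((l : ℕ) - (i + 1)) : ℤ) : ℝ) := by
        have : (l : ℕ) = ((l : ℕ) - (i + 1)) + (i + 1) := by have : (i : ℕ) < l := h; omega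
        rw [this, pow_add, Nat.add_sub_cancel]
        push_cast
        field_simp
      rw [this, turn_intCast]

/-! ### Fourier and Hadamard transforms of registers -/

section Registers

variable {ι κ W : Type} [DecidableEq W] {n : ℕ}

/-- The digits that control phase shifts of a given digit in the Fourier transform of two
registers. -/
def qftControls : Fin n ⊕ Fin n → List ((Fin n ⊕ Fin n) × ℝ)
  | .inl i => (Finset.univ.filter (· < i)).toList.map fun l =>
      (.inl l, 2 ^ (l : ℕ) / 2 ^ ((i : ℕ) + 1))
  | .inr i => (Finset.univ.filter (· < i)).toList.map fun l =>
      (.inr l, 2 ^ (l : ℕ) / 2 ^ ((i : ℕ) + 1))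

/-- The order in which the Fourier transform treats the digits. -/
def qftOrder (n : ℕ) : List (Fin n ⊕ Fin n) :=
  (List.finRange n).reverse.map .inl ++ (List.finRange n).reverse.map .inr

/-- The Fourier transform modulo `2 ^ n` of two registers. -/
def qftGates (reg : Fin n ⊕ Fin n ↪ W) (d : W) : List (WireGate ι κ W) :=
  (qftOrder n).flatMap fun j =>
    fourierStep d (reg j) ((qftControls j).map fun c => (reg c.1, c.2))

theorem mem_qftControls_inl {i : Fin n} {c : (Fin n ⊕ Fin n) × ℝ} (h : c ∈ qftControls (.inl i)) :
    ∃ l < i, c.1 = .inl l := by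
  obtain ⟨l, hl, rfl⟩ := List.mem_map.mp h
  exact ⟨l, by simpa using hl, rfl⟩

theorem mem_qftControls_inr {i : Fin n} {c : (Fin n ⊕ Fin n) × ℝ} (h : c ∈ qftControls (.inr i)) :
    ∃ l < i, c.1 = .inr l := by
  obtain ⟨l, hl, rfl⟩ := List.mem_map.mp h
  exact ⟨l, by simpa using hl, rfl⟩

theorem mem_qftOrder (j : Fin n ⊕ Fin n) : j ∈ qftOrder n := by
  cases j <;> simp [qftOrder]

theorem nodup_qftOrder : (qftOrder n).Nodup := by
  have h := List.nodup_reverse.mpr (List.nodup_finRange n)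
  refine List.nodup_append.mpr ⟨h.map Sum.inl_injective, h.map Sum.inr_injective, ?_⟩
  rintro _ ha _ hb rfl
  obtain ⟨a, -, rfl⟩ := List.mem_map.mp ha
  obtain ⟨b, -, hb⟩ := List.mem_map.mp hb
  exact Sum.inr_ne_inl hb

/-- Digits are treated from the highest down, and phases are controlled by lower digits of the same
register. -/
theorem pairwise_qftOrder :
    (qftOrder n).Pairwise fun j j' => ∀ c ∈ qftControls j', c.1 ≠ j := by
  have h : (List.finRange n).reverse.Pairwise fun i i' => i' < i :=
    List.pairwise_reverse.mpr (List.pairwise_lt_finRange n)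
  refine List.pairwise_append.mpr ⟨List.pairwise_map.mpr (h.imp ?_),
    List.pairwise_map.mpr (h.imp ?_), ?_⟩
  · intro i i' hi c hc e
    obtain ⟨l, hl, hl'⟩ := mem_qftControls_inl hc
    rw [hl', Sum.inl.injEq] at e
    exact absurd (hl.trans hi) (by simp [e])
  · intro i i' hi c hc e
    obtain ⟨l, hl, hl'⟩ := mem_qftControls_inr hc
    rw [hl', Sum.inr.injEq] at e
    exact absurd (hl.trans hi) (by simp [e])
  · rintro _ ha _ hb c hc e
    obtain ⟨a, -, rfl⟩ := List.mem_map.mp ha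
    obtain ⟨b, -, rfl⟩ := List.mem_map.mp hb
    obtain ⟨l, hl, hl'⟩ := mem_qftControls_inr hc
    rw [hl'] at e
    exact Sum.inr_ne_inl e

theorem length_flatMap_le {α β : Type} (l : List α) (f : α → List β) (k : ℕ)
    (h : ∀ a ∈ l, (f a).length ≤ k) : (l.flatMap f).length ≤ l.length * k := by
  induction l with
  | nil => simp
  | cons a l ih =>
    have h1 := h a List.mem_cons_self
    have h2 := ih fun b hb => h b (List.mem_cons_of_mem _ hb)
    rw [List.flatMap_cons, List.length_append, List.length_cons, add_mul]
    omega

theorem length_qftGates_le (reg : Fin n ⊕ Fin n ↪ W) (d : W) :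
    (qftGates (ι := ι) (κ := κ) reg d).length ≤ (n + n) * (1 + n) := by
  refine (length_flatMap_le _ _ (1 + n) fun j _ => ?_).trans (by simp [qftOrder])
  refine (length_fourierStep_le _ _ _).trans ?_
  have h : ∀ i : Fin n, (Finset.univ.filter (· < i)).card ≤ n := fun i =>
    (Finset.card_le_univ _).trans (by simp)
  cases j with
  | inl i => simpa [qftControls] using h i
  | inr i => simpa [qftControls] using h i

-- The transform leaves its output with the digits reversed. No swaps are made; the wires are read
-- in the order given by `rev` instead.
open scoped Classical in
theorem run_qftGates [Fintype W] (F : Oracle ι κ) (reg : Fin n ⊕ Fin n ↪ W) (d : W)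
    (hd : ∀ j, d ≠ reg j) (s₀ s : W → Bool) :
    WireGate.run F (qftGates reg d) (Pi.single s₀ 1) s =
      if ∀ v, (∀ j, v ≠ reg j) → s v = s₀ v then
        (1 / 2 : ℂ) ^ n * turn (((Nat.ofBits fun i => s₀ (reg (.inl i)) : ℕ) *
          (Nat.ofBits fun i : Fin n => s (reg (.inl i.rev)) : ℕ) +
          (Nat.ofBits fun i => s₀ (reg (.inr i)) : ℕ) *
          (Nat.ofBits fun i : Fin n => s (reg (.inr i.rev)) : ℕ)) / 2 ^ n)
      else 0 := by
  rw [qftGates, run_fourier F reg d hd qftControls s₀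
    (fun j b => (Real.sqrt 2 : ℂ)⁻¹ * (if b && s₀ (reg j) then -1 else 1) *
      ((qftControls j).map fun c => if b && s₀ (reg c.1) then turn c.2 else 1).prod)
    (fun _ _ => rfl) ?_ _ nodup_qftOrder pairwise_qftOrder ∅ (by simp)
    Finset.univ (by simp [mem_qftOrder]) _ ?_ s]
  · simp only [Finset.mem_univ, true_implies]
    congr 1
    rw [Fintype.prod_sum_type]
    simp only [qftControls, List.map_map, Function.comp_def, Finset.prod_map_toList]
    rw [prod_fourier_phases (fun i => s (reg (.inl i))) (fun i => s₀ (reg (.inl i))),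
      prod_fourier_phases (fun i => s (reg (.inr i))) (fun i => s₀ (reg (.inr i))), add_div, turn_add]
    have h : (Real.sqrt 2 : ℂ)⁻¹ ^ n * (Real.sqrt 2 : ℂ)⁻¹ ^ n = (1 / 2) ^ n := by
      rw [← mul_pow, ← mul_inv, ← Complex.ofReal_mul, Real.mul_self_sqrt zero_le_two]
      simp
    rw [← h]
    ring
  · rintro (i | i) c hc e
    · obtain ⟨l, hl, hl'⟩ := mem_qftControls_inl hc
      rw [hl', Sum.inl.injEq] at e
      exact hl.ne e
    · obtain ⟨l, hl, hl'⟩ := mem_qftControls_inr hc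
      rw [hl', Sum.inr.injEq] at e
      exact hl.ne e
  · intro s
    simp [Pi.single_apply, funext_iff]

/-- Hadamard gates on all wires of a register. -/
def hadamardGates {J : Type} [Fintype J] (reg : J ↪ W) (d : W) : List (WireGate ι κ W) :=
  (Finset.univ : Finset J).toList.flatMap fun j => fourierStep d (reg j) []

theorem length_hadamardGates_le {J : Type} [Fintype J] (reg : J ↪ W) (d : W) :
    (hadamardGates (ι := ι) (κ := κ) reg d).length ≤ Fintype.card J := by
  refine (length_flatMap_le _ _ 1 fun j _ => length_fourierStep_le _ _ _).trans ?_
  simp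

open scoped Classical in
theorem run_hadamardGates [Fintype W] {J : Type} [Fintype J] (F : Oracle ι κ) (reg : J ↪ W)
    (d : W) (hd : ∀ j, d ≠ reg j) (s : W → Bool) :
    WireGate.run F (hadamardGates reg d) (zeroKet W) s =
      if ∀ v, (∀ j, v ≠ reg j) → s v = false then (Real.sqrt 2 : ℂ)⁻¹ ^ Fintype.card J else 0 := by
  have h := run_fourier F reg d hd (fun _ => []) (fun _ => false)
    (fun _ _ => (Real.sqrt 2 : ℂ)⁻¹) (by simp) (by simp) (Finset.univ : Finset J).toList
    (Finset.nodup_toList _) (List.pairwise_of_forall (by simp)) ∅ (by simp)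
    Finset.univ (by simp) (zeroKet W)
    (fun s => by simp [zeroKet, Pi.single_apply, funext_iff]) s
  simpa [hadamardGates] using h

end Registers

/-! ### Programs for the root-of-unity test and the rounded quotient -/

/-- The number of auxiliary bits for a multiplication modulo an `L`-digit number. -/
def mulCost (L : ℕ) : ℕ := (29 * L + 10) * L

section Programs

variable {ι κ I : Type}

theorem HasNum.ofBits {S : Set (Inputs ι κ I → Bool)} (hc : ∀ b, (fun _ => b) ∈ S) {n : ℕ}
    (f : Fin n → Inputs ι κ I → Bool) (hf : ∀ i, f i ∈ S) :
    HasNum S fun x => Nat.ofBits fun i => f i x := by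
  refine HasNum.of_lt (L := n) hc (fun x => Nat.ofBits_lt_two_pow _) fun i hi => ?_
  simpa [Nat.testBit_ofBits_lt _ i hi] using hf ⟨i, hi⟩

variable [Fintype ι] [Fintype κ]

/-- A test whether two residues `a`, `x` are reduced modulo `p` and `a ^ r = 1`. -/
theorem Reach.rootOfUnity_test {S : Set (Inputs ι κ I → Bool)} (hc : ∀ b, (fun _ => b) ∈ S)
    {a x : Inputs ι κ I → ℕ} (ha : HasNum S a) (hx : HasNum S x) {L p r : ℕ}
    (hLa : ∀ y, a y < 2 ^ L) (hLx : ∀ y, x y < 2 ^ L) (hp : 1 < p) (hpL : p < 2 ^ L)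
    (hLp : 2 ^ L ≤ 2 * p) (hr : r < 2 ^ L) :
    ∃ S', Reach (25 * L + 7 + 2 * mulCost L * L) S S' ∧
      (fun y => decide (a y < p ∧ x y < p ∧ a y ^ r % p = 1)) ∈ S' := by
  have hp0 : 0 < p := by omega
  obtain ⟨S₁, h₁, m₁, -⟩ := HasNum.compare hc ha hLa hp0 hpL.le
  have hc₁ : ∀ b, (fun _ => b) ∈ S₁ := fun b => h₁.1 (hc b)
  obtain ⟨S₂, h₂, m₂, -⟩ := HasNum.compare hc₁ (hx.mono h₁.1) hLx hp0 hpL.le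
  have hc₂ : ∀ b, (fun _ => b) ∈ S₂ := fun b => h₂.1 (hc₁ b)
  -- Adding zero modulo `p` reduces `a`, which may exceed `p`, as `powMod` requires; one subtraction
  -- suffices because `2 ^ L ≤ 2 p`.
  obtain ⟨S₃, h₃, m₃⟩ := HasNum.addMod (L := L) hc₂ ((ha.mono h₁.1).mono h₂.1)
    (HasNum.const hc₂ 0) hLa (fun _ => Nat.two_pow_pos L) hp0 hpL.le
    (fun y => by have := hLa y; omega)
  have hc₃ : ∀ b, (fun _ => b) ∈ S₃ := fun b => h₃.1 (hc₂ b)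
  obtain ⟨S₄, h₄, m₄⟩ := HasNum.powMod (L := L) hc₃ m₃ (fun y => Nat.mod_lt _ hp0) hp0 hpL.le L r hr
  have hc₄ : ∀ b, (fun _ => b) ∈ S₄ := fun b => h₄.1 (hc₃ b)
  obtain ⟨S₅, h₅, m₅⟩ := Reach.forall_eq (S := S₄) (Finset.range L)
    (fun i y => (((a y + 0) % p) ^ r % p).testBit i) (fun i _ => (1 : ℕ).testBit i)
    hc₄ (fun i _ => m₄ i) (fun i _ => hc₄ _)
  obtain ⟨S₆, h₆, m₆⟩ := Reach.bin (fun a b => !a && b) (h₅.1 (h₄.1 (h₃.1 (h₂.1 m₁)))) m₅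
  obtain ⟨S₇, h₇, m₇⟩ := Reach.bin (fun a b => !a && b) (h₆.1 (h₅.1 (h₄.1 (h₃.1 m₂)))) m₆
  refine ⟨S₇, ((((((h₁.trans h₂).trans h₃).trans h₄).trans h₅).trans h₆).trans h₇).mono ?_, ?_⟩
  · rw [Finset.card_range, mulCost]; omega
  · convert m₇ using 2 with y
    have hbits : (∀ i ∈ Finset.range L, ((a y ^ r % p).testBit i) = (1 : ℕ).testBit i) ↔
        a y ^ r % p = 1 := by
      refine ⟨fun h => Nat.eq_of_testBit_eq fun i => ?_, fun h i _ => by rw [h]⟩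
      by_cases hi : i < L
      · exact h i (Finset.mem_range.mpr hi)
      · have h1 : (1 : ℕ) < 2 ^ i := hp.trans (hpL.trans_le (Nat.pow_le_pow_right two_pos (by omega)))
        have h2 : a y ^ r % p < 2 ^ i := (Nat.mod_lt _ hp0).trans
          (hpL.trans_le (Nat.pow_le_pow_right two_pos (by omega)))
        rw [Nat.testBit_lt_two_pow h1, Nat.testBit_lt_two_pow h2]
    rw [add_zero, ← Nat.pow_mod]
    simp only [hbits]
    rw [Bool.eq_iff_iff]
    simp
    tauto

/-- The quotient `u / v` modulo `p`, where `u = ⌊p U / 2 ^ n⌋` and `v = ⌊p V / 2 ^ n⌋`. -/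
def roundedQuotient (p n U V : ℕ) : ℕ :=
  (p * U / 2 ^ n * ((p * V / 2 ^ n) ^ (p - 2) % p)) % p

theorem HasNum.roundedQuotient {S : Set (Inputs ι κ I → Bool)} (hc : ∀ b, (fun _ => b) ∈ S)
    {U V : Inputs ι κ I → ℕ} (hU : HasNum S U) (hV : HasNum S V) {L p n : ℕ}
    (hLU : ∀ y, U y < 2 ^ n) (hLV : ∀ y, V y < 2 ^ n) (hp : 1 < p) (hpL : p < 2 ^ L) :
    ∃ S', Reach (16 * L * n + 2 * mulCost L * L + mulCost L) S S' ∧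
      HasNum S' fun y => roundedQuotient p n (U y) (V y) := by
  have hp0 : 0 < p := by omega
  have hlt : ∀ N, N < 2 ^ n → p * N / 2 ^ n < p := fun N hN => by
    rw [Nat.div_lt_iff_lt_mul (Nat.two_pow_pos n)]
    exact Nat.mul_lt_mul_of_pos_left hN hp0
  obtain ⟨S₁, h₁, m₁⟩ := HasNum.mulShift hc hU hp0 hpL hLU
  have hc₁ : ∀ b, (fun _ => b) ∈ S₁ := fun b => h₁.1 (hc b)
  obtain ⟨S₂, h₂, m₂⟩ := HasNum.mulShift hc₁ (hV.mono h₁.1) hp0 hpL hLV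
  have hc₂ : ∀ b, (fun _ => b) ∈ S₂ := fun b => h₂.1 (hc₁ b)
  -- By Fermat, the power `p - 2` inverts nonzero residues.
  obtain ⟨S₃, h₃, m₃⟩ := HasNum.powMod (L := L) hc₂ m₂ (fun y => hlt _ (hLV y)) hp0 hpL.le L (p - 2)
    (by omega)
  have hc₃ : ∀ b, (fun _ => b) ∈ S₃ := fun b => h₃.1 (hc₂ b)
  obtain ⟨S₄, h₄, m₄⟩ := HasNum.mulMod (L := L) hc₃ ((m₁.mono h₂.1).mono h₃.1) m₃
    (fun y => (hlt _ (hLU y)).trans hpL) (fun y => Nat.mod_lt _ hp0) hp0 hpL.le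
  refine ⟨S₄, (((h₁.trans h₂).trans h₃).trans h₄).mono ?_, m₄⟩
  have e : 16 * L * n = 8 * L * n + 8 * L * n := by ring
  rw [mulCost, e]

end Programs

/-! ### Rounded frequencies and interference -/

/-- The least `U` with `U / Q ≥ u / p`. -/
def roundUp (p Q u : ℕ) : ℕ := (Q * u + (p - 1)) / p

theorem roundUp_bounds {p : ℕ} (Q u : ℕ) (hp : 0 < p) :
    Q * u ≤ p * roundUp p Q u ∧ p * roundUp p Q u < Q * u + p := by
  unfold roundUp
  have h1 := Nat.div_add_mod (Q * u + (p - 1)) p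
  have h2 := Nat.mod_lt (Q * u + (p - 1)) hp
  omega

theorem roundUp_lt {p Q u : ℕ} (hu : u < p) (hpQ : p ≤ Q) : roundUp p Q u < Q := by
  have h := (roundUp_bounds (p := p) Q u (by omega)).2
  have h2 : Q * (u + 1) ≤ Q * p := Nat.mul_le_mul_left _ hu
  have h3 : p * roundUp p Q u < p * Q := by linarith
  exact lt_of_mul_lt_mul_left h3 (Nat.zero_le _)

/-- The excess `p * roundUp p Q u - Q * u` is smaller than `p ≤ Q`, so rounding down undoes rounding
up. -/
theorem mul_roundUp_div {p Q : ℕ} (u : ℕ) (hp : 0 < p) (hpQ : p ≤ Q) :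
    p * roundUp p Q u / Q = u := by
  have h := roundUp_bounds Q u hp
  rw [Nat.div_eq_iff (by omega)]
  rw [mul_comm u Q]
  omega

theorem roundedQuotient_roundUp {p : ℕ} [Fact p.Prime] {n : ℕ} (hpn : p ≤ 2 ^ n) (v t : ZMod p)
    (hv : v ≠ 0) :
    roundedQuotient p n (roundUp p (2 ^ n) (v * t).val) (roundUp p (2 ^ n) v.val) = t.val := by
  have hp : 1 < p := (Fact.out : p.Prime).one_lt
  rw [roundedQuotient, mul_roundUp_div _ (by omega) hpn, mul_roundUp_div _ (by omega) hpn,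
    ← ZMod.val_natCast]
  congr 1
  push_cast
  rw [ZMod.natCast_zmod_val, ZMod.natCast_mod]
  push_cast
  rw [ZMod.natCast_zmod_val]
  have h := ZMod.pow_card_sub_one_eq_one hv
  have e : p - 1 = (p - 2) + 1 := by omega
  rw [e, pow_succ] at h
  linear_combination t * h

theorem size_bounds {p : ℕ} (hp : 0 < p) : p < 2 ^ bitLen p ∧ 2 ^ bitLen p ≤ 2 * p := by
  refine ⟨Nat.lt_size_self p, ?_⟩
  have h : 0 < Nat.size p := Nat.size_pos.mpr hp
  have h1 : 2 ^ (Nat.size p - 1) ≤ p := Nat.lt_size.mp (by omega)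
  have e : Nat.size p = (Nat.size p - 1) + 1 := by omega
  show 2 ^ Nat.size p ≤ 2 * p
  rw [e, pow_succ]
  omega

theorem ofBits_residueBits {p : ℕ} [NeZero p] (x : ZMod p) : Nat.ofBits (residueBits x) = x.val := by
  refine Nat.eq_of_testBit_eq fun i => ?_
  by_cases hi : i < bitLen p
  · rw [Nat.testBit_ofBits_lt _ i hi]; rfl
  · rw [Nat.testBit_ofBits_ge _ i (by omega), Nat.testBit_lt_two_pow]
    exact (ZMod.val_lt x).trans ((size_bounds (NeZero.pos p)).1.trans_le
      (Nat.pow_le_pow_right two_pos (by omega)))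

theorem residueBits_injective {p : ℕ} [NeZero p] :
    Function.Injective (residueBits : ZMod p → _) := fun x y h => by
  apply ZMod.val_injective p
  rw [← ofBits_residueBits, h, ofBits_residueBits]

theorem residueBits_natCast_ofBits {p : ℕ} (b : Fin (bitLen p) → Bool) (hb : Nat.ofBits b < p) :
    residueBits ((Nat.ofBits b : ℕ) : ZMod p) = b := by
  funext i
  rw [residueBits, ZMod.val_cast_of_lt hb, Nat.testBit_ofBits_lt _ i i.2]

/-- Constructive interference: the phases at the rounded frequencies nearly agree. -/
theorem norm_sum_turn_ge {p : ℕ} [NeZero p] {Q : ℕ} (hQ : 16 * p ≤ Q) (u v w : ZMod p) {J : Type}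
    (T : Finset J) (a x : J → ZMod p) (h : ∀ j ∈ T, u * a j + v * x j = w) :
    (T.card : ℝ) ^ 2 / 2 ≤ ‖∑ j ∈ T, turn (((a j).val * (roundUp p Q u.val : ℕ) +
      (x j).val * (roundUp p Q v.val : ℕ)) / Q)‖ ^ 2 := by
  have hp : (0 : ℝ) < p := by exact_mod_cast NeZero.pos p
  have hQ' : (16 : ℝ) * p ≤ Q := by exact_mod_cast hQ
  have hQ0 : (0 : ℝ) < Q := by linarith
  -- The phase error, in turns, caused by rounding the two frequencies. Up to whole turns the exact
  -- phase is `w / p` for every `j`.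
  set ε : J → ℝ := fun j => ((a j).val * (p * (roundUp p Q u.val : ℕ) - Q * u.val) +
    (x j).val * (p * (roundUp p Q v.val : ℕ) - Q * v.val)) / (p * Q) with hε
  have hphase : ∀ j ∈ T, turn (((a j).val * (roundUp p Q u.val : ℕ) +
      (x j).val * (roundUp p Q v.val : ℕ)) / Q) = turn (w.val / p) * turn (ε j) := by
    intro j hj
    have hmod : (u.val * (a j).val + v.val * (x j).val) % p = w.val := by
      rw [← ZMod.val_natCast, ← h j hj]
      congr 1
      push_cast
      simp only [ZMod.natCast_zmod_val]
    have hk := Nat.div_add_mod (u.val * (a j).val + v.val * (x j).val) p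
    rw [hmod] at hk
    set k := (u.val * (a j).val + v.val * (x j).val) / p
    have hk' : (p : ℝ) * k + w.val = u.val * (a j).val + v.val * (x j).val := by exact_mod_cast hk
    have e : (((a j).val * (roundUp p Q u.val : ℕ) + (x j).val * (roundUp p Q v.val : ℕ)) / Q : ℝ) =
        (w.val / p + ε j) + ((k : ℤ) : ℝ) := by
      have : (k : ℝ) = (u.val * (a j).val + v.val * (x j).val - w.val) / p := by
        rw [← hk']; field_simp; ring
      simp only [hε, Int.cast_natCast, this]
      field_simp
      ring
    rw [e, turn_add, turn_intCast, mul_one, turn_add]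
  rw [Finset.sum_congr rfl hphase, ← Finset.mul_sum, norm_mul, norm_turn, one_mul]
  have hre : (T.card : ℝ) * (Real.sqrt 2 / 2) ≤ (∑ j ∈ T, turn (ε j)).re := by
    rw [Complex.re_sum, ← nsmul_eq_mul]
    refine Finset.card_nsmul_le_sum _ _ _ fun j _ => ?_
    rw [turn_re, ← Real.cos_pi_div_four]
    have hb : ∀ y z : ZMod p, 0 ≤ (y.val : ℝ) * (p * (roundUp p Q z.val : ℕ) - Q * z.val) ∧
        (y.val : ℝ) * (p * (roundUp p Q z.val : ℕ) - Q * z.val) ≤ p * p := by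
      intro y z
      obtain ⟨h1, h2⟩ := roundUp_bounds Q z.val (NeZero.pos p)
      have h1' : (Q : ℝ) * z.val ≤ p * (roundUp p Q z.val : ℕ) := by exact_mod_cast h1
      have h2' : (p : ℝ) * (roundUp p Q z.val : ℕ) < Q * z.val + p := by exact_mod_cast h2
      have hy : (y.val : ℝ) ≤ p := by exact_mod_cast (ZMod.val_lt y).le
      refine ⟨mul_nonneg (Nat.cast_nonneg _) (by linarith), mul_le_mul hy (by linarith)
        (by linarith) hp.le⟩
    have hε0 : 0 ≤ ε j := div_nonneg (add_nonneg (hb _ _).1 (hb _ _).1) (by positivity)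
    -- Two errors of at most `p²`, divided by `p Q ≥ 16 p²`. One eighth of a turn has cosine `√2 /
    -- 2`, whose square is the factor `1 / 2`.
    have hε1 : ε j ≤ 1 / 8 := by
      rw [hε]
      simp only
      rw [div_le_iff₀ (by positivity)]
      have := (hb (a j) u).2
      have := (hb (x j) v).2
      nlinarith
    refine Real.cos_le_cos_of_nonneg_of_le_pi (by positivity) (by linarith [Real.pi_pos]) ?_
    nlinarith [Real.pi_pos]
  have hnorm := hre.trans (Complex.re_le_norm _)
  have hsq : (Real.sqrt 2) ^ 2 = 2 := Real.sq_sqrt zero_le_two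
  calc (T.card : ℝ) ^ 2 / 2 = ((T.card : ℝ) * (Real.sqrt 2 / 2)) ^ 2 := by
        rw [mul_pow, div_pow, hsq]; ring
    _ ≤ _ := pow_le_pow_left₀ (by positivity) hnorm 2

/-! ### One round of Fourier sampling -/

/-- The wires of one round: two registers of `n` digits, `m` wires for the answer of the oracle, a
flag, and `K` auxiliary wires. -/
abbrev TrialWire (n m K : ℕ) : Type := (Fin n ⊕ Fin n) ⊕ (Fin m ⊕ (Unit ⊕ Fin K))

namespace TrialWire

variable {L n m K : ℕ}

/-- The two registers. -/
def reg : Fin n ⊕ Fin n ↪ TrialWire n m K := Function.Embedding.inl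

/-- The lower `L` digits of the registers. -/
def low (h : L ≤ n) : Fin L ⊕ Fin L ↪ TrialWire n m K :=
  (Function.Embedding.sumMap (Fin.castLEEmb h) (Fin.castLEEmb h)).trans reg

/-- The flag. -/
def flag : TrialWire n m K := .inr (.inr (.inl ()))

/-- The auxiliary wires. -/
def anc : Fin K ↪ TrialWire n m K :=
  ⟨fun k => .inr (.inr (.inr k)), fun k k' h => by simpa using h⟩

/-- The wires for a query with the lower digits as argument. -/
def oracle (h : L ≤ n) : (Fin L ⊕ Fin L) ⊕ Fin m ↪ TrialWire n m K :=
  ⟨Sum.elim (low h) fun j => .inr (.inl j), by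
    rintro (i | i) (j | j) hij
    · exact congrArg _ ((low h).injective hij)
    · simp [low, reg] at hij
    · simp [low, reg] at hij
    · simpa using hij⟩

theorem low_inl (h : L ≤ n) (i : Fin L) :
    low (m := m) (K := K) h (.inl i) = .inl (.inl (Fin.castLE h i)) := rfl

theorem low_inr (h : L ≤ n) (i : Fin L) :
    low (m := m) (K := K) h (.inr i) = .inl (.inr (Fin.castLE h i)) := rfl

theorem low_ne_anc (h : L ≤ n) (i : Fin L ⊕ Fin L) (k : Fin K) :
    low (m := m) h i ≠ anc k := by rintro ⟨⟩

theorem low_ne_flag (h : L ≤ n) (i : Fin L ⊕ Fin L) :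
    low (m := m) (K := K) h i ≠ flag := by rintro ⟨⟩

theorem anc_ne_flag (k : Fin K) : (anc k : TrialWire n m K) ≠ flag := by
  rintro ⟨⟩

theorem flag_ne_reg (j : Fin n ⊕ Fin n) : (flag : TrialWire n m K) ≠ reg j := by rintro ⟨⟩

/-- The basis state with given lower digits. -/
def basis (b : Fin L ⊕ Fin L → Bool) : TrialWire n m K → Bool :=
  Sum.elim (Sum.elim (fun i => if h : (i : ℕ) < L then b (.inl ⟨i, h⟩) else false)
    fun i => if h : (i : ℕ) < L then b (.inr ⟨i, h⟩) else false) fun _ => false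

theorem basis_low (h : L ≤ n) (b : Fin L ⊕ Fin L → Bool) :
    basis (m := m) (K := K) b ∘ low h = b := by
  funext i
  rcases i with i | i <;> simp [basis, low_inl, low_inr]

theorem basis_eq_false (h : L ≤ n) (b : Fin L ⊕ Fin L → Bool) (v : TrialWire n m K)
    (hv : ∀ j, v ≠ low h j) : basis b v = false := by
  rcases v with (i | i) | v
  · by_cases hi : (i : ℕ) < L
    · exact absurd rfl (hv (.inl ⟨i, hi⟩))
    · simp [basis, hi]
  · by_cases hi : (i : ℕ) < L
    · exact absurd rfl (hv (.inr ⟨i, hi⟩))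
    · simp [basis, hi]
  · rfl

theorem eq_basis (h : L ≤ n) (s : TrialWire n m K → Bool)
    (hs : ∀ v, (∀ j, v ≠ low h j) → s v = false) : s = basis (s ∘ low h) := by
  funext v
  by_cases hv : ∃ j, v = low h j
  · obtain ⟨j, rfl⟩ := hv
    exact (congrFun (basis_low h (s ∘ low h)) j).symm
  · push Not at hv
    rw [hs v hv, basis_eq_false h _ v hv]

theorem ofBits_extend (h : L ≤ n) (b : Fin L → Bool) :
    (Nat.ofBits fun i : Fin n => if h : (i : ℕ) < L then b ⟨i, h⟩ else false) = Nat.ofBits b := by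
  refine Nat.eq_of_testBit_eq fun i => ?_
  by_cases hi : i < n
  · rw [Nat.testBit_ofBits_lt _ i hi]
    by_cases hL : i < L
    · rw [Nat.testBit_ofBits_lt _ i hL]; simp [hL]
    · rw [Nat.testBit_ofBits_ge _ i (by omega)]; simp [hL]
  · rw [Nat.testBit_ofBits_ge _ i (by omega), Nat.testBit_ofBits_ge _ i (by omega)]

/-- The number in the first register. -/
def measuredLeft (s : TrialWire n m K → Bool) : ℕ := Nat.ofBits fun i : Fin n => s (reg (.inl i.rev))

/-- The number in the second register. -/
def measuredRight (s : TrialWire n m K → Bool) : ℕ :=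
  Nat.ofBits fun i : Fin n => s (reg (.inr i.rev))

/-- The outcome with raised flag, given numbers, and given oracle answer. -/
def outcome (U V : ℕ) (y : Fin m → Bool) : TrialWire n m K → Bool :=
  Sum.elim (Sum.elim (fun i => U.testBit i.rev) fun i => V.testBit i.rev)
    (Sum.elim y (Sum.elim (fun _ => true) fun _ => false))

theorem ofBits_testBit_eq {U : ℕ} (hU : U < 2 ^ n) :
    (Nat.ofBits fun i : Fin n => U.testBit i) = U := by
  refine Nat.eq_of_testBit_eq fun i => ?_
  by_cases hi : i < n
  · rw [Nat.testBit_ofBits_lt _ i hi]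
  · rw [Nat.testBit_ofBits_ge _ i (by omega), Nat.testBit_lt_two_pow]
    exact hU.trans_le (Nat.pow_le_pow_right two_pos (by omega))

theorem measuredLeft_outcome {U : ℕ} (hU : U < 2 ^ n) (V : ℕ) (y : Fin m → Bool) :
    measuredLeft (outcome (K := K) U V y : TrialWire n m K → Bool) = U := by
  have h : measuredLeft (outcome (K := K) U V y : TrialWire n m K → Bool) =
    Nat.ofBits fun i : Fin n => U.testBit i.rev.rev := rfl
  simpa only [h, Fin.rev_rev] using ofBits_testBit_eq hU

theorem measuredRight_outcome {V : ℕ} (hV : V < 2 ^ n) (U : ℕ) (y : Fin m → Bool) :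
    measuredRight (outcome (K := K) U V y : TrialWire n m K → Bool) = V := by
  have h : measuredRight (outcome (K := K) U V y : TrialWire n m K → Bool) =
    Nat.ofBits fun i : Fin n => V.testBit i.rev.rev := rfl
  simpa only [h, Fin.rev_rev] using ofBits_testBit_eq hV

/-- The circuit of one round, where `l` computes the flag. -/
def gates (h : L ≤ n) (l : List (WireGate (Fin L ⊕ Fin L) (Fin m) (TrialWire n m K))) :
    List (WireGate (Fin L ⊕ Fin L) (Fin m) (TrialWire n m K)) :=
  hadamardGates (low h) flag ++ (l ++ (.query (oracle h) :: qftGates reg flag))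

-- Each `b` is mapped to a basis state by the flag computation and the query. It reaches the given
-- outcome iff its flag is raised and its answer is `y`, and then it contributes one phase. The
-- Hadamard gates on `2 L` wires give `2 ^ (-L)`, the two Fourier transforms `2 ^ (-n)`.
open scoped Classical in
theorem run_gates (h : L ≤ n) (l : List (WireGate (Fin L ⊕ Fin L) (Fin m) (TrialWire n m K)))
    (F : Oracle (Fin L ⊕ Fin L) (Fin m)) (τ : Equiv.Perm (TrialWire n m K → Bool))
    (hl : ∀ ψ, WireGate.run F l ψ = ψ ∘ τ.symm) (good : (Fin L ⊕ Fin L → Bool) → Bool)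
    (hτ : ∀ s, (∀ k, s (anc k) = false) →
      τ s = Function.update s flag (xor (s flag) (good (s ∘ low h))))
    {U V : ℕ} (hU : U < 2 ^ n) (hV : V < 2 ^ n) (y : Fin m → Bool) :
    WireGate.run F (gates h l) (zeroKet _) (outcome U V y) =
      (1 / 2) ^ L * (1 / 2) ^ n * ∑ b : Fin L ⊕ Fin L → Bool, if good b ∧ F b = y then
        turn (((Nat.ofBits fun i => b (.inl i) : ℕ) * U +
          (Nat.ofBits fun i => b (.inr i) : ℕ) * V) / 2 ^ n) else 0 := by
  set σ : Equiv.Perm (TrialWire n m K → Bool) := queryPerm (oracle h) F * τ with hσ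
  set ψ₁ := WireGate.run F (hadamardGates (low h) flag) (zeroKet (TrialWire n m K)) with hψ₁
  -- Expansion in the images under `σ` of basis states, to which linearity applies.
  have hψ₃ : ψ₁ ∘ σ.symm = fun s => ∑ s₁, ψ₁ s₁ * (Pi.single (σ s₁) 1 : Ket _) s := by
    funext s
    rw [Finset.sum_eq_single (σ.symm s)]
    · simp
    · intro s₁ _ hs₁
      rw [Pi.single_apply, if_neg, mul_zero]
      rintro rfl
      simp at hs₁
    · simp
  have hstate : WireGate.run F (gates h l) (zeroKet _) =
      WireGate.run F (qftGates reg flag) (ψ₁ ∘ σ.symm) := by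
    rw [gates, WireGate.run_append, WireGate.run_append, hl, WireGate.run_cons]
    rfl
  rw [hstate, hψ₃, WireGate.run_sum]
  simp only
  rw [Finset.mul_sum]
  symm
  have hone : ((Real.sqrt 2 : ℂ)⁻¹) ^ Fintype.card (Fin L ⊕ Fin L) = (1 / 2) ^ L := by
    rw [Fintype.card_sum, Fintype.card_fin, pow_add, ← mul_pow, ← mul_inv, ← Complex.ofReal_mul,
      Real.mul_self_sqrt zero_le_two]
    simp
  refine Finset.sum_of_injOn basis (fun b _ b' _ hb => ?_) (fun _ _ => Finset.mem_univ _) ?_ ?_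
  · rw [← basis_low (m := m) (K := K) h b, hb, basis_low]
  · intro s _ hs
    rw [hψ₁, run_hadamardGates F (low h) flag (fun j => (low_ne_flag h j).symm), if_neg, zero_mul]
    intro h0
    exact hs ⟨s ∘ low h, by simp, (eq_basis h s h0).symm⟩
  · intro b _
    rw [hψ₁, run_hadamardGates F (low h) flag (fun j => (low_ne_flag h j).symm),
      if_pos (basis_eq_false h b), hone, mul_assoc]
    congr 1
    rw [run_qftGates F reg flag flag_ne_reg]
    have hτb : τ (basis b) = Function.update (basis b) flag (good b) := by
      rw [hτ _ fun k => rfl, basis_low]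
      exact congrArg _ (Bool.false_xor _)
    have hreg : ∀ j, σ (basis b) (reg j) = basis (m := m) (K := K) b (reg j) := by
      intro j
      refine (queryMap_of_ne _ _ _ fun j => ?_).trans ?_
      · rintro ⟨⟩
      · rw [hτb, Function.update_of_ne (flag_ne_reg j).symm]
    have hflag : σ (basis b) flag = good b := by
      refine (queryMap_of_ne _ _ _ fun j => ?_).trans ?_
      · rintro ⟨⟩
      · rw [hτb, Function.update_self]
    have hanc : ∀ k, σ (basis b) (anc k) = false := by
      intro k
      refine (queryMap_of_ne _ _ _ fun j => ?_).trans ?_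
      · rintro ⟨⟩
      · rw [hτb, Function.update_of_ne (anc_ne_flag k)]; rfl
    have hans : ∀ j, σ (basis b) (.inr (.inl j)) = F b j := by
      intro j
      refine (queryMap_ans (oracle h) F _ j).trans ?_
      have harg : (fun i => τ (basis b) (oracle (m := m) (K := K) h (.inl i))) = b := by
        rw [hτb]
        funext i
        refine (Function.update_of_ne (low_ne_flag h i) _ _).trans (congrFun (basis_low h b) i)
      rw [harg, hτb, Function.update_of_ne (by rintro ⟨⟩)]
      exact Bool.false_xor _
    have hcond : (∀ v, (∀ j, v ≠ reg j) → outcome U V y v = σ (basis b) v) ↔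
        good b = true ∧ F b = y := by
      refine ⟨fun hv => ⟨?_, ?_⟩, fun ⟨hg, hy⟩ v hv => ?_⟩
      · rw [← hflag, ← hv flag flag_ne_reg]; rfl
      · funext j
        rw [← hans, ← hv (.inr (.inl j)) (by rintro _ ⟨⟩)]; rfl
      · rcases v with v | j | ⟨⟨⟩⟩ | k
        · exact absurd rfl (hv v)
        · rw [hans, hy]; rfl
        · exact (hflag.trans hg).symm
        · exact (hanc k).symm
    rw [← mul_ite_zero]
    congr 1
    refine if_congr hcond.symm ?_ rfl
    have e₁ : (Nat.ofBits fun i : Fin n => basis (m := m) (K := K) b (reg (.inl i))) =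
        Nat.ofBits fun i => b (.inl i) := ofBits_extend h fun i => b (.inl i)
    have e₂ : (Nat.ofBits fun i : Fin n => basis (m := m) (K := K) b (reg (.inr i))) =
        Nat.ofBits fun i => b (.inr i) := ofBits_extend h fun i => b (.inr i)
    have e₃ := measuredLeft_outcome (m := m) (K := K) hU V y
    have e₄ := measuredRight_outcome (m := m) (K := K) hV U y
    rw [measuredLeft] at e₃
    rw [measuredRight] at e₄
    simp only [hreg, e₁, e₂, e₃, e₄]

end TrialWire

theorem Comp.exists_const {ι κ I : Type} [Fintype ι] [Fintype κ] [Nonempty I] :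
    ∃ S : Set (Inputs ι κ I → Bool), Comp 2 S ∧ (∀ i, (fun x => x.2 i) ∈ S) ∧
      ∀ b, (fun _ => b) ∈ S := by
  obtain ⟨i⟩ := ‹Nonempty I›
  have h0 := Comp.init (ι := ι) (κ := κ) (I := I)
  have h1 := h0.bin (fun _ _ => true) ⟨i, rfl⟩ ⟨i, rfl⟩
  have h2 := h1.bin (fun _ _ => false) (Set.mem_insert _ _) (Set.mem_insert _ _)
  refine ⟨_, h2, fun i => .inr (.inr ⟨i, rfl⟩), fun b => ?_⟩
  cases b
  · exact .inl rfl
  · exact .inr (.inl rfl)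

/-- The number of auxiliary wires of one round. -/
def flagCost (L : ℕ) : ℕ := 2 + (25 * L + 7 + 2 * mulCost L * L)

/-- The encoding of a pair of residues. -/
def pairBits {p : ℕ} (a x : ZMod p) : Fin (bitLen p) ⊕ Fin (bitLen p) → Bool :=
  Sum.elim (residueBits a) (residueBits x)

open TrialWire in
/-- One round: a circuit whose measured numbers yield `t` with some probability, if the oracle
satisfies `F (a, x) = F (a', x') ↔ x + a t = x' + a' t` for `r`-th roots of unity `a`, `a'`. -/
theorem exists_trial_gates (p : ℕ) [Fact p.Prime] (m r : ℕ) (hr : r < 2 ^ bitLen p) :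
    ∃ l : List (WireGate (Fin (bitLen p) ⊕ Fin (bitLen p)) (Fin m)
        (TrialWire (bitLen p + 4) m (flagCost (bitLen p)))),
      l.length ≤ 2 * bitLen p + (10 * flagCost (bitLen p) + 5) + 1 +
        (bitLen p + 4 + (bitLen p + 4)) * (1 + (bitLen p + 4)) ∧
      ∀ (F : Oracle (Fin (bitLen p) ⊕ Fin (bitLen p)) (Fin m)) (t : ZMod p),
        (∀ a x a' x' : ZMod p, a ^ r = 1 → a' ^ r = 1 →
          (F (pairBits a x) = F (pairBits a' x') ↔ x + a * t = x' + a' * t)) →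
        ((Finset.univ.filter fun a : ZMod p => a ^ r = 1).card : ℝ) ^ 2 / 2 *
          ((1 / 2) ^ bitLen p * (1 / 2) ^ (bitLen p + 4)) ^ 2 * ((p - 1) * p) ≤
        ∑ s, if roundedQuotient p (bitLen p + 4) (measuredLeft s) (measuredRight s) = t.val
          then ‖WireGate.run F l (zeroKet _) s‖ ^ 2 else 0 := by
  have hp : 1 < p := (Fact.out : p.Prime).one_lt
  obtain ⟨hpL, hLp⟩ := size_bounds (p := p) (by omega)
  -- The four extra digits of the registers provide the factor 16 for the phase estimate.
  have hQ : 16 * p ≤ 2 ^ (bitLen p + 4) := by rw [pow_add]; omega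
  have hLn : (bitLen p) ≤ (bitLen p + 4) := by omega
  have hL0 : 0 < bitLen p := by
    by_contra h
    rw [show bitLen p = 0 by omega] at hpL
    omega
  have : Nonempty (Fin (bitLen p) ⊕ Fin (bitLen p)) := ⟨.inl ⟨0, hL0⟩⟩
  obtain ⟨S, hS, hin, hc⟩ := Comp.exists_const (ι := Fin (bitLen p) ⊕ Fin (bitLen p)) (κ := Fin m)
    (I := Fin (bitLen p) ⊕ Fin (bitLen p))
  obtain ⟨S', hS', hf⟩ := Reach.rootOfUnity_test hc (HasNum.ofBits hc _ fun i => hin (.inl i))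
    (HasNum.ofBits hc _ fun i => hin (.inr i)) (fun y => Nat.ofBits_lt_two_pow _)
    (fun y => Nat.ofBits_lt_two_pow _) hp hpL hLp hr
  obtain ⟨τ, ⟨lτ, _, hlen, -, hrun⟩, hτ⟩ := (hS'.2 _ hS).exists_xor (K := flagCost (bitLen p))
    (W := TrialWire (bitLen p + 4) m (flagCost (bitLen p))) anc (low hLn)
    (low_ne_anc hLn) flag (low_ne_flag hLn) anc_ne_flag le_rfl hf
  refine ⟨gates hLn lτ, ?_, fun F t hF => ?_⟩
  · rw [gates, List.length_append, List.length_append, List.length_cons]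
    have h1 := length_hadamardGates_le (ι := Fin (bitLen p) ⊕ Fin (bitLen p)) (κ := Fin m)
      (low (m := m) (K := flagCost (bitLen p)) hLn) flag
    have h2 := length_qftGates_le (ι := Fin (bitLen p) ⊕ Fin (bitLen p)) (κ := Fin m)
      (reg (n := (bitLen p + 4)) (m := m) (K := flagCost (bitLen p))) flag
    rw [Fintype.card_sum, Fintype.card_fin] at h1
    have h3 : lτ.length ≤ 10 * flagCost (bitLen p) + 5 := hlen
    omega
  set M := Finset.univ.filter fun a : ZMod p => a ^ r = 1 with hM
  let Ro := fun u : ZMod p => roundUp p (2 ^ (bitLen p + 4)) u.val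
  have hRo : ∀ u, Ro u < 2 ^ (bitLen p + 4) := fun u => roundUp_lt (ZMod.val_lt u) (by omega)
  let out : ZMod p × ZMod p → TrialWire (bitLen p + 4) m (flagCost (bitLen p)) → Bool := fun vz =>
    outcome (Ro (vz.1 * t)) (Ro vz.1) (F (pairBits 1 vz.2))
  have hdiv : ∀ u, p * Ro u / 2 ^ (bitLen p + 4) = u.val := fun u => mul_roundUp_div _ (by omega) (by omega)
  -- The second number determines `v`, and the answer at `(1, z)` determines `z`; so the
  -- probabilities of these outcomes may be added.
  have hinj : Function.Injective out := by
    rintro ⟨v, z⟩ ⟨v', z'⟩ h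
    have hv : Ro v = Ro v' := by
      rw [← measuredRight_outcome (hRo v) (Ro (v * t)) (F (pairBits 1 z)),
        ← measuredRight_outcome (hRo v') (Ro (v' * t)) (F (pairBits 1 z'))]
      exact congrArg measuredRight h
    have hv' : v = v' := ZMod.val_injective p (by rw [← hdiv, hv, hdiv])
    have hy : F (pairBits 1 z) = F (pairBits 1 z') := by
      funext j
      exact congrFun h (.inr (.inl j))
    have := (hF 1 z 1 z' (one_pow _) (one_pow _)).mp hy
    rw [hv', add_right_cancel this]
  have hamp : ∀ v z : ZMod p, (M.card : ℝ) ^ 2 / 2 * ((1 / 2) ^ (bitLen p) * (1 / 2) ^ (bitLen p + 4)) ^ 2 ≤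
      ‖WireGate.run F (gates hLn lτ) (zeroKet _) (out (v, z))‖ ^ 2 := by
    intro v z
    rw [run_gates hLn lτ F (τ F) (fun ψ => (hrun F ψ).1)
      (fun b => decide ((Nat.ofBits fun i => b (.inl i)) < p ∧ (Nat.ofBits fun i => b (.inr i)) < p ∧
        (Nat.ofBits fun i => b (.inl i)) ^ r % p = 1)) (fun s hs => hτ F s hs)
        (hRo _) (hRo _)]
    -- The strings that survive the flag and the answer `F(1, z)` are exactly the pairs `(a, z + t -
    -- a t)` with `a ∈ M`. On them `(v t) a + v x = v (z + t)` is constant.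
    have hsum : (∑ b : Fin (bitLen p) ⊕ Fin (bitLen p) → Bool,
        if decide ((Nat.ofBits fun i => b (.inl i)) < p ∧ (Nat.ofBits fun i => b (.inr i)) < p ∧
          (Nat.ofBits fun i => b (.inl i)) ^ r % p = 1) = true ∧ F b = F (pairBits 1 z) then
        turn (((Nat.ofBits fun i => b (.inl i) : ℕ) * (Ro (v * t) : ℕ) +
          (Nat.ofBits fun i => b (.inr i) : ℕ) * (Ro v : ℕ)) / 2 ^ (bitLen p + 4)) else 0) =
        ∑ a ∈ M, turn ((a.val * (Ro (v * t) : ℕ) + (z + t - a * t).val * (Ro v : ℕ)) /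
          (2 ^ (bitLen p + 4) : ℕ)) := by
      symm
      have hl : ∀ a x : ZMod p, (Nat.ofBits fun i => pairBits a x (.inl i)) = a.val :=
        fun a x => ofBits_residueBits a
      have hr : ∀ a x : ZMod p, (Nat.ofBits fun i => pairBits a x (.inr i)) = x.val :=
        fun a x => ofBits_residueBits x
      have hpow : ∀ k : ℕ, k ^ r % p = 1 ↔ (k : ZMod p) ^ r = 1 := fun k => by
        have h := ZMod.natCast_eq_natCast_iff' (k ^ r) 1 p
        rw [Nat.mod_eq_of_lt hp, Nat.cast_pow, Nat.cast_one] at h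
        exact h.symm
      refine Finset.sum_of_injOn (fun a => pairBits a (z + t - a * t)) (fun a _ a' _ h => ?_)
        (fun _ _ => Finset.mem_univ _) (fun b _ hb => ?_) (fun a ha => ?_)
      · apply residueBits_injective
        funext i
        exact congrFun h (.inl i)
      · refine if_neg fun ⟨h1, h2⟩ => hb ?_
        obtain ⟨h3, h4, h5⟩ := of_decide_eq_true h1
        rw [hpow] at h5
        have hbb : pairBits ((Nat.ofBits fun i => b (.inl i) : ℕ) : ZMod p)
            ((Nat.ofBits fun i => b (.inr i) : ℕ) : ZMod p) = b := by
          funext i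
          rcases i with i | i
          · exact congrFun (residueBits_natCast_ofBits _ h3) i
          · exact congrFun (residueBits_natCast_ofBits _ h4) i
        refine ⟨((Nat.ofBits fun i => b (.inl i) : ℕ) : ZMod p), by simpa [hM] using h5, ?_⟩
        rw [← hbb, hF _ _ _ _ h5 (one_pow _), one_mul] at h2
        simp only [← h2, add_sub_cancel_right]
        exact hbb
      · have ha' : a ^ r = 1 := by simpa [hM] using ha
        rw [if_pos]
        · rw [hl, hr]; push_cast; rfl
        · refine ⟨decide_eq_true ⟨?_, ?_, ?_⟩, ?_⟩
          · rw [hl]; exact ZMod.val_lt _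
          · rw [hr]; exact ZMod.val_lt _
          · rw [hl, hpow, ZMod.natCast_zmod_val, ha']
          · rw [hF _ _ _ _ ha' (one_pow _)]; ring
    have e : ∀ x : ℂ, ‖(1 / 2) ^ bitLen p * (1 / 2) ^ (bitLen p + 4) * x‖ ^ 2 =
        ((1 / 2) ^ bitLen p * (1 / 2) ^ (bitLen p + 4)) ^ 2 * ‖x‖ ^ 2 := fun x => by
      rw [norm_mul, mul_pow, norm_mul, norm_pow, norm_pow]
      norm_num
    rw [hsum, e, mul_comm]
    exact mul_le_mul_of_nonneg_left (norm_sum_turn_ge hQ (v * t) v (v * (z + t)) M (fun a => a)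
      (fun a => z + t - a * t) fun a _ => by ring) (by positivity)
  calc _ = ∑ vz ∈ (Finset.univ.filter fun v : ZMod p => v ≠ 0) ×ˢ (Finset.univ : Finset (ZMod p)),
        (M.card : ℝ) ^ 2 / 2 * ((1 / 2) ^ (bitLen p) * (1 / 2) ^ (bitLen p + 4)) ^ 2 := by
        rw [Finset.sum_const, Finset.card_product, Finset.filter_ne', Finset.card_erase_of_mem
          (Finset.mem_univ _), Finset.card_univ, ZMod.card, nsmul_eq_mul, Nat.cast_mul,
          Nat.cast_sub hp.le]
        push_cast
        ring
    _ ≤ ∑ vz ∈ (Finset.univ.filter fun v : ZMod p => v ≠ 0) ×ˢ (Finset.univ : Finset (ZMod p)),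
        if roundedQuotient p (bitLen p + 4) (measuredLeft (out vz)) (measuredRight (out vz)) = t.val
          then ‖WireGate.run F (gates hLn lτ) (zeroKet _) (out vz)‖ ^ 2 else 0 := by
        refine Finset.sum_le_sum fun ⟨v, z⟩ hvz => ?_
        rw [if_pos]
        · exact hamp v z
        · have hv : v ≠ 0 := by simpa using hvz
          rw [measuredLeft_outcome (hRo _), measuredRight_outcome (hRo _)]
          exact roundedQuotient_roundUp (by omega) v t hv
    _ = ∑ s ∈ (((Finset.univ.filter fun v : ZMod p => v ≠ 0) ×ˢ
        (Finset.univ : Finset (ZMod p))).image out), _ := by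
        rw [Finset.sum_image hinj.injOn]
    _ ≤ _ := Finset.sum_le_sum_of_subset_of_nonneg (Finset.subset_univ _) fun s _ _ => by
        split_ifs <;> positivity

/-! ### Repetition -/

section Blocks

variable {ι κ V W : Type} [DecidableEq V] [DecidableEq W]

/-- The same gate on other wires. -/
def WireGate.map (f : V ↪ W) : WireGate ι κ V → WireGate ι κ W
  | .ctrl w a h M => .ctrl (f w) (f a) (f.injective.ne h) M
  | .query e => .query (e.trans f)

/-- Gates on the image of `f` act on the tensor factor `φ` only; `χ` is a spectator that does not
see those wires. -/
theorem WireGate.run_map (f : V ↪ W) (F : Oracle ι κ) (l : List (WireGate ι κ V)) (φ : Ket V)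
    (χ : Ket W) (hχ : ∀ s s', (∀ w, (∀ v, w ≠ f v) → s w = s' w) → χ s = χ s') :
    run F (l.map (map f)) (fun s => φ (s ∘ f) * χ s) = fun s => run F l φ (s ∘ f) * χ s := by
  induction l generalizing φ with
  | nil => rfl
  | cons g l ih =>
    rw [List.map_cons, run_cons, run_cons, ← ih]
    congr 1
    cases g with
    | ctrl w a h M =>
      funext s
      have h1 : ∀ z, Function.update s (f w) z ∘ f = Function.update (s ∘ f) w z := fun z =>
        Function.update_comp_eq_of_injective s f.injective w z
      have h2 : ∀ z, χ (Function.update s (f w) z) = χ s := fun z =>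
        hχ _ _ fun v hv => Function.update_of_ne (hv w) _ _
      simp only [map, apply, act, h1, h2, Finset.sum_mul, mul_assoc]
      rfl
    | query e =>
      funext s
      simp only [map, apply]
      have h1 : queryMap (e.trans f) F s ∘ f = queryMap e F (s ∘ f) := by
        funext v
        by_cases hv : ∃ j, v = e (.inr j)
        · obtain ⟨j, rfl⟩ := hv
          exact (queryMap_ans (e.trans f) F s j).trans (queryMap_ans e F (s ∘ f) j).symm
        · push Not at hv
          exact (queryMap_of_ne (e.trans f) F s fun j h => hv j (f.injective h)).trans
            (queryMap_of_ne e F (s ∘ f) hv).symm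
      rw [h1, hχ (queryMap (e.trans f) F s) s fun v hv => queryMap_of_ne _ _ _ fun j => hv _]

/-- Disjoint blocks evolve independently: for each block in turn, the product over the other blocks
is the spectator of `run_map`. -/
theorem WireGate.run_blocks {N : ℕ} (f : Fin N × V ↪ W) (F : Oracle ι κ)
    (l : List (WireGate ι κ V)) (χ : Ket W)
    (hχ : ∀ s s', (∀ w, (∀ v, w ≠ f v) → s w = s' w) → χ s = χ s') (js : List (Fin N))
    (hjs : js.Nodup) (φ : Fin N → Ket V) :
    run F (js.flatMap fun j => l.map (map ⟨fun v => f (j, v), fun v v' h => by simpa using h⟩))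
      (fun s => (∏ i, φ i fun v => s (f (i, v))) * χ s) =
      fun s => (∏ i, (if i ∈ js then run F l (φ i) else φ i) fun v => s (f (i, v))) * χ s := by
  induction js generalizing φ with
  | nil => simp only [List.flatMap_nil, run_nil, List.not_mem_nil, if_false]
  | cons j js ih =>
    rw [List.nodup_cons] at hjs
    rw [List.flatMap_cons, run_append]
    have h1 : ∀ φ : Fin N → Ket V, (fun s : W → Bool => (∏ i, φ i fun v => s (f (i, v))) * χ s) =
        fun s => φ j (fun v => s (f (j, v))) *
          ((∏ i ∈ Finset.univ.erase j, φ i fun v => s (f (i, v))) * χ s) := fun φ => by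
      funext s
      rw [← mul_assoc, Finset.mul_prod_erase Finset.univ (fun i => φ i fun v => s (f (i, v)))
        (Finset.mem_univ j)]
    have h2 := run_map (⟨fun v => f (j, v), fun v v' h => by simpa using h⟩ : V ↪ W) F l (φ j)
      (fun s => (∏ i ∈ Finset.univ.erase j, φ i fun v => s (f (i, v))) * χ s) (by
        intro s s' h
        rw [hχ s s' fun w hw => h w fun v => hw (j, v)]
        congr 1
        refine Finset.prod_congr rfl fun i hi => ?_
        congr 1
        funext v
        refine h _ fun v' hv' => (Finset.mem_erase.mp hi).1 ?_
        exact congrArg Prod.fst (f.injective hv'))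
    have h3 : run F (l.map (map ⟨fun v => f (j, v), fun v v' h => by simpa using h⟩))
        (fun s => (∏ i, φ i fun v => s (f (i, v))) * χ s) =
        fun s => (∏ i, Function.update φ j (run F l (φ j)) i fun v => s (f (i, v))) * χ s := by
      rw [h1, h1]
      refine h2.trans ?_
      funext s
      rw [Function.update_self]
      congr 2
      refine Finset.prod_congr rfl fun i hi => ?_
      rw [Function.update_of_ne (Finset.mem_erase.mp hi).1]
    rw [h3, ih hjs.2]
    funext s
    congr 1
    refine Finset.prod_congr rfl fun i _ => ?_
    rcases eq_or_ne i j with rfl | hij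
    · rw [if_neg hjs.1, if_pos List.mem_cons_self, Function.update_self]
    · simp [hij]

end Blocks

open scoped Classical in
/-- The probability that at least one of `N` independent rounds is good. -/
theorem one_sub_pow_le_sum {X : Type} [Fintype X] (w : X → ℝ) (hw : ∀ x, 0 ≤ w x)
    (hsum : ∑ x, w x = 1) (good : X → Prop) (δ : ℝ) (hδ : δ ≤ ∑ x, if good x then w x else 0)
    (N : ℕ) :
    1 - (1 - δ) ^ N ≤ ∑ s : Fin N → X, if ∃ i, good (s i) then ∏ i, w (s i) else 0 := by
  have hbad : ∑ x, (if good x then 0 else w x) ≤ 1 - δ := by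
    have : ∑ x, (if good x then w x else 0) + ∑ x, (if good x then 0 else w x) = 1 := by
      rw [← Finset.sum_add_distrib, ← hsum]
      exact Finset.sum_congr rfl fun x _ => by split_ifs <;> simp
    linarith
  have h0 : 0 ≤ ∑ x, (if good x then 0 else w x) :=
    Finset.sum_nonneg fun x _ => by split_ifs <;> simp [hw]
  have hall : ∑ s : Fin N → X, ∏ i, w (s i) = 1 := by
    rw [← Fintype.piFinset_univ, ← Finset.prod_univ_sum]
    simp [hsum]
  have hnone : ∑ s : Fin N → X, ∏ i, (if good (s i) then 0 else w (s i)) =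
      (∑ x, (if good x then 0 else w x)) ^ N := by
    have := Finset.prod_univ_sum (fun _ : Fin N => Finset.univ)
      (fun _ x => if good x then 0 else w x)
    rw [Fintype.piFinset_univ] at this
    rw [← this, Finset.prod_const, Finset.card_univ, Fintype.card_fin]
  have hsplit : ∀ s : Fin N → X, (if ∃ i, good (s i) then ∏ i, w (s i) else 0) =
      ∏ i, w (s i) - ∏ i, (if good (s i) then 0 else w (s i)) := by
    intro s
    by_cases hs : ∃ i, good (s i)
    · obtain ⟨i, hi⟩ := hs
      have h : ∏ i, (if good (s i) then 0 else w (s i)) = 0 :=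
        Finset.prod_eq_zero (Finset.mem_univ i) (if_pos hi)
      rw [if_pos ⟨i, hi⟩, h, sub_zero]
    · rw [if_neg hs]
      push Not at hs
      simp [hs]
  simp only [hsplit]
  rw [Finset.sum_sub_distrib, hall, hnone]
  linarith [pow_le_pow_left₀ h0 hbad N]

/-- Compute several bits onto clean output wires. -/
theorem Comp.realize_outputs {ι κ I W : Type} [Fintype ι] [Fintype κ] [DecidableEq W] {K : ℕ}
    (anc : Fin K ↪ W) (inp : I → W) (hdisj : ∀ i k, inp i ≠ anc k) {ο : Type} [Fintype ο]
    (out : ο ↪ W) (hinp : ∀ i j, inp i ≠ out j) (hanc : ∀ k j, anc k ≠ out j)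
    {S : Set (Oracle ι κ × (I → Bool) → Bool)} (hS : Comp K S)
    (f : ο → Oracle ι κ × (I → Bool) → Bool) (hf : ∀ j, f j ∈ S) :
    ∃ τ : Oracle ι κ → Equiv.Perm (W → Bool), Realizable ((10 * K + 5) * Fintype.card ο) τ ∧
      ∀ F s, (∀ k, s (anc k) = false) → ∀ j,
        τ F s (out j) = xor (s (out j)) (f j (F, s ∘ inp)) := by
  classical
  suffices ∀ T : Finset ο, ∃ τ : Oracle ι κ → Equiv.Perm (W → Bool),
      Realizable ((10 * K + 5) * T.card) τ ∧ ∀ F s, (∀ k, s (anc k) = false) →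
        (∀ j ∈ T, τ F s (out j) = xor (s (out j)) (f j (F, s ∘ inp))) ∧
        ∀ w, (∀ j ∈ T, w ≠ out j) → τ F s w = s w by
    obtain ⟨τ, hτ, h⟩ := this Finset.univ
    exact ⟨τ, hτ, fun F s hs j => (h F s hs).1 j (Finset.mem_univ j)⟩
  intro T
  induction T using Finset.induction_on with
  | empty => exact ⟨fun _ => 1, Realizable.one, fun F s _ => by simp⟩
  | insert j T hj ih =>
    obtain ⟨τ, hτ, h⟩ := ih
    obtain ⟨τ', hτ', h'⟩ := hS.exists_xor anc inp hdisj (out j) (fun i => hinp i j)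
      (fun k => hanc k j) le_rfl (hf j)
    refine ⟨fun F => τ' F * τ F, (hτ.mul hτ').mono ?_, fun F s hs => ?_⟩
    · rw [Finset.card_insert_of_notMem hj, mul_add, mul_one]
    have hs' : ∀ k, τ F s (anc k) = false := fun k =>
      ((h F s hs).2 _ fun i _ => hanc k i).trans (hs k)
    have hinp' : τ F s ∘ inp = s ∘ inp := by
      funext i
      exact (h F s hs).2 _ fun j _ => hinp i j
    rw [Equiv.Perm.mul_apply, h' F _ hs', hinp', (h F s hs).2 (out j) fun i hi e =>
      hj (out.injective e ▸ hi)]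
    refine ⟨fun i hi => ?_, fun w hw => ?_⟩
    · rcases eq_or_ne i j with rfl | hij
      · simp
      · rw [Function.update_of_ne (out.injective.ne hij)]
        exact (h F s hs).1 i (Finset.mem_of_mem_insert_of_ne hi hij)
    · rw [Function.update_of_ne (hw j (Finset.mem_insert_self _ _))]
      exact (h F s hs).2 w fun i hi => hw i (Finset.mem_insert_of_mem hi)

open scoped Classical in
/-- Run a circuit `N` times and evaluate all outcomes by a straight-line program. -/
theorem exists_repeated_circuit {ι κ V ο : Type} [Fintype ι] [Fintype κ] [Fintype V]
    [DecidableEq V] [Fintype ο] [DecidableEq ο] (l : List (WireGate ι κ V)) (N K : ℕ)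
    {S : Set (Inputs ι κ (Fin N × V) → Bool)} (hS : Comp K S)
    (f : ο → Inputs ι κ (Fin N × V) → Bool) (hf : ∀ j, f j ∈ S) :
    ∃ C : QCircuit ι κ ο, C.size ≤ N * Fintype.card V + (K + Fintype.card ο) +
        (N * l.length + (10 * K + 5) * Fintype.card ο) ∧
      ∀ F (y : ο → Bool) (good : (V → Bool) → Prop) (δ : ℝ),
        (∀ s : Fin N × V → Bool, (∃ i, good fun v => s (i, v)) → (fun j => f j (F, s)) = y) →
        (δ ≤ ∑ s, if good s then ‖WireGate.run F l (zeroKet V) s‖ ^ 2 else 0) →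
        1 - (1 - δ) ^ N ≤ C.prob F y := by
  let W := (Fin N × V) ⊕ (Fin K ⊕ ο)
  let anc : Fin K ↪ W := Function.Embedding.inl.trans Function.Embedding.inr
  let out : ο ↪ W := Function.Embedding.inr.trans Function.Embedding.inr
  let blk : Fin N × V ↪ W := Function.Embedding.inl
  obtain ⟨τ, ⟨lτ, l', hlen, -, hrun⟩, hτ⟩ := hS.realize_outputs (W := W) anc blk
    (by rintro _ _ ⟨⟩) out (by rintro _ _ ⟨⟩) (by rintro _ _ ⟨⟩) f hf
  obtain ⟨C, hC, hprob⟩ := exists_circuit_of_wireGates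
    (((List.finRange N).flatMap fun j => l.map (WireGate.map
      ⟨fun v => blk (j, v), fun v v' h => by simpa using h⟩)) ++ lτ) out
  refine ⟨C, ?_, fun F y good δ hy hδ => ?_⟩
  · rw [hC, List.length_append]
    have h1 := length_flatMap_le (List.finRange N) (fun j => l.map (WireGate.map (W := W)
      ⟨fun v => blk (j, v), fun v v' h => by simpa using h⟩)) l.length (by simp)
    rw [List.length_finRange] at h1
    have h2 : Fintype.card W = N * Fintype.card V + (K + Fintype.card ο) := by
      simp [W, Fintype.card_sum, Fintype.card_prod]
    omega
  set ψ := WireGate.run F l (zeroKet V) with hψ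
  let χ : Ket W := fun s => if ∀ v, s (.inr v) = false then 1 else 0
  have hzero : zeroKet W = fun s => (∏ i, zeroKet V fun v => s (blk (i, v))) * χ s := by
    funext s
    simp only [zeroKet, Pi.single_apply, χ]
    rw [Finset.prod_ite_zero, ite_zero_mul_ite_zero]
    simp only [Finset.prod_const_one, mul_one]
    refine if_congr ?_ rfl rfl
    simp only [funext_iff, Finset.mem_univ, true_implies]
    refine ⟨fun h => ⟨fun i v => h _, fun v => h _⟩, fun h w => ?_⟩
    rcases w with ⟨i, v⟩ | w
    · exact h.1 i v
    · exact h.2 w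
  have hfinal : ∀ s, WireGate.run F (((List.finRange N).flatMap fun j => l.map (WireGate.map
      ⟨fun v => blk (j, v), fun v v' h => by simpa using h⟩)) ++ lτ) (zeroKet W) (τ F s) =
      (∏ i, ψ fun v => s (blk (i, v))) * χ s := by
    intro s
    rw [WireGate.run_append, hzero, WireGate.run_blocks blk F l χ ?_ _ (List.nodup_finRange N)
      (fun _ => zeroKet V), (hrun F _).1]
    · simp [← hψ]
    · intro s s' h
      have : ∀ v, s (.inr v) = s' (.inr v) := fun v => h _ (by rintro _ ⟨⟩)
      simp only [χ, this]
  have hnorm : ∑ x, ‖ψ x‖ ^ 2 = 1 := by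
    rw [hψ, WireGate.sum_norm_run, zeroKet, Finset.sum_eq_single fun _ => false]
    · simp
    · intro s _ hs
      simp [hs]
    · simp
  -- The evaluation permutes basis states, so reindexing by it expresses the output distribution
  -- through the product state before the evaluation.
  rw [hprob, ← Equiv.sum_comp (τ F)]
  simp only [hfinal]
  -- It suffices to count the states with clean auxiliary and output wires; the remaining terms are
  -- nonnegative.
  let ext : (Fin N → V → Bool) → W → Bool := fun s => Sum.elim (fun iv => s iv.1 iv.2) fun _ => false
  have hext : Function.Injective ext := by
    intro s s' h
    funext i v
    exact congrFun h (.inl (i, v))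
  calc _ ≤ ∑ s : Fin N → V → Bool, if ∃ i, good (s i) then ∏ i, ‖ψ (s i)‖ ^ 2 else 0 :=
        one_sub_pow_le_sum (fun x => ‖ψ x‖ ^ 2) (fun x => by positivity) hnorm good δ hδ N
    _ ≤ ∑ s : Fin N → V → Bool, if (fun j => τ F (ext s) (out j)) = y then
        ‖(∏ i, ψ fun v => ext s (blk (i, v))) * χ (ext s)‖ ^ 2 else 0 := by
        refine Finset.sum_le_sum fun s _ => ?_
        split_ifs with h1 h2 h2
        · have e : χ (ext s) = 1 := if_pos fun _ => rfl
          rw [e, mul_one, norm_prod, Finset.prod_pow]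
          rfl
        · refine absurd ?_ h2
          rw [← hy (ext s ∘ blk) h1]
          funext j
          rw [hτ F (ext s) (fun k => rfl) j]
          exact Bool.false_xor _
        · positivity
        · exact le_rfl
    _ = ∑ s ∈ Finset.univ.image ext, if (fun j => τ F s (out j)) = y then
        ‖(∏ i, ψ fun v => s (blk (i, v))) * χ s‖ ^ 2 else 0 := by
        rw [Finset.sum_image hext.injOn]
    _ ≤ _ := Finset.sum_le_sum_of_subset_of_nonneg (Finset.subset_univ _) fun s _ _ => by
        split_ifs <;> positivity

/-! ### Verification of the measured candidates -/

section Verification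

/-- The encoding of a pair of numbers with `L` digits. -/
def numBits (L a x : ℕ) : Fin L ⊕ Fin L → Bool :=
  Sum.elim (fun i => a.testBit i) (fun i => x.testBit i)

/-- Does the oracle have the same value at `(1, -t)` and at `(a, -a t)`? -/
def verified {L m : ℕ} (F : Oracle (Fin L ⊕ Fin L) (Fin m)) (p a t : ℕ) : Bool :=
  decide (F (numBits L 1 ((p - 1) * t % p)) = F (numBits L a ((p - a) * t % p)))

/-- The values `x + a t` at the two query points differ by `(a - 1) (u - t)`, which vanishes only
for `u = t` since `a ≠ 1`. -/
theorem verified_iff {p : ℕ} [Fact p.Prime] {m r : ℕ}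
    {F : Oracle (Fin (bitLen p) ⊕ Fin (bitLen p)) (Fin m)} {t : ZMod p}
    (hF : ∀ a x a' x' : ZMod p, a ^ r = 1 → a' ^ r = 1 →
      (F (pairBits a x) = F (pairBits a' x') ↔ x + a * t = x' + a' * t))
    {a : ZMod p} (ha : a ^ r = 1) (ha1 : a ≠ 1) {u : ℕ} (hu : u < p) :
    verified F p a.val u = true ↔ u = t.val := by
  have hp : 1 < p := (Fact.out : p.Prime).one_lt
  have key : ∀ b : ZMod p, numBits (bitLen p) b.val ((p - b.val) * u % p) =
      pairBits b (-(b * u)) := by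
    intro b
    have h : (-(b * u) : ZMod p).val = (p - b.val) * u % p := by
      rw [← ZMod.val_natCast]
      congr 1
      rw [Nat.cast_mul, Nat.cast_sub (ZMod.val_lt b).le, ZMod.natCast_self, ZMod.natCast_zmod_val]
      ring
    unfold pairBits residueBits
    rw [h]
    rfl
  have h1 := key 1
  rw [ZMod.val_one] at h1
  rw [verified, decide_eq_true_iff, h1, key a, hF _ _ _ _ (one_pow r) ha]
  have h2 : -(1 * (u : ZMod p)) + 1 * t = -(a * u) + a * t ↔ (u : ZMod p) = t := by
    rw [← sub_eq_zero, show -(1 * (u : ZMod p)) + 1 * t - (-(a * u) + a * t) = (a - 1) * (u - t) by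
      ring, mul_eq_zero, sub_eq_zero, sub_eq_zero]
    simp [ha1]
  rw [h2]
  refine ⟨fun h => ?_, fun h => ?_⟩
  · rw [← h, ZMod.val_natCast_of_lt hu]
  · rw [h, ZMod.natCast_zmod_val]

/-- The number of auxiliary bits for the evaluation of one round. -/
def verifyCost (L n m : ℕ) : ℕ :=
  16 * L * n + 2 * mulCost L * L + 3 * mulCost L + 17 * L + 4 * m + 7 + 2 * L

variable {I : Type}

/-- One step of a running disjunction: `g` collects the digits from earlier rounds, and `s` is the
shift applied to a verified candidate. -/
theorem Reach.verify {L n m : ℕ} {S : Set (Inputs (Fin L ⊕ Fin L) (Fin m) I → Bool)}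
    (hc : ∀ b, (fun _ => b) ∈ S) {U V : Inputs (Fin L ⊕ Fin L) (Fin m) I → ℕ} (hU : HasNum S U)
    (hV : HasNum S V) {p : ℕ} (hLU : ∀ y, U y < 2 ^ n) (hLV : ∀ y, V y < 2 ^ n) (hp : 1 < p)
    (hpL : p < 2 ^ L) {a s : ℕ} (ha : 0 < a) (hs : s ≤ p)
    (g : Fin L → Inputs (Fin L ⊕ Fin L) (Fin m) I → Bool)
    (hg : ∀ j, g j ∈ S) :
    ∃ S', Reach (verifyCost L n m) S S' ∧ ∀ j, (fun y => g j y ||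
      (verified y.1 p a (roundedQuotient p n (U y) (V y)) &&
        ((roundedQuotient p n (U y) (V y) + s) % p).testBit j)) ∈ S' := by
  have hp0 : 0 < p := by omega
  obtain ⟨S₁, h₁, m₁⟩ := HasNum.roundedQuotient hc hU hV hLU hLV hp hpL
  have hc₁ : ∀ b, (fun _ => b) ∈ S₁ := fun b => h₁.1 (hc b)
  have ht : ∀ y, roundedQuotient p n (U y) (V y) < p := fun y => Nat.mod_lt _ hp0
  obtain ⟨S₂, h₂, m₂⟩ := HasNum.mulMod (L := L) hc₁ (HasNum.const hc₁ (p - 1)) m₁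
    (fun _ => by omega) ht hp0 hpL.le
  have hc₂ : ∀ b, (fun _ => b) ∈ S₂ := fun b => h₂.1 (hc₁ b)
  obtain ⟨S₃, h₃, m₃⟩ := HasNum.mulMod (L := L) hc₂ (HasNum.const hc₂ (p - a)) (m₁.mono h₂.1)
    (fun _ => by omega) ht hp0 hpL.le
  have hc₃ : ∀ b, (fun _ => b) ∈ S₃ := fun b => h₃.1 (hc₂ b)
  obtain ⟨S₄, h₄, m₄⟩ := HasNum.addMod (L := L) hc₃ ((m₁.mono h₂.1).mono h₃.1)
    (HasNum.const hc₃ s) (fun y => (ht y).trans hpL) (fun _ => by omega) hp0 hpL.le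
    (fun y => by have := ht y; omega)
  have hc₄ : ∀ b, (fun _ => b) ∈ S₄ := fun b => h₄.1 (hc₃ b)
  obtain ⟨S₅, h₅, m₅⟩ := Reach.query (S := S₄)
    (fun i y => numBits L 1 ((p - 1) * roundedQuotient p n (U y) (V y) % p) i) (by
      rintro (i | i)
      · exact hc₄ _
      · exact h₄.1 (h₃.1 (m₂ i)))
  have hc₅ : ∀ b, (fun _ => b) ∈ S₅ := fun b => h₅.1 (hc₄ b)
  obtain ⟨S₆, h₆, m₆⟩ := Reach.query (S := S₅)
    (fun i y => numBits L a ((p - a) * roundedQuotient p n (U y) (V y) % p) i) (by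
      rintro (i | i)
      · exact hc₅ _
      · exact h₅.1 (h₄.1 (m₃ i)))
  have hc₆ : ∀ b, (fun _ => b) ∈ S₆ := fun b => h₆.1 (hc₅ b)
  obtain ⟨S₇, h₇, m₇⟩ := Reach.forall_eq Finset.univ
    (fun j y => y.1 (fun i => numBits L 1 ((p - 1) * roundedQuotient p n (U y) (V y) % p) i) j)
    (fun j y => y.1 (fun i => numBits L a ((p - a) * roundedQuotient p n (U y) (V y) % p) i) j)
    hc₆ (fun j _ => h₆.1 (m₅ j)) (fun j _ => m₆ j)
  have m₇' : (fun y : Inputs (Fin L ⊕ Fin L) (Fin m) I =>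
      verified y.1 p a (roundedQuotient p n (U y) (V y))) ∈ S₇ := by
    convert m₇ using 2 with y
    simp [verified, funext_iff]
  obtain ⟨S₈, h₈, m₈⟩ := Reach.family (S := S₇) (c := 2) (Finset.univ : Finset (Fin L))
    (fun j y => g j y || (verified y.1 p a (roundedQuotient p n (U y) (V y)) &&
        ((roundedQuotient p n (U y) (V y) + s) % p).testBit j))
    (fun j _ S' hS' => by
      obtain ⟨S₁', h₁', m₁'⟩ := Reach.bin (fun a b => a && b) (hS' m₇')
        (hS' (h₇.1 (h₆.1 (h₅.1 (m₄ j)))))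
      obtain ⟨S₂', h₂', m₂'⟩ := Reach.bin (fun a b => a || b)
        (h₁'.1 (hS' (h₇.1 (h₆.1 (h₅.1 (h₄.1 (h₃.1 (h₂.1 (h₁.1 (hg j)))))))))) m₁'
      exact ⟨S₂', h₁'.trans h₂', m₂'⟩)
  refine ⟨S₈, (((((((h₁.trans h₂).trans h₃).trans h₄).trans h₅).trans h₆).trans h₇).trans h₈).mono ?_,
    fun j => m₈ j (Finset.mem_univ j)⟩
  simp only [Finset.card_univ, Fintype.card_sum, Fintype.card_fin, verifyCost]
  have e : mulCost L = (29 * L + 10) * L := rfl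
  rw [← e]
  omega

/-- The digitwise disjunction over all rounds replaces a search for a successful round. It is
harmless because all verified candidates are equal. -/
theorem Reach.verify_all {L n m N : ℕ} {S : Set (Inputs (Fin L ⊕ Fin L) (Fin m) I → Bool)}
    (hc : ∀ b, (fun _ => b) ∈ S) {U V : Fin N → Inputs (Fin L ⊕ Fin L) (Fin m) I → ℕ}
    (hU : ∀ i, HasNum S (U i)) (hV : ∀ i, HasNum S (V i)) {p : ℕ} (hLU : ∀ i y, U i y < 2 ^ n)
    (hLV : ∀ i y, V i y < 2 ^ n) (hp : 1 < p) (hpL : p < 2 ^ L) {a s : ℕ} (ha : 0 < a) (hs : s ≤ p) :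
    ∃ S', Reach (verifyCost L n m * N) S S' ∧ ∀ j : Fin L, (fun y => decide (∃ i,
      verified y.1 p a (roundedQuotient p n (U i y) (V i y)) = true ∧
        ((roundedQuotient p n (U i y) (V i y) + s) % p).testBit j = true)) ∈ S' := by
  suffices ∀ T : Finset (Fin N), ∃ S', Reach (verifyCost L n m * T.card) S S' ∧
      ∀ j : Fin L, (fun y => decide (∃ i ∈ T,
        verified y.1 p a (roundedQuotient p n (U i y) (V i y)) = true ∧
          ((roundedQuotient p n (U i y) (V i y) + s) % p).testBit j = true)) ∈ S' by
    simpa using this Finset.univ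
  intro T
  induction T using Finset.induction_on with
  | empty => exact ⟨S, Reach.refl S, fun j => by simpa using hc false⟩
  | insert i T hi ih =>
    obtain ⟨S₁, h₁, m₁⟩ := ih
    obtain ⟨S₂, h₂, m₂⟩ := Reach.verify (fun b => h₁.1 (hc b)) ((hU i).mono h₁.1)
      ((hV i).mono h₁.1) (hLU i) (hLV i) hp hpL ha hs _ m₁
    refine ⟨S₂, (h₁.trans h₂).mono ?_, fun j => ?_⟩
    · rw [Finset.card_insert_of_notMem hi, mul_add, mul_one]
    · convert m₂ j using 2 with y
      rw [Bool.eq_iff_iff]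
      simp only [Finset.mem_insert, exists_eq_or_imp, decide_eq_true_iff, Bool.or_eq_true,
        Bool.and_eq_true]
      exact or_comm

end Verification

/-! ### The reconstruction circuit -/

/-- Here and below all costs are bounded by monomials in the one quantity `L + m + 1`, so that they
can be combined by linear arithmetic. -/
theorem mulCost_le (L m : ℕ) : mulCost L ≤ 39 * (L + m + 1) ^ 2 := by
  rw [mulCost]
  nlinarith [Nat.zero_le (L * m), Nat.zero_le m]

theorem flagCost_le (L m : ℕ) : flagCost L ≤ 112 * (L + m + 1) ^ 3 := by
  have h := Nat.mul_le_mul (mulCost_le L m) (show L ≤ L + m + 1 by omega)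
  have h1 : L + m + 1 ≤ (L + m + 1) ^ 3 := Nat.le_self_pow (by norm_num) _
  have e : 39 * (L + m + 1) ^ 2 * (L + m + 1) = 39 * (L + m + 1) ^ 3 := by ring
  rw [e] at h
  have e2 : 2 * mulCost L * L = 2 * (mulCost L * L) := by ring
  rw [flagCost, e2]
  omega

theorem verifyCost_le (L m : ℕ) : verifyCost L (L + 4) m ≤ 289 * (L + m + 1) ^ 3 := by
  have h0 := mulCost_le L m
  have h := Nat.mul_le_mul h0 (show L ≤ L + m + 1 by omega)
  have h1 : L + m + 1 ≤ (L + m + 1) ^ 3 := Nat.le_self_pow (by norm_num) _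
  have h2 : (L + m + 1) ^ 2 ≤ (L + m + 1) ^ 3 := Nat.pow_le_pow_right (by omega) (by norm_num)
  have h3 : L * (L + 4) ≤ (L + m + 1) * (4 * (L + m + 1)) :=
    Nat.mul_le_mul (by omega) (by omega)
  have e : 39 * (L + m + 1) ^ 2 * (L + m + 1) = 39 * (L + m + 1) ^ 3 := by ring
  have e1 : (L + m + 1) * (4 * (L + m + 1)) = 4 * (L + m + 1) ^ 2 := by ring
  have e2 : 2 * mulCost L * L = 2 * (mulCost L * L) := by ring
  have e3 : 16 * L * (L + 4) = 16 * (L * (L + 4)) := by ring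
  rw [e] at h
  rw [e1] at h3
  rw [verifyCost, e2, e3]
  omega

theorem circuit_size_le {N L m V l K : ℕ} (hN : 0 < N)
    (hV : V = L + 4 + (L + 4) + (m + (1 + flagCost L)))
    (hl : l ≤ 2 * L + (10 * flagCost L + 5) + 1 + (L + 4 + (L + 4)) * (1 + (L + 4)))
    (hK : K = 2 + verifyCost L (L + 4) m * N) :
    N * V + (K + L) + (N * l + (10 * K + 5) * L) ≤ 5000 * N * (L + m + 1) ^ 4 := by
  have h1 : L + m + 1 ≤ (L + m + 1) ^ 3 := Nat.le_self_pow (by norm_num) _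
  have h2 : (L + m + 1) ^ 2 ≤ (L + m + 1) ^ 3 := Nat.pow_le_pow_right (by omega) (by norm_num)
  have h3 : (L + m + 1) ^ 3 ≤ (L + m + 1) ^ 4 := Nat.pow_le_pow_right (by omega) (by norm_num)
  have hf := flagCost_le L m
  have hV' : V ≤ 121 * (L + m + 1) ^ 4 := by omega
  have hprod : (L + 4 + (L + 4)) * (1 + (L + 4)) ≤ (8 * (L + m + 1)) * (5 * (L + m + 1)) :=
    Nat.mul_le_mul (by omega) (by omega)
  have e1 : (8 * (L + m + 1)) * (5 * (L + m + 1)) = 40 * (L + m + 1) ^ 2 := by ring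
  rw [e1] at hprod
  have hl' : l ≤ 1168 * (L + m + 1) ^ 4 := by omega
  have hv := Nat.mul_le_mul_right N (verifyCost_le L m)
  have hN3 : 1 * 1 ≤ N * (L + m + 1) ^ 3 := Nat.mul_le_mul hN (Nat.one_le_pow _ _ (by omega))
  have hK' : K ≤ 291 * (N * (L + m + 1) ^ 3) := by
    have e : 289 * (L + m + 1) ^ 3 * N = 289 * (N * (L + m + 1) ^ 3) := by ring
    rw [e] at hv
    omega
  have hKL := Nat.mul_le_mul (show 10 * K + 5 ≤ 2915 * (N * (L + m + 1) ^ 3) by omega)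
    (show L ≤ L + m + 1 by omega)
  have e2 : 2915 * (N * (L + m + 1) ^ 3) * (L + m + 1) = 2915 * (N * (L + m + 1) ^ 4) := by ring
  rw [e2] at hKL
  have hNV := Nat.mul_le_mul_left N hV'
  have hNl := Nat.mul_le_mul_left N hl'
  have h3N := Nat.mul_le_mul_left N h3
  have hL : L ≤ N * (L + m + 1) ^ 4 := by
    calc L ≤ (L + m + 1) ^ 4 := by omega
      _ = 1 * (L + m + 1) ^ 4 := (one_mul _).symm
      _ ≤ _ := Nat.mul_le_mul_right _ hN
  have e3 : N * (121 * (L + m + 1) ^ 4) = 121 * (N * (L + m + 1) ^ 4) := by ring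
  have e4 : N * (1168 * (L + m + 1) ^ 4) = 1168 * (N * (L + m + 1) ^ 4) := by ring
  have e5 : 5000 * N * (L + m + 1) ^ 4 = 5000 * (N * (L + m + 1) ^ 4) := by ring
  rw [e3] at hNV
  rw [e4] at hNl
  rw [e5]
  -- The coefficients add up to `121 + 291 + 1 + 1168 + 2915 = 4496`.
  omega

open TrialWire in
/-- Reconstruction of `t` from an oracle with `F (a, x) = F (a', x') ↔ x + a t = x' + a' t` for
`r`-th roots of unity `a`, `a'`. -/
theorem exists_reconstruction_circuit (p : ℕ) [Fact p.Prime] (m : ℕ) {r N : ℕ}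
    (hr : r < 2 ^ bitLen p) (hN : 0 < N) {a : ZMod p} (ha : a ^ r = 1) (ha1 : a ≠ 1) (ha0 : a ≠ 0)
    (s : ZMod p) {δ : ℝ}
    (hδ : δ ≤ ((Finset.univ.filter fun a : ZMod p => a ^ r = 1).card : ℝ) ^ 2 / 2 *
      ((1 / 2) ^ bitLen p * (1 / 2) ^ (bitLen p + 4)) ^ 2 * ((p - 1) * p)) :
    ∃ C : QCircuit (Fin (bitLen p) ⊕ Fin (bitLen p)) (Fin m) (Fin (bitLen p)),
      C.size ≤ 5000 * N * (bitLen p + m + 1) ^ 4 ∧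
      ∀ (F : Oracle (Fin (bitLen p) ⊕ Fin (bitLen p)) (Fin m)) (t : ZMod p),
        (∀ a x a' x' : ZMod p, a ^ r = 1 → a' ^ r = 1 →
          (F (pairBits a x) = F (pairBits a' x') ↔ x + a * t = x' + a' * t)) →
        1 - (1 - δ) ^ N ≤ C.prob F (residueBits (t - s)) := by
  classical
  have hp : 1 < p := (Fact.out : p.Prime).one_lt
  obtain ⟨hpL, -⟩ := size_bounds (p := p) (by omega)
  obtain ⟨l, hl, hlF⟩ := exists_trial_gates p m r hr
  have : Nonempty (Fin N × TrialWire (bitLen p + 4) m (flagCost (bitLen p))) := ⟨(⟨0, hN⟩, flag)⟩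
  obtain ⟨S, hS, hin, hc⟩ := Comp.exists_const (ι := Fin (bitLen p) ⊕ Fin (bitLen p)) (κ := Fin m)
    (I := Fin N × TrialWire (bitLen p + 4) m (flagCost (bitLen p)))
  obtain ⟨S', hS', hf⟩ := Reach.verify_all (n := bitLen p + 4) (N := N) (p := p) (a := a.val)
    -- A natural number representing `-s`, so that the output is `t - s` rather than `t`.
    (s := p - s.val) hc
    (U := fun i x => measuredLeft fun v => x.2 (i, v))
    (V := fun i x => measuredRight fun v => x.2 (i, v))
    (fun i => HasNum.ofBits hc _ fun j => hin _) (fun i => HasNum.ofBits hc _ fun j => hin _)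
    (fun i y => Nat.ofBits_lt_two_pow _) (fun i y => Nat.ofBits_lt_two_pow _) hp hpL
    (Nat.pos_of_ne_zero fun h => ha0 ((ZMod.val_eq_zero a).mp h)) (by omega)
  obtain ⟨C, hC, hprob⟩ := exists_repeated_circuit l N _ (hS'.2 _ hS) _ hf
  refine ⟨C, hC.trans ?_, fun F t hF => hprob F (residueBits (t - s)) (fun x => roundedQuotient p
    (bitLen p + 4) (measuredLeft x) (measuredRight x) = t.val) _ ?_ ?_⟩
  · rw [Fintype.card_fin]
    exact circuit_size_le hN (by simp) hl rfl
  rotate_left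
  · exact (hδ.trans (hlF F t hF)).trans_eq
      (Finset.sum_congr rfl fun x _ => by congr)
  · rintro x ⟨i, hi⟩
    have hlt : ∀ U V, roundedQuotient p (bitLen p + 4) U V < p := fun U V => Nat.mod_lt _ (by omega)
    have hver : ∀ i, verified F p a.val (roundedQuotient p (bitLen p + 4)
        (measuredLeft fun v => x (i, v)) (measuredRight fun v => x (i, v))) = true ↔
        roundedQuotient p (bitLen p + 4) (measuredLeft fun v => x (i, v))
          (measuredRight fun v => x (i, v)) = t.val := fun i =>
      verified_iff hF ha ha1 (hlt _ _)
    have hval : (t.val + (p - s.val)) % p = (t - s).val := by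
      rw [← ZMod.val_natCast]
      congr 1
      rw [Nat.cast_add, Nat.cast_sub (ZMod.val_lt s).le, ZMod.natCast_self, ZMod.natCast_zmod_val,
        ZMod.natCast_zmod_val]
      ring
    funext j
    simp only
    rw [residueBits, ← hval, Bool.eq_iff_iff, decide_eq_true_iff]
    constructor
    · rintro ⟨i', h1, h2⟩
      rw [hver] at h1
      rwa [h1] at h2
    · intro h
      exact ⟨i, (hver i).mpr hi, by rw [hi]; exact h⟩

/-! ### Subgroups of `ℤ_q ⋉ ℤ_p` -/

namespace QHedral

variable {p q : ℕ}

theorem left_mul (g h : QHedral p q) :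
    (g * h).left.toAdd = g.left.toAdd + ((linearPart p q g : (ZMod p)ˣ) : ZMod p) * h.left.toAdd := rfl

theorem eq_iff_left_linearPart {g h : QHedral p q} :
    g = h ↔ g.left.toAdd = h.left.toAdd ∧ linearPart p q g = linearPart p q h := by
  refine ⟨by rintro rfl; exact ⟨rfl, rfl⟩, fun ⟨h1, h2⟩ => SemidirectProduct.ext h1 ?_⟩
  exact Subtype.ext h2

theorem linearPart_conj (g h : QHedral p q) :
    linearPart p q (g⁻¹ * h * g) = linearPart p q h := by
  rw [map_mul, map_mul, map_inv, mul_right_comm, inv_mul_cancel, one_mul]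

theorem left_pow_translation {g : QHedral p q} (hg : linearPart p q g = 1) (k : ℕ) :
    (g ^ k).left.toAdd = k * g.left.toAdd := by
  induction k with
  | zero => simp
  | succ k ih =>
    rw [pow_succ, left_mul, map_pow, hg, ih, one_pow, Units.val_one, Nat.cast_succ]
    ring

/-- Powers of `g` exhaust the translations. Every commutator is a translation, since linear parts
commute, so it lies in `H`. -/
theorem normal_of_translation_mem [Fact p.Prime] {H : Subgroup (QHedral p q)} {g : QHedral p q}
    (hg : g ∈ H) (hg1 : linearPart p q g = 1) (hg0 : g ≠ 1) : H.Normal := by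
  have hl : g.left.toAdd ≠ 0 := fun h => hg0 (eq_iff_left_linearPart.mpr ⟨h, by rw [hg1, map_one]⟩)
  have hall : ∀ h : QHedral p q, linearPart p q h = 1 → h ∈ H := by
    intro h hh
    have : g ^ (h.left.toAdd / g.left.toAdd).val = h := by
      rw [eq_iff_left_linearPart, left_pow_translation hg1, map_pow, hg1, hh, one_pow, ZMod.natCast_zmod_val,
        div_mul_cancel₀ _ hl]
      exact ⟨rfl, rfl⟩
    rw [← this]
    exact pow_mem hg _
  refine ⟨fun n hn h => ?_⟩
  have h1 : h * n * h⁻¹ * n⁻¹ ∈ H := hall _ (by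
    simp only [map_mul, map_inv]
    rw [mul_comm (linearPart p q h), mul_inv_cancel_right, mul_inv_cancel])
  simpa using mul_mem h1 hn

/-- A non-normal subgroup consists of the maps with linear part in some non-trivial group that fix a
given point. -/
theorem exists_fixed_point [Fact p.Prime] {H : Subgroup (QHedral p q)} (hH : ¬ H.Normal) :
    (∃ a ∈ H.map (linearPart p q), a ≠ 1) ∧ ∃ s : ZMod p, ∀ g, g ∈ H ↔
      linearPart p q g ∈ H.map (linearPart p q) ∧
        g.left.toAdd = s * (1 - (linearPart p q g : (ZMod p)ˣ)) := by
  have htriv : ∀ g ∈ H, linearPart p q g = 1 → g = 1 := fun g hg hg1 => by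
    by_contra h
    exact hH (normal_of_translation_mem hg hg1 h)
  obtain ⟨h₀, hh₀, h1⟩ : ∃ h ∈ H, linearPart p q h ≠ 1 := by
    by_contra! h
    refine hH ?_
    rw [show H = ⊥ from (Subgroup.eq_bot_iff_forall H).mpr fun g hg => htriv g hg (h g hg)]
    infer_instance
  have ha : (1 - (linearPart p q h₀ : (ZMod p)ˣ) : ZMod p) ≠ 0 := fun h =>
    h1 (Units.ext (sub_eq_zero.mp h).symm)
  have hleft : ∀ g ∈ H, g.left.toAdd = h₀.left.toAdd / (1 - (linearPart p q h₀ : (ZMod p)ˣ)) *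
      (1 - (linearPart p q g : (ZMod p)ˣ)) := by
    intro g hg
    -- The commutator is a translation in `H`, hence trivial. Comparing translation parts then shows
    -- that `g` fixes the fixed point of `h₀`.
    have hcomm : g * h₀ = h₀ * g := by
      have h : (h₀ * g)⁻¹ * (g * h₀) = 1 := htriv _
        (mul_mem (inv_mem (mul_mem hh₀ hg)) (mul_mem hg hh₀)) (by
          rw [map_mul, map_inv, map_mul, map_mul, mul_comm (linearPart p q g), inv_mul_cancel])
      exact (inv_mul_eq_one.mp h).symm
    have h := congrArg (fun k : QHedral p q => k.left.toAdd) hcomm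
    simp only [left_mul] at h
    rw [div_mul_eq_mul_div, eq_div_iff ha]
    linear_combination h
  refine ⟨⟨_, ⟨h₀, hh₀, rfl⟩, h1⟩, _, fun g => ⟨fun hg => ⟨⟨g, hg, rfl⟩, hleft g hg⟩, ?_⟩⟩
  rintro ⟨⟨h, hh, e⟩, hg⟩
  have : g = h := eq_iff_left_linearPart.mpr ⟨by rw [hg, hleft h hh, e], e.symm⟩
  rwa [this]

/-- Conjugation by `b` keeps the linear parts and moves the common fixed point from `s` to `b(s)`.
-/
theorem mem_conjSubgroup {H : Subgroup (QHedral p q)} {s : ZMod p} (hs : ∀ g, g ∈ H ↔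
      linearPart p q g ∈ H.map (linearPart p q) ∧
        g.left.toAdd = s * (1 - (linearPart p q g : (ZMod p)ˣ))) (b g : QHedral p q) :
    g ∈ conjSubgroup b H ↔ linearPart p q g ∈ H.map (linearPart p q) ∧
      g.left.toAdd = (b.left.toAdd + (linearPart p q b : (ZMod p)ˣ) * s) *
        (1 - (linearPart p q g : (ZMod p)ˣ)) := by
  have h1 : g ∈ conjSubgroup b H ↔ b⁻¹ * g * b ∈ H := by
    unfold conjSubgroup
    rw [Subgroup.mem_map]
    refine ⟨?_, fun h => ⟨_, h, ?_⟩⟩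
    · rintro ⟨h, hh, rfl⟩
      simpa [mul_assoc] using hh
    · simp [mul_assoc]
  rw [h1, hs, linearPart_conj]
  refine and_congr_right fun _ => ?_
  have h2 : b * (b⁻¹ * g * b) = g * b := by group
  have h3 : b.left.toAdd + (linearPart p q b : (ZMod p)ˣ) * (b⁻¹ * g * b).left.toAdd =
      g.left.toAdd + (linearPart p q g : (ZMod p)ˣ) * b.left.toAdd :=
    congrArg (fun k : QHedral p q => k.left.toAdd) h2
  rw [← (linearPart p q b).isUnit.mul_right_inj]
  constructor <;> intro h
  · linear_combination h - h3
  · linear_combination h + h3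

/-- A map with linear part different from 1 has only one fixed point. So the conjugate determines
the point `b(s)`, which for the translation by `c` is `c + s`. -/
theorem conjSubgroup_translation_eq_iff [Fact p.Prime] {H : Subgroup (QHedral p q)} {s : ZMod p}
    (hs : ∀ g, g ∈ H ↔ linearPart p q g ∈ H.map (linearPart p q) ∧
        g.left.toAdd = s * (1 - (linearPart p q g : (ZMod p)ˣ)))
    (hM : ∃ a ∈ H.map (linearPart p q), a ≠ 1) (b : QHedral p q) (c : ZMod p) :
    conjSubgroup (translation c) H = conjSubgroup b H ↔
      c = b.left.toAdd + (linearPart p q b : (ZMod p)ˣ) * s - s := by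
  have hc : ((translation c : QHedral p q).left.toAdd +
      (linearPart p q (translation c) : (ZMod p)ˣ) * s) = c + s := by
    show c + ((1 : (ZMod p)ˣ) : ZMod p) * s = c + s
    rw [Units.val_one, one_mul]
  constructor
  · intro h
    obtain ⟨a, ⟨k, hk, rfl⟩, ha1⟩ := hM
    have ha : (1 - (linearPart p q k : (ZMod p)ˣ) : ZMod p) ≠ 0 := fun h =>
      ha1 (Units.ext (sub_eq_zero.mp h).symm)
    let g : QHedral p q := ⟨Multiplicative.ofAdd ((c + s) * (1 - (linearPart p q k : (ZMod p)ˣ))),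
      k.right⟩
    have hg : g ∈ conjSubgroup (translation c) H :=
      (mem_conjSubgroup hs _ g).mpr ⟨⟨k, hk, rfl⟩, by rw [hc]; rfl⟩
    rw [h, mem_conjSubgroup hs] at hg
    have h2 := mul_right_cancel₀ ha (hg.2 : (c + s) * (1 - (linearPart p q k : (ZMod p)ˣ)) = _)
    exact eq_sub_of_add_eq h2
  · intro h
    ext g
    rw [mem_conjSubgroup hs, mem_conjSubgroup hs, hc, h, sub_add_cancel]

/-- A hiding function separates the pairs `(a, x)` according to `x + a t`. -/
theorem Hides.apply_pairBits_eq_iff [Fact p.Prime] {H : Subgroup (QHedral p q)} {s : ZMod p}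
    (hs : ∀ g, g ∈ H ↔ linearPart p q g ∈ H.map (linearPart p q) ∧
        g.left.toAdd = s * (1 - (linearPart p q g : (ZMod p)ˣ))) (b : QHedral p q) {m : ℕ}
    {F : Oracle (Fin (bitLen p) ⊕ Fin (bitLen p)) (Fin m)}
    (hF : Hides (fun g : QHedral p q => F g.bits) (conjSubgroup b H)) {a a' : (ZMod p)ˣ}
    (ha : a ∈ H.map (linearPart p q)) (ha' : a' ∈ H.map (linearPart p q)) (x x' : ZMod p) :
    F (pairBits (a : ZMod p) x) = F (pairBits (a' : ZMod p) x') ↔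
      x + a * (b.left.toAdd + (linearPart p q b : (ZMod p)ˣ) * s) =
        x' + a' * (b.left.toAdd + (linearPart p q b : (ZMod p)ˣ) * s) := by
  set t := b.left.toAdd + (linearPart p q b : (ZMod p)ˣ) * s with ht
  obtain ⟨h, hh, rfl⟩ := ha
  obtain ⟨h', hh', rfl⟩ := ha'
  let g : QHedral p q := ⟨Multiplicative.ofAdd x, h.right⟩
  let g' : QHedral p q := ⟨Multiplicative.ofAdd x', h'.right⟩
  have hlin : linearPart p q (g⁻¹ * g') = (linearPart p q h)⁻¹ * linearPart p q h' := by
    rw [map_mul, map_inv]; rfl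
  have key : F g.bits = F g'.bits ↔ _ := hF g g'
  rw [QuotientGroup.eq, mem_conjSubgroup hs, hlin, ← ht] at key
  refine key.trans ?_
  -- For linear parts in `M` the only remaining coset condition is that `g⁻¹ g'` fixes `t`, that is,
  -- `g(t) = g'(t)`.
  rw [and_iff_right (mul_mem (inv_mem (Subgroup.mem_map_of_mem _ hh)) (Subgroup.mem_map_of_mem _ hh'))]
  have h3 : x + (linearPart p q h : (ZMod p)ˣ) * (g⁻¹ * g').left.toAdd = x' :=
    congrArg (fun k : QHedral p q => k.left.toAdd) (mul_inv_cancel_left g g')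
  rw [← (linearPart p q h).isUnit.mul_right_inj]
  have e : ((linearPart p q h : (ZMod p)ˣ) : ZMod p) * (t * (1 - ((linearPart p q h)⁻¹ *
      linearPart p q h' : (ZMod p)ˣ))) =
      t * ((linearPart p q h : (ZMod p)ˣ) - (linearPart p q h' : (ZMod p)ˣ)) := by
    have := Units.mul_inv (linearPart p q h)
    rw [Units.val_mul]
    linear_combination (-t * (linearPart p q h' : (ZMod p)ˣ)) * this
  rw [e]
  constructor <;> intro h
  · linear_combination h3 - h
  · linear_combination h3 - h

theorem le_card [Fact p.Prime] : p ≤ Nat.card (QHedral p q) := by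
  rw [SemidirectProduct.card]
  have h1 : Nat.card (Multiplicative (ZMod p)) = p := by
    rw [Nat.card_congr Multiplicative.toAdd, Nat.card_zmod]
  rw [h1]
  exact Nat.le_mul_of_pos_right _ Nat.card_pos

end QHedral

/-! ### Roots of unity and numerical estimates -/

/-- A finite group of units of a field consists of roots of unity. -/
theorem mem_iff_pow_card_eq_one {p : ℕ} [Fact p.Prime] (M : Subgroup (ZMod p)ˣ) (a : (ZMod p)ˣ) :
    a ∈ M ↔ a ^ Nat.card M = 1 := by
  have hpos : 0 < Nat.card M := Nat.card_pos
  have : NeZero (Nat.card M) := ⟨hpos.ne'⟩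
  have hle : M ≤ rootsOfUnity (Nat.card M) (ZMod p) := fun a ha => by
    rw [mem_rootsOfUnity]
    exact congrArg Subtype.val (pow_card_eq_one' (x := (⟨a, ha⟩ : M)))
  -- A field has at most `r` roots of unity of order dividing `r`, so the inclusion of `M` is an
  -- equality.
  have hcard : Nat.card (rootsOfUnity (Nat.card M) (ZMod p)) ≤ Nat.card M :=
    card_rootsOfUnity (ZMod p) (Nat.card M)
  have e := Subgroup.eq_of_le_of_card_ge hle hcard
  rw [← mem_rootsOfUnity, ← e]

theorem card_le_card_pow_eq_one {p : ℕ} [Fact p.Prime] (M : Subgroup (ZMod p)ˣ) :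
    Nat.card M ≤ (Finset.univ.filter fun a : ZMod p => a ^ Nat.card M = 1).card := by
  classical
  have hc : Nat.card M = (Finset.univ : Finset M).card := by
    rw [Finset.card_univ, Nat.card_eq_fintype_card]
  refine hc.trans_le (Finset.card_le_card_of_injOn (fun a : M => ((a : (ZMod p)ˣ) : ZMod p))
    (fun a _ => ?_) fun a _ b _ h => Subtype.ext (Units.ext h))
  rw [Finset.mem_coe, Finset.mem_filter, ← Units.val_pow_eq_pow_val,
    (mem_iff_pow_card_eq_one M a).mp a.2]
  exact ⟨Finset.mem_univ _, Units.val_one⟩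

/-- The success probability of one round in terms of the index `I`. -/
theorem success_probability_ge {p r I c : ℕ} (hp : 2 ≤ p) (hrI : r * I = p - 1) (hc : r ≤ c) :
    1 / (65536 * I ^ 2 : ℕ) ≤ (c : ℝ) ^ 2 / 2 *
      ((1 / 2) ^ bitLen p * (1 / 2) ^ (bitLen p + 4)) ^ 2 * ((p - 1) * p) := by
  have hI : 0 < I := Nat.pos_of_ne_zero fun h => by rw [h] at hrI; omega
  have hr : 0 < r := Nat.pos_of_ne_zero fun h => by rw [h] at hrI; omega
  have h2 : (2 ^ bitLen p : ℝ) ≤ 2 * p := mod_cast (size_bounds (p := p) (by omega)).2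
  have hI' : (0 : ℝ) < I := mod_cast hI
  have hr' : (0 : ℝ) < r := mod_cast hr
  have hc' : (r : ℝ) ≤ c := mod_cast hc
  have hp' : (2 : ℝ) ≤ p := mod_cast hp
  have e : (r : ℝ) * I = p - 1 := by
    have : ((r * I : ℕ) : ℝ) = ((p - 1 : ℕ) : ℝ) := by rw [hrI]
    rwa [Nat.cast_mul, Nat.cast_sub (by omega), Nat.cast_one] at this
  -- Here `2 ^ bitLen p ≤ 2 p` gives `2 ^ (2 * bitLen p + 4) ≤ 16 (2 p)²`.
  have hhalf : 1 / (64 * (p : ℝ) ^ 2) ≤ (1 / 2 : ℝ) ^ bitLen p * (1 / 2) ^ (bitLen p + 4) := by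
    rw [pow_add, ← mul_assoc, ← pow_add, ← two_mul, pow_mul', one_div_pow,
      show (1 / 2 : ℝ) ^ 4 = 1 / 16 by norm_num, one_div_pow, one_div_mul_one_div]
    refine one_div_le_one_div_of_le (by positivity) ?_
    have := pow_le_pow_left₀ (by positivity) h2 2
    nlinarith
  calc (1 : ℝ) / (65536 * I ^ 2 : ℕ) ≤ (r : ℝ) ^ 2 / 2 * (1 / (64 * (p : ℝ) ^ 2)) ^ 2 * ((p - 1) * p) := by
        push_cast
        rw [← e]
        -- From `p ≤ 2 (p - 1)`; the cube cancels `r³` and turns `8192` into `8192 · 8 = 65536`.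
        have hpI : (p : ℝ) ≤ 2 * (r * I) := by rw [e]; linarith
        have e2 : (r : ℝ) ^ 2 / 2 * (1 / (64 * (p : ℝ) ^ 2)) ^ 2 * (r * I * p) =
            r ^ 3 * I / (8192 * p ^ 3) := by
          field_simp
          norm_num
        rw [e2, div_le_div_iff₀ (by positivity) (by positivity)]
        have h3 := pow_le_pow_left₀ (by positivity) hpI 3
        calc (1 : ℝ) * (8192 * p ^ 3) ≤ 1 * (8192 * (2 * (r * I)) ^ 3) := by linarith
          _ = _ := by ring
    _ ≤ _ := by
        have : (0 : ℝ) ≤ (p - 1) * p := mul_nonneg (by linarith) (by linarith)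
        gcongr

/-- `(1 - 1/n) ^ n ≤ exp (-1) < 1/2`. -/
theorem one_sub_one_div_pow_le (n k : ℕ) (hn : 0 < n) :
    (1 - 1 / (n : ℝ)) ^ (n * (k + 1)) ≤ (1 / 2) ^ k := by
  have hn' : (1 : ℝ) ≤ n := mod_cast hn
  have h0 : 0 ≤ 1 - 1 / (n : ℝ) := sub_nonneg.mpr ((div_le_one (by linarith)).mpr hn')
  have h1 : (1 - 1 / (n : ℝ)) ^ n ≤ 1 / 2 :=
    (Real.one_sub_div_pow_le_exp_neg hn').trans (Real.exp_neg_one_lt_half.le.trans (by norm_num))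
  rw [pow_mul]
  exact (pow_le_pow_left₀ (pow_nonneg h0 _) h1 _).trans
    (pow_le_pow_of_le_one (by norm_num) (by norm_num) (Nat.le_succ k))

/-- The bound `p ≥ 3 > e` makes `log p ≥ 1`, which absorbs the additive constant in `bitLen p ≤ 1 +
log p / log 2`. -/
theorem bitLen_le_log {p : ℕ} (hp : 3 ≤ p) : 1 ≤ Real.log p ∧ (bitLen p : ℝ) ≤ 3 * Real.log p := by
  have hp' : (3 : ℝ) ≤ p := mod_cast hp
  have h1 : 1 ≤ Real.log p := by
    rw [Real.le_log_iff_exp_le (by linarith)]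
    linarith [Real.exp_one_lt_three]
  refine ⟨h1, ?_⟩
  have h2 : (2 ^ bitLen p : ℝ) ≤ 2 * p := mod_cast (size_bounds (p := p) (by omega)).2
  have h3 := Real.log_le_log (by positivity) h2
  rw [Real.log_pow, Real.log_mul (by norm_num) (by linarith)] at h3
  have h4 := Real.log_two_gt_d9
  by_contra! h5
  nlinarith [mul_lt_mul_of_pos_right h5 (show (0 : ℝ) < Real.log 2 by linarith)]

end

theorem theorem2 (A d : ℕ) :
    ∃ B e : ℕ, ∀ (p q : ℕ), p.Prime → q ∣ p - 1 →
      ∀ H : Subgroup (QHedral p q), ¬ H.Normal →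
        ((H.map (QHedral.linearPart p q)).index : ℝ) ≤ A * Real.log p ^ d →
        ∀ m k : ℕ,
          ∃ C : QCircuit (Fin (bitLen p) ⊕ Fin (bitLen p)) (Fin m) (Fin (bitLen p)),
            (C.size : ℝ) ≤ B * (Real.log (Nat.card (QHedral p q)) + m + k) ^ e ∧
            ∀ b : QHedral p q, ∃ c : ZMod p,
              (∀ c' : ZMod p, conjSubgroup (QHedral.translation c') H = conjSubgroup b H ↔
                c' = c) ∧
              ∀ F : (Fin (bitLen p) ⊕ Fin (bitLen p) → Bool) → (Fin m → Bool),
                Hides (fun g : QHedral p q => F g.bits) (conjSubgroup b H) →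
                1 - (1 / 2 : ℝ) ^ k ≤ C.prob F (residueBits c) := by
  -- With `T = log |G| + m + k ≥ 1` one has `index ≤ A T ^ d`, `k + 1 ≤ 2 T` and `bitLen p + m + 1 ≤
  -- 5 T`. Then `1250 = 2 · 5⁴`, and the exponent is `2 d + 1 + 4`.
  refine ⟨5000 * 65536 * 1250 * A ^ 2, 2 * d + 5, fun p q hp _ H hH hindex m k => ?_⟩
  have : Fact p.Prime := ⟨hp⟩
  obtain ⟨⟨a, ha, ha1⟩, s, hs⟩ := QHedral.exists_fixed_point hH
  set M := H.map (QHedral.linearPart p q) with hM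
  have hcard : Nat.card M * M.index = p - 1 := by
    rw [Subgroup.card_mul_index, Nat.card_units, Nat.card_zmod]
  have hp2 := hp.two_le
  have hI : 0 < M.index := Nat.pos_of_ne_zero fun h => by rw [h] at hcard; omega
  -- Nontriviality of `M` also excludes `p = 2`, as the logarithmic bound requires.
  have hr1 : Nat.card M ≠ 1 := fun h => ha1 (by
    rw [Subgroup.card_eq_one] at h
    rw [h] at ha
    exact Subgroup.mem_bot.mp ha)
  have hrp : Nat.card M ≤ p - 1 := hcard ▸ Nat.le_mul_of_pos_right _ hI
  have hr0 : 0 < Nat.card M := Nat.card_pos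
  have hN : 0 < 65536 * M.index ^ 2 := by positivity
  obtain ⟨C, hC, hprob⟩ := exists_reconstruction_circuit p m (r := Nat.card M)
    (N := 65536 * M.index ^ 2 * (k + 1)) (by have := (size_bounds (p := p) (by omega)).1; omega)
    (by positivity) (a := (a : ZMod p))
    (by rw [← Units.val_pow_eq_pow_val, (mem_iff_pow_card_eq_one M a).mp ha, Units.val_one])
    (fun h => ha1 (Units.ext h)) a.ne_zero s
    (success_probability_ge hp2 hcard (card_le_card_pow_eq_one M))
  refine ⟨C, ?_, fun b => ⟨b.left.toAdd + (QHedral.linearPart p q b : (ZMod p)ˣ) * s - s,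
    QHedral.conjSubgroup_translation_eq_iff hs ⟨a, ha, ha1⟩ b, fun F hF => ?_⟩⟩
  · obtain ⟨hlog, hL⟩ := bitLen_le_log (p := p) (by omega)
    have hG : Real.log p ≤ Real.log (Nat.card (QHedral p q)) :=
      Real.log_le_log (by exact_mod_cast hp.pos) (mod_cast QHedral.le_card)
    set T := Real.log (Nat.card (QHedral p q)) + m + k with hT
    have hm : (0 : ℝ) ≤ m := m.cast_nonneg
    have hk : (0 : ℝ) ≤ k := k.cast_nonneg
    have hpT : Real.log p ≤ T := by linarith
    have hIT : (M.index : ℝ) ≤ A * T ^ d := hindex.trans (by gcongr)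
    calc (C.size : ℝ) ≤ ((5000 * (65536 * M.index ^ 2 * (k + 1)) * (bitLen p + m + 1) ^ 4 : ℕ) : ℝ) :=
          mod_cast hC
      _ = 5000 * (65536 * (M.index : ℝ) ^ 2 * (k + 1)) * (bitLen p + m + 1) ^ 4 := by push_cast; ring
      _ ≤ 5000 * (65536 * (A * T ^ d) ^ 2 * (2 * T)) * (5 * T) ^ 4 := by
          gcongr <;> linarith
      _ = _ := by push_cast; ring
  · refine le_trans ?_ (hprob F _ fun a x a' x' h h' => ?_)
    · linarith [one_sub_one_div_pow_le (65536 * M.index ^ 2) k hN]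
    · have hunit : ∀ a : ZMod p, a ^ Nat.card M = 1 → ∃ u : (ZMod p)ˣ, u ∈ M ∧ (u : ZMod p) = a := by
        intro a h
        have h2 := Units.val_ofPowEqOne a (Nat.card M) h hr0.ne'
        refine ⟨Units.ofPowEqOne a (Nat.card M) h hr0.ne', ?_, h2⟩
        rw [mem_iff_pow_card_eq_one]
        exact Units.pow_ofPowEqOne h hr0.ne'
      obtain ⟨u, hu, rfl⟩ := hunit a h
      obtain ⟨u', hu', rfl⟩ := hunit a' h'
      exact QHedral.Hides.apply_pairBits_eq_iff hs b hF hu hu' x x'
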